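/- Let $n\ge 1$. For a convex body $K\subset\mathbb R^{n+1}$ write $h_K(x)=\max_{y\in K}x\cdot y$, let $dS$ be the area measure of $S^n$, and let $C^2_e(S^n)$ be the space of even $C^2$ functions on $S^n$. Let $\mathcal K^2_{+,e}$ be the class of origin-symmetric convex bodies $L$ whose support function is $C^2$ on $S^n$ with $H_L=\nabla^2h_L+h_L\,\mathrm{Id}>0$, and let $U_L$ be the cofactor matrix of $H_L$, so that $U_L^{ij}=H_L^{ij}\det H_L$ with $(H_L^{ij})=H_L^{-1}$. Let $K$ be an origin-symmetric convex body with $C^{-1}\le h_K\le C$ on $S^n$ for some constant $C>0$. Then there are unique finite Borel measures on $S^n$, denoted $$\det H\,dS,\qquad U^{ij}\delta_{ij}\,dS,\qquad U^{ij}u_iu_j\,dS\quad (u\in C^2_e(S^n)),$$ such that, for every sequence $L_k\in\mathcal K^2_{+,e}$ with $h_{L_k}\to h_K$ uniformly on $S^n$, the measures $\det H_{L_k}\,dS$, $U_{L_k}^{ij}\delta_{ij}\,dS$ and $U_{L_k}^{ij}u_iu_j\,dS$ converge weakly to them, respectively. With $h=h_K$, $H^{ij}\det H=U^{ij}$ and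 all integrals taken with respect to these measures, define $$\lambda_{1,e}(-L_K)=\inf_{u}\frac{\int_{S^n}H^{ij}h^2u_iu_j\det H\,dS}{\int_{S^n}(u-\underline u)^2h\det H\,dS},\qquad \underline u=\frac{\int_{S^n}u\,h\det H\,dS}{\int_{S^n}h\det H\,dS},$$ $$\lambda_{1,e}(K)=\inf_{z}\frac{\int_{S^n}H^{ij}z_iz_j\det H\,dS-\int_{S^n}H^{ij}\delta_{ij}z^2\det H\,dS+n\int_{S^n}z^2h^{-1}\det H\,dS}{\int_{S^n}z^2h^{-1}\det H\,dS-\left(\int_{S^n}h\det H\,dS\right)^{-1}\left(\int_{S^n}z\det H\,dS\right)^2},$$ where $u$ and $z$ run over those functions in $C^2_e(S^n)$ for which the denominator is nonzero. Then $$\lambda_{1,e}(-L_K)=\lambda_{1,e}(K).$$ -/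

import Mathlib

open MeasureTheory Filter Topology
open scoped Manifold ContDiff

noncomputable section

namespace HBM

/-- The ambient space `ℝ^{n+1}` with its Euclidean structure. -/
abbrev Amb (n : ℕ) : Type := EuclideanSpace ℝ (Fin (n + 1))

/-- The unit sphere `S^n` of `ℝ^{n+1}`. -/
abbrev Sph (n : ℕ) : Type := Metric.sphere (0 : Amb n) 1

/-- The area measure `dS` of `S^n`. -/
def sphArea (n : ℕ) : Measure (Sph n) := (volume : Measure (Amb n)).toSphere

/-- The support function `h_K(x) = max_{y ∈ K} x · y`, as a function on all of `ℝ^{n+1}`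
(where it is convex and homogeneous of degree one). -/
def supp {n : ℕ} (K : ConvexBody (Amb n)) (x : Amb n) : ℝ :=
  sSup ((fun y : Amb n => inner ℝ x y) '' (K : Set (Amb n)))

/-- `K = -K`. -/
def IsOriginSymmetric {n : ℕ} (K : ConvexBody (Amb n)) : Prop :=
  ∀ x ∈ K, -x ∈ K

/-- The second derivative `D²f(x)(v, w)` of a function on `ℝ^{n+1}`. -/
def hess {n : ℕ} (f : Amb n → ℝ) (x v w : Amb n) : ℝ :=
  fderiv ℝ (fderiv ℝ f) x v w

/-- The class `𝒦²_{+,e}`: origin-symmetric convex bodies whose support function is `C²` away from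
the origin with `∇²h + h Id > 0` on `S^n`. For `x ∈ S^n` the form `∇²h + h Id` on the tangent space
`x^⊥` is the restriction to `x^⊥` of the Hessian `D²h(x)` in `ℝ^{n+1}`. -/
def IsSmoothPosEven {n : ℕ} (L : ConvexBody (Amb n)) : Prop :=
  IsOriginSymmetric L ∧ ContDiffOn ℝ 2 (supp L) {0}ᶜ ∧
    ∀ x : Amb n, ‖x‖ = 1 → ∀ v : Amb n, inner ℝ x v = 0 → v ≠ 0 → 0 < hess (supp L) x v v

/-- The class `C²_e(S^n)` of even `C²` functions on the sphere. -/
def C2Even (n : ℕ) : Set (Sph n → ℝ) :=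
  {u | ContMDiff (𝓡 n) 𝓘(ℝ, ℝ) 2 u ∧ ∀ x : Sph n, u (-x) = u x}

/-- The extension of a function on `S^n` to `ℝ^{n+1} ∖ {0}`, homogeneous of degree zero
(with value `0` at the origin). -/
def radialExt {n : ℕ} (u : Sph n → ℝ) (x : Amb n) : ℝ :=
  if hx : x ≠ 0 then u ⟨‖x‖⁻¹ • x, by simp [norm_smul, hx]⟩ else 0

/-- The components in the standard basis of `ℝ^{n+1}` of the gradient `∇u(x)` on `S^n`, a vector
tangent to `S^n` at `x`: it is the Euclidean gradient at `x` of the extension of `u` which is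
homogeneous of degree zero. -/
def sphGrad {n : ℕ} (u : Sph n → ℝ) (x : Sph n) : Fin (n + 1) → ℝ :=
  fun i => fderiv ℝ (radialExt u) (x : Amb n) (EuclideanSpace.single i 1)

/-- The matrix `A = D²h + dr ⊗ dr` at `x ∈ S^n`, in the standard basis of `ℝ^{n+1}`. In an
orthonormal basis consisting of a tangent frame at `x` followed by `x` itself, it is block diagonal
with blocks `H = ∇²h + h Id` and `1`. -/
def bigHess {n : ℕ} (L : ConvexBody (Amb n)) (x : Sph n) :
    Matrix (Fin (n + 1)) (Fin (n + 1)) ℝ :=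
  Matrix.of fun i j =>
    hess (supp L) (x : Amb n) (EuclideanSpace.single i 1) (EuclideanSpace.single j 1)
      + (x : Amb n) i * (x : Amb n) j

/-- The density `det H` of the surface area measure with respect to `dS`. -/
def areaDensity {n : ℕ} (L : ConvexBody (Amb n)) (x : Sph n) : ℝ :=
  (bigHess L x).det

/-- The density `U^{ij} u_i u_j`, where `U` is the cofactor matrix of `H`
(so `U^{ij} = H^{ij} det H` for invertible `H`). The adjugate of `A` is block diagonal
with blocks `U` and `det H`, and `∇u` is tangent. -/
def energyDensity {n : ℕ} (u : Sph n → ℝ) (L : ConvexBody (Amb n)) (x : Sph n) : ℝ :=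
  sphGrad u x ⬝ᵥ ((bigHess L x).adjugate.mulVec (sphGrad u x))

/-- The density `U^{ij} δ_{ij}`, the trace of the cofactor matrix of `H`; the trace of the adjugate
of `A` is `tr U + det H`. -/
def traceDensity {n : ℕ} (L : ConvexBody (Amb n)) (x : Sph n) : ℝ :=
  (bigHess L x).adjugate.trace - (bigHess L x).det

/-- `μ` is the finite Borel measure on `S^n` to which the measures `d(L_k) dS` converge weakly
whenever `L_k` are bodies of class `𝒦²_{+,e}` whose support functions converge to `h_K`
uniformly on `S^n`. -/
def IsWeakLimitMeasure {n : ℕ} (d : ConvexBody (Amb n) → Sph n → ℝ) (K : ConvexBody (Amb n))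
    (μ : Measure (Sph n)) : Prop :=
  IsFiniteMeasure μ ∧
    ∀ L : ℕ → ConvexBody (Amb n), (∀ k, IsSmoothPosEven (L k)) →
      TendstoUniformlyOn (fun k => supp (L k)) (supp K) atTop (Metric.sphere 0 1) →
      ∀ φ : C(Sph n, ℝ),
        Tendsto (fun k => ∫ x, φ x * d (L k) x ∂(sphArea n)) atTop (𝓝 (∫ x, φ x ∂μ))

/-- The measure which extends `d(K) dS` to bodies that need not be smooth. -/
def limitMeasure {n : ℕ} (d : ConvexBody (Amb n) → Sph n → ℝ) (K : ConvexBody (Amb n)) :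
    Measure (Sph n) :=
  Classical.epsilon (IsWeakLimitMeasure d K)

/-- The measure `det H dS`. -/
def areaMeasure {n : ℕ} (K : ConvexBody (Amb n)) : Measure (Sph n) :=
  limitMeasure areaDensity K

/-- The measure `U^{ij} u_i u_j dS`. -/
def energyMeasure {n : ℕ} (K : ConvexBody (Amb n)) (u : Sph n → ℝ) : Measure (Sph n) :=
  limitMeasure (energyDensity u) K

/-- The measure `U^{ij} δ_{ij} dS`. -/
def traceMeasure {n : ℕ} (K : ConvexBody (Amb n)) : Measure (Sph n) :=
  limitMeasure traceDensity K

/-- The mean `u̲ = (∫ h det H dS)⁻¹ ∫ u h det H dS`. -/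
def wMean {n : ℕ} (K : ConvexBody (Amb n)) (u : Sph n → ℝ) : ℝ :=
  (∫ x, supp K x ∂(areaMeasure K))⁻¹ * ∫ x, u x * supp K x ∂(areaMeasure K)

/-- The numerator `∫ H^{ij} h² u_i u_j det H dS`. -/
def numL {n : ℕ} (K : ConvexBody (Amb n)) (u : Sph n → ℝ) : ℝ :=
  ∫ x, supp K x ^ 2 ∂(energyMeasure K u)

/-- The denominator `∫ (u - u̲)² h det H dS`. -/
def denL {n : ℕ} (K : ConvexBody (Amb n)) (u : Sph n → ℝ) : ℝ :=
  ∫ x, (u x - wMean K u) ^ 2 * supp K x ∂(areaMeasure K)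

/-- The numerator `∫ H^{ij} z_i z_j det H dS - ∫ H^{ij} δ_{ij} z² det H dS + n ∫ z² h⁻¹ det H dS`. -/
def numK {n : ℕ} (K : ConvexBody (Amb n)) (z : Sph n → ℝ) : ℝ :=
  (energyMeasure K z).real Set.univ - ∫ x, z x ^ 2 ∂(traceMeasure K)
    + n * ∫ x, z x ^ 2 * (supp K x)⁻¹ ∂(areaMeasure K)

/-- The denominator `∫ z² h⁻¹ det H dS - (∫ h det H dS)⁻¹ (∫ z det H dS)²`. -/
def denK {n : ℕ} (K : ConvexBody (Amb n)) (z : Sph n → ℝ) : ℝ :=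
  ∫ x, z x ^ 2 * (supp K x)⁻¹ ∂(areaMeasure K)
    - (∫ x, supp K x ∂(areaMeasure K))⁻¹ * (∫ x, z x ∂(areaMeasure K)) ^ 2

/-- `λ_{1,e}(-L_K)`: the infimum of the Rayleigh quotient in `u` over the even `C²` functions `u`
with nonzero denominator. -/
def lambdaL {n : ℕ} (K : ConvexBody (Amb n)) : EReal :=
  ⨅ u ∈ {u ∈ C2Even n | denL K u ≠ 0}, ((numL K u / denL K u : ℝ) : EReal)

/-- `λ_{1,e}(K)`: the infimum of the quotient in `z` over the even `C²` functions `z` with nonzero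
denominator. -/
def lambdaK {n : ℕ} (K : ConvexBody (Amb n)) : EReal :=
  ⨅ z ∈ {z ∈ C2Even n | denK K z ≠ 0}, ((numK K z / denK K z : ℝ) : EReal)

end HBM

end

/-!
Write `h = h_K`. The two Rayleigh quotients are exchanged by the substitution `z = u h`: for smooth
`K`, expanding the gradient of `u h` and integrating by parts gives

`∫ U^{ij} z_i z_j - ∫ U^{ij} δ_{ij} z² = ∫ h² U^{ij} u_i u_j - ∫ u² h U^{ij} (h_{ij} + h δ_{ij})`,

and `U^{ij} (h_{ij} + h δ_{ij}) = n det H`, so that the numerators agree; the denominators agree by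
expanding a square. For a general body `u h` is not of class `C²`. It is replaced by `z_k = u h_k`,
where `h_k → h` are smooth even support functions, and conversely `u` by `u_k = z / h_k`. Both
quotients converge, and since `λ` is an infimum this suffices for the two inequalities.

Functions on the sphere are represented by one-homogeneous functions `f` on `ℝ^{n+1}`. The tangential
form `∇²f + f Id` is then the Hessian `D²f`, completed by `x ⊗ x` to an invertible matrix in the radial
direction. With `aDen f = det (D²f + x ⊗ x)` and `mDen f g = tr (adj (D²f + x ⊗ x) D²g)`, all three
densities `det H`, `U^{ij} δ_{ij}`, `U^{ij} u_i u_j` are linear combinations, with continuous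
coefficients independent of `f`, of `aDen f` and of `mDen f g` for fixed `g` (`traceDensity_eq`,
`sq_mul_eDen`).

* *Integration by parts* (`integral_mul_mDen_comm`): `∫ φ mDen f v = ∫ v mDen f φ`. The Jacobian
  determinant of a compactly supported vector field has integral zero
  (`integral_det_fderiv_eq_zero`). This is applied to `η (∇f + s φ ∇v) + τ X`, with `X` a radial
  field, and the coefficient of `s τ` is integrated in polar coordinates. Derivatives in `s`, `τ` are
  taken by interpolation of polynomials (`interpDeriv`), as finite sums of values, which makes their
  exchange with integrals and limits trivial.

* *Weak convergence* (`IsPosBdd.convergesNear_aDen`, `IsPosBdd.convergesNear_mDen`). By symmetry the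
  first variation of `vol f = ∫ f aDen f` in direction `w` is `(n + 1) ∫ w aDen f`, so `vol` is
  monotone. Being also homogeneous, it converges as `f` tends uniformly to a positive `h`. The
  integrals `∫ g aDen f` and `∫ φ mDen f g` are recovered by interpolation from the values of `vol` and
  `aDen` at `f + t g`, `t ≥ 0`, and continuous test functions are reached by density. The limits are
  represented by measures (Riesz–Markov–Kakutani). In the same way the joint limit of
  `∫ φ mDen f g` as `f, g → h` is `n` times the limit of `∫ φ aDen f`
  (`IsPosBdd.tendsto_integral_mul_mDen_prod`); this replaces `U^{ij} (h_{ij} + h δ_{ij}) = n det H` in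
  the non-smooth case.

* *Approximation* (`IsOriginSymmetric.hasSmoothApprox`): `h` is a uniform limit of the functions
  `(∑ |x · y_j| ^ p) ^ (1 / p) + ε |x|`, with `y_j` running over a fine finite net of `K` and `p` a
  large even number.
-/

noncomputable section

namespace HBM

/-! ### Polynomial functions and interpolation -/

/-- A real function which is a polynomial of degree at most `N`. -/
def IsPolyDeg (N : ℕ) (p : ℝ → ℝ) : Prop :=
  ∃ P : Polynomial ℝ, P.natDegree ≤ N ∧ ∀ t, p t = P.eval t

/-- A linear functional on polynomials of degree at most `N` is a fixed linear combination of the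
values at any `N + 1` nodes. -/
theorem exists_interpolation_weights (N : ℕ) (ν : ℕ → ℝ) (hν : Function.Injective ν)
    (T : Polynomial ℝ →ₗ[ℝ] ℝ) :
    ∃ w : ℕ → ℝ, ∀ P : Polynomial ℝ, P.natDegree ≤ N →
      ∑ i ∈ Finset.range (N + 1), w i * P.eval (ν i) = T P := by
  refine ⟨fun i => T (Lagrange.basis (Finset.range (N + 1)) ν i), fun P hP => ?_⟩
  have hdeg : P.degree < (Finset.range (N + 1)).card := by
    rw [Finset.card_range]
    exact lt_of_le_of_lt Polynomial.degree_le_natDegree (by exact_mod_cast Nat.lt_succ_of_le hP)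
  conv_rhs => rw [Lagrange.eq_interpolate (hν.injOn) hdeg]
  rw [Lagrange.interpolate_apply, map_sum]
  refine Finset.sum_congr rfl fun i _ => ?_
  rw [← Polynomial.smul_eq_C_mul, map_smul, smul_eq_mul, mul_comm]

/-- The derivative at `0` of a polynomial function of bounded degree is a fixed combination of its
values at natural numbers. -/
theorem exists_derivWeights (N : ℕ) :
    ∃ w : ℕ → ℝ, ∀ (p : ℝ → ℝ) (d : ℝ), IsPolyDeg N p → HasDerivAt p d 0 →
      ∑ i ∈ Finset.range (N + 1), w i * p i = d := by
  obtain ⟨w, hw⟩ := exists_interpolation_weights N (fun i => (i : ℝ)) Nat.cast_injective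
    ((Polynomial.leval (0 : ℝ)).comp Polynomial.derivative)
  refine ⟨w, fun p d ⟨P, hP, hpP⟩ hd => ?_⟩
  have h1 : p = fun t => P.eval t := funext hpP
  rw [h1] at hd ⊢
  rw [hw P hP, hd.unique (P.hasDerivAt 0)]
  rfl

/-- Weights computing the derivative at `0` of a polynomial of degree at most `N` from its values
at `0, …, N`. -/
def derivWeight (N : ℕ) : ℕ → ℝ := (exists_derivWeights N).choose

/-- The derivative at `0` of a polynomial function of degree at most `N`, computed from its values
at `0, …, N`. Being a finite sum, it commutes with integrals and with limits. -/
def interpDeriv (N : ℕ) (p : ℝ → ℝ) : ℝ := ∑ i ∈ Finset.range (N + 1), derivWeight N i * p i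

theorem interpDeriv_eq {N : ℕ} {p : ℝ → ℝ} {d : ℝ} (hp : IsPolyDeg N p) (hd : HasDerivAt p d 0) :
    interpDeriv N p = d :=
  (exists_derivWeights N).choose_spec p d hp hd

theorem IsPolyDeg.differentiable {N : ℕ} {p : ℝ → ℝ} (hp : IsPolyDeg N p) :
    Differentiable ℝ p := by
  obtain ⟨P, -, h⟩ := hp
  rw [funext h]
  exact P.differentiable

theorem IsPolyDeg.affine_mul {N : ℕ} {p : ℝ → ℝ} (hp : IsPolyDeg N p) (a b : ℝ) :
    IsPolyDeg (N + 1) fun t => (a + t * b) * p t := by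
  obtain ⟨P, hP, h⟩ := hp
  refine ⟨(Polynomial.C a + Polynomial.X * Polynomial.C b) * P, ?_, fun t => by simp [h, mul_comm t]⟩
  refine Polynomial.natDegree_mul_le.trans ?_
  have : (Polynomial.C a + Polynomial.X * Polynomial.C b : Polynomial ℝ).natDegree ≤ 1 := by
    compute_degree
  omega

/-- Integration in a parameter preserves polynomials: each coefficient is a combination of values
at nodes. -/
theorem IsPolyDeg.integral {X : Type*} [MeasurableSpace X] {μ : Measure X} {N : ℕ}
    {p : X → ℝ → ℝ} (hp : ∀ x, IsPolyDeg N (p x)) (hi : ∀ t, Integrable (fun x => p x t) μ) :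
    IsPolyDeg N fun t => ∫ x, p x t ∂μ := by
  have key : ∀ k, ∃ w : ℕ → ℝ, ∀ P : Polynomial ℝ, P.natDegree ≤ N →
      ∑ i ∈ Finset.range (N + 1), w i * P.eval (i : ℝ) = P.coeff k := fun k => by
    simpa using exists_interpolation_weights N (fun i => (i : ℝ)) Nat.cast_injective
      (Polynomial.lcoeff ℝ k)
  choose w hw using key
  refine ⟨∑ k ∈ Finset.range (N + 1), Polynomial.C (∑ i ∈ Finset.range (N + 1),
    w k i * ∫ x, p x i ∂μ) * Polynomial.X ^ k, ?_, fun t => ?_⟩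
  · refine Polynomial.natDegree_sum_le_of_forall_le _ _ fun k hk => ?_
    exact (Polynomial.natDegree_C_mul_X_pow_le _ _).trans (by simpa [Nat.lt_succ_iff] using hk)
  · have h1 : ∀ x, p x t = ∑ k ∈ Finset.range (N + 1), (∑ i ∈ Finset.range (N + 1),
        w k i * p x i) * t ^ k := fun x => by
      obtain ⟨P, hP, h⟩ := hp x
      rw [h t, Polynomial.eval_eq_sum_range' (Nat.lt_succ_of_le hP)]
      refine Finset.sum_congr rfl fun k _ => ?_
      rw [← hw k P hP]
      simp [h]
    simp_rw [h1]
    rw [integral_finsetSum]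
    · rw [Polynomial.eval_finsetSum]
      refine Finset.sum_congr rfl fun k _ => ?_
      rw [integral_mul_const,
        integral_finsetSum _ fun (i : ℕ) _ => (hi (i : ℝ)).const_mul (w k i)]
      simp [integral_const_mul, Polynomial.eval_finsetSum]
    · intro k _
      refine Integrable.mul_const ?_ _
      exact integrable_finsetSum _ fun i _ => (hi i).const_mul (w k i)

/-- Differentiation under the integral sign needs no domination for polynomial integrands. -/
theorem hasDerivAt_integral_of_isPolyDeg {X : Type*} [MeasurableSpace X] {μ : Measure X} {N : ℕ}
    {p : X → ℝ → ℝ} {d : X → ℝ} (hp : ∀ x, IsPolyDeg N (p x))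
    (hi : ∀ t, Integrable (fun x => p x t) μ) (hd : ∀ x, HasDerivAt (p x) (d x) 0) :
    HasDerivAt (fun t => ∫ x, p x t ∂μ) (∫ x, d x ∂μ) 0 := by
  have h1 := IsPolyDeg.integral hp hi
  have h2 := (h1.differentiable 0).hasDerivAt
  have h3 : ∫ x, d x ∂μ = deriv (fun t => ∫ x, p x t ∂μ) 0 := by
    rw [← interpDeriv_eq h1 h2]
    simp_rw [← fun x => interpDeriv_eq (hp x) (hd x)]
    simp only [interpDeriv]
    rw [integral_finsetSum _ fun (i : ℕ) _ => (hi (i : ℝ)).const_mul (derivWeight N i)]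
    simp [integral_const_mul]
  rw [h3]
  exact h2

theorem isPolyDeg_const (N : ℕ) (c : ℝ) : IsPolyDeg N fun _ => c :=
  ⟨Polynomial.C c, by simp, fun t => by simp⟩

theorem interpDeriv_const (N : ℕ) (c : ℝ) : interpDeriv N (fun _ => c) = 0 :=
  interpDeriv_eq (isPolyDeg_const N c) (hasDerivAt_const _ _)

theorem interpDeriv_const_mul (N : ℕ) (c : ℝ) (p : ℝ → ℝ) :
    interpDeriv N (fun t => c * p t) = c * interpDeriv N p := by
  simp only [interpDeriv, Finset.mul_sum]
  exact Finset.sum_congr rfl fun i _ => by ring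

theorem interpDeriv_sub (N : ℕ) (p q : ℝ → ℝ) :
    interpDeriv N (fun t => p t - q t) = interpDeriv N p - interpDeriv N q := by
  simp only [interpDeriv, mul_sub, Finset.sum_sub_distrib]

theorem interpDeriv_comm (N : ℕ) (p : ℝ → ℝ → ℝ) :
    interpDeriv N (fun t => interpDeriv N (p t))
      = interpDeriv N fun s => interpDeriv N fun t => p t s := by
  simp only [interpDeriv, Finset.mul_sum]
  rw [Finset.sum_comm]
  refine Finset.sum_congr rfl fun i _ => Finset.sum_congr rfl fun j _ => by ring

theorem integrable_interpDeriv {X : Type*} [MeasurableSpace X] {μ : Measure X} (N : ℕ)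
    {p : ℝ → X → ℝ} (hp : ∀ t, Integrable (p t) μ) :
    Integrable (fun x => interpDeriv N fun t => p t x) μ :=
  integrable_finsetSum _ fun i _ => (hp i).const_mul _

theorem integral_interpDeriv {X : Type*} [MeasurableSpace X] {μ : Measure X} (N : ℕ)
    {p : ℝ → X → ℝ} (hp : ∀ t, Integrable (p t) μ) :
    ∫ x, interpDeriv N (fun t => p t x) ∂μ = interpDeriv N fun t => ∫ x, p t x ∂μ := by
  simp only [interpDeriv]
  rw [integral_finsetSum _ fun (i : ℕ) _ => (hp (i : ℝ)).const_mul (derivWeight N i)]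
  simp [integral_const_mul]

/-! ### Determinants along lines -/

section Matrix

open Matrix

variable {ι : Type*} [Fintype ι]

theorem vecMulVec_mul_self (θ : ι → ℝ) (hθ : θ ⬝ᵥ θ = 1) :
    vecMulVec θ θ * vecMulVec θ θ = vecMulVec θ θ := by
  rw [vecMulVec_mul_vecMulVec, hθ, one_smul]

theorem mul_vecMulVec_eq_zero {A : Matrix ι ι ℝ} {θ : ι → ℝ}
    (hA : A *ᵥ θ = 0) : A * vecMulVec θ θ = 0 := by
  rw [mul_vecMulVec, hA, zero_vecMulVec]

variable [DecidableEq ι]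

theorem isPolyDeg_det (A B : Matrix ι ι ℝ) :
    IsPolyDeg (Fintype.card ι) fun t => (A + t • B).det := by
  refine ⟨_, Polynomial.natDegree_det_X_add_C_le B A, fun t => ?_⟩
  rw [← Polynomial.coe_evalRingHom, RingHom.map_det]
  refine congrArg Matrix.det (Matrix.ext fun i j => ?_)
  simp [add_comm, mul_comm t]

/-- Cramer's rule, summed over the rows: the linear term of the determinant at `M`. -/
theorem trace_adjugate_mul (M B : Matrix ι ι ℝ) :
    (M.adjugate * B).trace = ∑ i, (M.updateRow i (B i)).det := by
  rw [Matrix.trace_mul_comm, Matrix.trace]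
  refine Finset.sum_congr rfl fun i _ => ?_
  have h := congrFun (Matrix.cramer_eq_adjugate_mulVec Mᵀ (B i)) i
  rw [Matrix.cramer_transpose_apply] at h
  rw [h, ← Matrix.adjugate_transpose, Matrix.mulVec_transpose]
  simp [Matrix.mul_apply, Matrix.vecMul, dotProduct]

/-- Jacobi's formula along a line. -/
theorem hasDerivAt_det (M B : Matrix ι ι ℝ) :
    HasDerivAt (fun t : ℝ => (M + t • B).det) (M.adjugate * B).trace 0 := by
  let D : ContinuousMultilinearMap ℝ (fun _ : ι => ι → ℝ) ℝ :=
    { Matrix.detRowAlternating.toMultilinearMap with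
      cont := continuous_id.matrix_det (A := fun x : ι → ι → ℝ => (Matrix.of x)) }
  let F : ℝ → ι → ι → ℝ := fun t i j => M i j + t * B i j
  have h1 : HasDerivAt F (fun i j => B i j) 0 := by
    refine hasDerivAt_pi.2 fun i => hasDerivAt_pi.2 fun j => ?_
    simpa [F] using ((hasDerivAt_id (0 : ℝ)).mul_const (B i j)).const_add (M i j)
  have h2 := (D.hasFDerivAt (F 0)).comp_hasDerivAt (0 : ℝ) h1
  have h0 : F 0 = M := by ext i j; simp [F]
  have h3 : D.linearDeriv (F 0) (fun i j => B i j) = (M.adjugate * B).trace := by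
    rw [trace_adjugate_mul, ContinuousMultilinearMap.linearDeriv_apply, h0]
    rfl
  rw [h3] at h2
  exact h2

theorem interpDeriv_det {N : ℕ} (hN : N = Fintype.card ι) (M B : Matrix ι ι ℝ) :
    interpDeriv N (fun t => (M + t • B).det) = (M.adjugate * B).trace :=
  interpDeriv_eq (hN ▸ isPolyDeg_det M B) (hasDerivAt_det M B)

theorem det_one_add_smul_vecMulVec (c : ℝ) (θ : ι → ℝ) (hθ : θ ⬝ᵥ θ = 1) :
    (1 + c • vecMulVec θ θ : Matrix ι ι ℝ).det = 1 + c := by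
  have h := det_one_add_replicateCol_mul_replicateRow (ι := Unit) (c • θ) θ
  rw [← vecMulVec_eq, smul_vecMulVec] at h
  rw [h, dotProduct_smul, hθ, smul_eq_mul, mul_one]

variable {A : Matrix ι ι ℝ} {θ : ι → ℝ}

/-- For `A θ = 0` the determinant of `A + β θ ⊗ θ` is `β` times the determinant of `A` on `θ^⊥`. -/
theorem det_add_smul_vecMulVec (hA : A *ᵥ θ = 0) (hθ : θ ⬝ᵥ θ = 1) (β : ℝ) :
    (A + β • vecMulVec θ θ).det = β * (A + vecMulVec θ θ).det := by
  have h : A + β • vecMulVec θ θ = (A + vecMulVec θ θ) * (1 + (β - 1) • vecMulVec θ θ) := by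
    rw [mul_add, mul_one, Matrix.mul_smul, add_mul, mul_vecMulVec_eq_zero hA, vecMulVec_mul_self θ hθ,
      zero_add, sub_smul, one_smul]
    abel
  rw [h, det_mul, det_one_add_smul_vecMulVec _ _ hθ]
  ring

theorem det_smul_add_vecMulVec {n : ℕ} (hn : Fintype.card ι = n + 1) (hA : A *ᵥ θ = 0)
    (hθ : θ ⬝ᵥ θ = 1) {c : ℝ} (hc : c ≠ 0) :
    (c • A + vecMulVec θ θ).det = c ^ n * (A + vecMulVec θ θ).det := by
  have h : c • A + vecMulVec θ θ = c • (A + c⁻¹ • vecMulVec θ θ) := by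
    rw [smul_add, smul_inv_smul₀ hc]
  rw [h, det_smul, det_add_smul_vecMulVec hA hθ, hn, pow_succ]
  field_simp

/-- `θ` is an eigenvector of the adjugate of `A + θ ⊗ θ` if `A θ = 0`. -/
theorem adjugate_mulVec_of_ker (hA : A *ᵥ θ = 0) (hθ : θ ⬝ᵥ θ = 1) :
    (A + vecMulVec θ θ).adjugate *ᵥ θ = (A + vecMulVec θ θ).det • θ := by
  have h : (A + vecMulVec θ θ) *ᵥ θ = θ := by
    rw [add_mulVec, hA, zero_add, vecMulVec_mulVec, hθ]
    simp
  calc _ = (A + vecMulVec θ θ).adjugate *ᵥ ((A + vecMulVec θ θ) *ᵥ θ) := by rw [h]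
    _ = _ := by rw [mulVec_mulVec, adjugate_mul, smul_mulVec, one_mulVec]

theorem trace_adjugate_mul_vecMulVec (hA : A *ᵥ θ = 0) (hθ : θ ⬝ᵥ θ = 1) :
    ((A + vecMulVec θ θ).adjugate * vecMulVec θ θ).trace = (A + vecMulVec θ θ).det := by
  rw [mul_vecMulVec, adjugate_mulVec_of_ker hA hθ, trace_vecMulVec, smul_dotProduct, hθ]
  simp

/-- Euler's identity for the determinant of `A` on `θ^⊥`, which is homogeneous of degree `n`. -/
theorem trace_adjugate_mul_self {n : ℕ} (hn : Fintype.card ι = n + 1)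
    (hA : A *ᵥ θ = 0) (hθ : θ ⬝ᵥ θ = 1) :
    ((A + vecMulVec θ θ).adjugate * A).trace = n * (A + vecMulVec θ θ).det := by
  have h : ((A + vecMulVec θ θ).adjugate * (A + vecMulVec θ θ)).trace
      = (n + 1) * (A + vecMulVec θ θ).det := by
    rw [adjugate_mul, trace_smul, trace_one, hn]
    push_cast
    rw [smul_eq_mul, mul_comm]
  rw [mul_add, trace_add, trace_adjugate_mul_vecMulVec hA hθ] at h
  linarith

/-- If `M` is symmetric, the derivative of the determinant in the direction of a rank one matrix
`y ⊗ w` is symmetric in `y` and `w`. -/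
theorem trace_adjugate_mul_vecMulVec_comm {M : Matrix ι ι ℝ} (hM : M.IsSymm) (y w : ι → ℝ) :
    (M.adjugate * vecMulVec y w).trace = (M.adjugate * vecMulVec w y).trace := by
  rw [← trace_transpose, transpose_mul, transpose_vecMulVec, trace_mul_comm, adjugate_transpose,
    hM.eq]

end Matrix

/-! ### The integral of a Jacobian determinant -/

section Jacobian

variable {E : Type*} [NormedAddCommGroup E] [NormedSpace ℝ E] [FiniteDimensional ℝ E]

/-- The determinant of `1 + s A` does not vanish for `s ∈ [0, t]` and is `1` at `s = 0`. -/
theorem det_one_add_smul_pos (A : E →L[ℝ] E) {t : ℝ} (ht : 0 ≤ t) (hA : t * ‖A‖ < 1) :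
    0 < (1 + t • A : E →L[ℝ] E).det := by
  have hne : ∀ s ∈ Set.Icc (0 : ℝ) t, (1 + s • A : E →L[ℝ] E).det ≠ 0 := by
    intro s hs h0
    have hlt : s * ‖A‖ < 1 := lt_of_le_of_lt (by gcongr; exact hs.2) hA
    obtain ⟨x, hx, hx0⟩ := Submodule.exists_mem_ne_zero_of_ne_bot
      (LinearMap.bot_lt_ker_of_det_eq_zero (f := ((1 + s • A : E →L[ℝ] E) : E →ₗ[ℝ] E)) h0).ne'
    have h1 : x = -(s • A x) := by
      have : x + s • A x = 0 := by simpa using hx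
      exact eq_neg_of_add_eq_zero_left this
    have h2 : ‖x‖ ≤ s * ‖A‖ * ‖x‖ := by
      calc ‖x‖ = ‖s • A x‖ := by conv_lhs => rw [h1, norm_neg]
        _ = s * ‖A x‖ := by rw [norm_smul, Real.norm_of_nonneg hs.1]
        _ ≤ s * (‖A‖ * ‖x‖) := by gcongr; exacts [hs.1, A.le_opNorm x]
        _ = _ := by ring
    have h3 : 0 < ‖x‖ := norm_pos_iff.2 hx0
    nlinarith
  by_contra hneg
  have hcont : ContinuousOn (fun s : ℝ => (1 + s • A : E →L[ℝ] E).det) (Set.Icc 0 t) :=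
    (ContinuousLinearMap.continuous_det.comp (by fun_prop)).continuousOn
  obtain ⟨s, hs, hs0⟩ := intermediate_value_Icc' ht hcont
    (show (0 : ℝ) ∈ Set.Icc _ _ by
      refine ⟨not_lt.1 hneg, ?_⟩
      simp [ContinuousLinearMap.det])
  exact hne s hs hs0

variable [MeasurableSpace E] [BorelSpace E] (μ : Measure E) [μ.IsAddHaarMeasure]

/-- A small compactly supported perturbation of the identity permutes every ball containing the
support, so its Jacobian determinant integrates to the volume of the ball. -/
theorem setIntegral_det_one_add_smul_fderiv {ψ : E → E} (hψ : ContDiff ℝ 1 ψ) {R : ℝ}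
    (hR : ∀ x, x ∉ Metric.closedBall (0 : E) R → ψ x = 0) {K : NNReal} (hK : LipschitzWith K ψ)
    {t : ℝ} (ht : 0 ≤ t) (htK : t * K < 1) :
    ∫ x in Metric.closedBall (0 : E) R, (1 + t • fderiv ℝ ψ x : E →L[ℝ] E).det ∂μ
      = μ.real (Metric.closedBall (0 : E) R) := by
  set B := Metric.closedBall (0 : E) R
  set Φ : E → E := fun x => x + t • ψ x with hΦ
  have happ : ApproximatesLinearOn Φ ((ContinuousLinearEquiv.refl ℝ E : E ≃L[ℝ] E) : E →L[ℝ] E)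
      Set.univ (Real.toNNReal t * K) := by
    intro x _ y _
    have h1 : Φ x - Φ y - (x - y) = t • (ψ x - ψ y) := by
      simp only [hΦ, smul_sub]; abel
    simp only [ContinuousLinearEquiv.coe_refl, ContinuousLinearMap.coe_id', id_eq]
    rw [h1, norm_smul, Real.norm_of_nonneg ht, NNReal.coe_mul, Real.coe_toNNReal t ht, mul_assoc]
    exact mul_le_mul_of_nonneg_left (hK.norm_sub_le x y) ht
  have hN : Subsingleton E ∨ (Real.toNNReal t * K) <
      ‖((ContinuousLinearEquiv.refl ℝ E).symm : E →L[ℝ] E)‖₊⁻¹ := by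
    rcases subsingleton_or_nontrivial E with h | h
    · exact Or.inl h
    · right
      have : ‖((ContinuousLinearEquiv.refl ℝ E).symm : E →L[ℝ] E)‖₊ = 1 := by
        simp
      rw [this, inv_one]
      rw [← NNReal.coe_lt_coe, NNReal.coe_mul, Real.coe_toNNReal t ht]
      exact htK
  have hinj : Function.Injective Φ := fun x y h =>
    happ.injOn hN (Set.mem_univ x) (Set.mem_univ y) h
  have hsurj : Function.Surjective Φ := happ.surjective hN
  have hout : ∀ x, x ∉ B → Φ x = x := fun x hx => by simp [hΦ, hR x hx]
  have himg : Φ '' B = B := by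
    apply Set.Subset.antisymm
    · rintro _ ⟨x, hx, rfl⟩
      by_contra h
      exact h (by rwa [hinj (hout _ h)])
    · intro y hy
      obtain ⟨x, rfl⟩ := hsurj y
      refine ⟨x, ?_, rfl⟩
      by_contra h
      exact h (by rwa [hout x h] at hy)
  have hder : ∀ x ∈ B, HasFDerivWithinAt Φ (1 + t • fderiv ℝ ψ x) B x := fun x _ => by
    have h := ((hψ.differentiable one_ne_zero) x).hasFDerivAt
    exact ((hasFDerivAt_id x).add (h.const_smul t)).hasFDerivWithinAt
  have hch := integral_image_eq_integral_abs_det_fderiv_smul μ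
    Metric.isClosed_closedBall.measurableSet hder hinj.injOn (fun _ => (1 : ℝ))
  rw [himg] at hch
  simp only [smul_eq_mul, mul_one, integral_const, MeasurableSet.univ, measureReal_restrict_apply,
    Set.univ_inter] at hch
  rw [hch]
  refine integral_congr_ae (Eventually.of_forall fun x => ?_)
  refine (abs_of_pos (det_one_add_smul_pos _ ht (lt_of_le_of_lt ?_ htK))).symm
  gcongr
  exact norm_fderiv_le_of_lipschitz ℝ hK

/-- The Jacobian determinant of a compactly supported `C¹` vector field has integral zero. The
integral of `det (s + Dψ)` over a large ball is the polynomial `s ^ N` times the volume of the ball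
for all large `s`, hence also for `s = 0`. -/
theorem integral_det_fderiv_eq_zero [Nontrivial E] {ψ : E → E} (hψ : ContDiff ℝ 1 ψ)
    (hc : HasCompactSupport ψ) : ∫ x, (fderiv ℝ ψ x).det ∂μ = 0 := by
  obtain ⟨R, hR⟩ := hc.isCompact.isBounded.subset_closedBall (0 : E)
  obtain ⟨K, hK⟩ := hψ.lipschitzWith_of_hasCompactSupport hc one_ne_zero
  set B := Metric.closedBall (0 : E) R
  set N := Module.finrank ℝ E
  have hNpos : 0 < N := Module.finrank_pos
  let b := Module.finBasis ℝ E
  let A : E → Matrix (Fin N) (Fin N) ℝ := fun x =>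
    LinearMap.toMatrix b b (fderiv ℝ ψ x : E →ₗ[ℝ] E)
  have hdet : ∀ (s : ℝ) x, (s • (1 : E →L[ℝ] E) + fderiv ℝ ψ x).det
      = (A x + s • (1 : Matrix (Fin N) (Fin N) ℝ)).det := by
    intro s x
    rw [ContinuousLinearMap.det, ← LinearMap.det_toMatrix b]
    congr 1
    simp [A, add_comm]
  have hcont : ∀ s : ℝ, Continuous fun x => (s • (1 : E →L[ℝ] E) + fderiv ℝ ψ x).det := fun s =>
    ContinuousLinearMap.continuous_det.comp
      (continuous_const.add (hψ.continuous_fderiv one_ne_zero))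
  have hint : ∀ s : ℝ, IntegrableOn (fun x => (s • (1 : E →L[ℝ] E) + fderiv ℝ ψ x).det) B μ :=
    fun s => (hcont s).continuousOn.integrableOn_compact (isCompact_closedBall _ _)
  -- Interpolation nodes `s` beyond the Lipschitz constant, so that `1 + s⁻¹ Dψ` is invertible.
  let ν : ℕ → ℝ := fun i => K + 1 + i
  have hν : Function.Injective ν := fun i j h => by simpa [ν] using h
  have hνpos : ∀ i, 0 < ν i := fun i => by positivity
  obtain ⟨w, hw⟩ := exists_interpolation_weights N ν hν (Polynomial.leval (0 : ℝ))
  have hzero : ∀ x, x ∉ B → fderiv ℝ ψ x = 0 := fun x hx => by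
    have : x ∉ tsupport (fderiv ℝ ψ) := fun h => hx (hR (tsupport_fderiv_subset ℝ h))
    exact image_eq_zero_of_notMem_tsupport this
  have h1 : ∫ x, (fderiv ℝ ψ x).det ∂μ = ∫ x in B, (fderiv ℝ ψ x).det ∂μ := by
    refine (setIntegral_eq_integral_of_forall_compl_eq_zero fun x hx => ?_).symm
    rw [hzero x hx]
    simp [ContinuousLinearMap.det]
  have h2 : ∀ x, (fderiv ℝ ψ x).det = ∑ i ∈ Finset.range (N + 1),
      w i * (ν i • (1 : E →L[ℝ] E) + fderiv ℝ ψ x).det := fun x => by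
    obtain ⟨P, hP, hPe⟩ := isPolyDeg_det (A x) 1
    rw [Fintype.card_fin] at hP
    have := hdet 0 x
    rw [zero_smul, zero_add] at this
    simp only at hPe
    rw [this, hPe 0]
    have h3 := hw P hP
    simp only [Polynomial.leval_apply] at h3
    rw [← h3]
    refine Finset.sum_congr rfl fun i _ => ?_
    rw [hdet, hPe]
  have h3 : ∀ i, ∫ x in B, (ν i • (1 : E →L[ℝ] E) + fderiv ℝ ψ x).det ∂μ
      = ν i ^ N * μ.real B := fun i => by
    have hK1 : (ν i)⁻¹ * K < 1 := by
      rw [inv_mul_lt_iff₀ (hνpos i)]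
      simp only [ν]
      have : (0 : ℝ) ≤ i := by positivity
      linarith
    rw [← setIntegral_det_one_add_smul_fderiv μ hψ
      (fun x hx => image_eq_zero_of_notMem_tsupport fun h => hx (hR h)) hK
      (inv_nonneg.2 (hνpos i).le) hK1, ← integral_const_mul]
    refine integral_congr_ae (Eventually.of_forall fun x => ?_)
    have h4 : ν i • (1 : E →L[ℝ] E) + fderiv ℝ ψ x
        = ν i • (1 + (ν i)⁻¹ • fderiv ℝ ψ x : E →L[ℝ] E) := by
      rw [smul_add, smul_inv_smul₀ (hνpos i).ne']
    simp only [h4]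
    rw [ContinuousLinearMap.det, ContinuousLinearMap.det, ← LinearMap.det_smul]
    rfl
  rw [h1]
  simp_rw [h2]
  rw [integral_finsetSum _ fun i _ => (hint (ν i)).const_mul (w i)]
  simp_rw [integral_const_mul, h3]
  have h5 := hw (Polynomial.X ^ N) (by simp)
  simp only [Polynomial.eval_pow, Polynomial.eval_X, Polynomial.leval_apply,
    zero_pow hNpos.ne'] at h5
  simp_rw [← mul_assoc]
  rw [← Finset.sum_mul, h5, zero_mul]

end Jacobian

/-! ### Homogeneous functions and their Hessian matrices -/

section Homogeneous

open Matrix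

variable {n : ℕ}

/-- Functions on `ℝ^{n+1}` which are positively homogeneous of degree one and `C²` away from the
origin. Their restrictions to the sphere are exactly the `C²` functions there. -/
structure IsHomC2 (f : Amb n → ℝ) : Prop where
  hom : ∀ t : ℝ, 0 < t → ∀ x, f (t • x) = t * f x
  smooth : ContDiffOn ℝ 2 f {0}ᶜ

/-- The matrix of second derivatives `D²f(x)` in the standard basis. -/
def hessM (f : Amb n → ℝ) (x : Amb n) : Matrix (Fin (n + 1)) (Fin (n + 1)) ℝ :=
  Matrix.of fun i j => hess f x (EuclideanSpace.single i 1) (EuclideanSpace.single j 1)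

/-- The matrix `x ⊗ x`. -/
def radM (x : Amb n) : Matrix (Fin (n + 1)) (Fin (n + 1)) ℝ := vecMulVec x.ofLp x.ofLp

/-- The coordinates of the differential. -/
def gradV (f : Amb n → ℝ) (x : Amb n) : Fin (n + 1) → ℝ :=
  fun i => fderiv ℝ f x (EuclideanSpace.single i 1)

theorem eventually_ne_zero {x : Amb n} (hx : x ≠ 0) : ∀ᶠ y in 𝓝 x, y ≠ 0 :=
  isOpen_compl_singleton.mem_nhds hx

theorem IsHomC2.contDiffAt {f : Amb n → ℝ} (hf : IsHomC2 f) {x : Amb n} (hx : x ≠ 0) :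
    ContDiffAt ℝ 2 f x :=
  hf.smooth.contDiffAt (isOpen_compl_singleton.mem_nhds hx)

theorem differentiableAt_fderiv {f : Amb n → ℝ} {x : Amb n} (hf : ContDiffAt ℝ 2 f x) :
    DifferentiableAt ℝ (fderiv ℝ f) x :=
  (hf.fderiv_right (m := 1) (by norm_num)).differentiableAt one_ne_zero

theorem eventually_differentiableAt {f : Amb n → ℝ} {x : Amb n} (hf : ContDiffAt ℝ 2 f x) :
    ∀ᶠ y in 𝓝 x, DifferentiableAt ℝ f y :=
  (hf.eventually (by simp)).mono fun _ h => h.differentiableAt two_ne_zero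

theorem hess_comm {f : Amb n → ℝ} {x : Amb n} (hf : ContDiffAt ℝ 2 f x) (v w : Amb n) :
    hess f x v w = hess f x w v :=
  (hf.isSymmSndFDerivAt (by simp)) v w

theorem hessM_isSymm {f : Amb n → ℝ} {x : Amb n} (hf : ContDiffAt ℝ 2 f x) :
    (hessM f x).IsSymm := by
  ext i j
  exact hess_comm hf _ _

theorem radM_isSymm (x : Amb n) : (radM x).IsSymm := by
  rw [Matrix.IsSymm, radM, transpose_vecMulVec]

theorem hess_congr {f g : Amb n → ℝ} {x : Amb n} (h : f =ᶠ[𝓝 x] g) (v w : Amb n) :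
    hess f x v w = hess g x v w := by
  rw [hess, hess, h.fderiv.fderiv_eq]

theorem hess_add {f g : Amb n → ℝ} {x : Amb n} (hf : ContDiffAt ℝ 2 f x)
    (hg : ContDiffAt ℝ 2 g x) (v w : Amb n) :
    hess (fun y => f y + g y) x v w = hess f x v w + hess g x v w := by
  have h : fderiv ℝ (fun y => f y + g y) =ᶠ[𝓝 x] fun y => fderiv ℝ f y + fderiv ℝ g y := by
    filter_upwards [eventually_differentiableAt hf, eventually_differentiableAt hg] with y h1 h2
    exact fderiv_add h1 h2
  rw [hess, h.fderiv_eq,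
    fderiv_fun_add (differentiableAt_fderiv hf) (differentiableAt_fderiv hg)]
  rfl

/-- The Leibniz rule for second derivatives. -/
theorem hess_mul {f g : Amb n → ℝ} {x : Amb n} (hf : ContDiffAt ℝ 2 f x)
    (hg : ContDiffAt ℝ 2 g x) (v w : Amb n) :
    hess (fun y => f y * g y) x v w = f x * hess g x v w + g x * hess f x v w
      + fderiv ℝ f x v * fderiv ℝ g x w + fderiv ℝ g x v * fderiv ℝ f x w := by
  have h : fderiv ℝ (fun y => f y * g y) =ᶠ[𝓝 x]
      fun y => f y • fderiv ℝ g y + g y • fderiv ℝ f y := by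
    filter_upwards [eventually_differentiableAt hf, eventually_differentiableAt hg] with y h1 h2
    exact fderiv_mul h1 h2
  have hf1 := hf.differentiableAt two_ne_zero
  have hg1 := hg.differentiableAt two_ne_zero
  rw [hess, h.fderiv_eq, fderiv_fun_add (hf1.fun_smul (differentiableAt_fderiv hg))
    (hg1.fun_smul (differentiableAt_fderiv hf)), fderiv_fun_smul hf1 (differentiableAt_fderiv hg),
    fderiv_fun_smul hg1 (differentiableAt_fderiv hf)]
  simp [hess]
  ring

theorem hess_const_mul {f : Amb n → ℝ} {x : Amb n} (hf : ContDiffAt ℝ 2 f x) (c : ℝ)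
    (v w : Amb n) : hess (fun y => c * f y) x v w = c * hess f x v w := by
  rw [hess_mul contDiffAt_const hf]
  simp [hess]

theorem fderiv_of_homogeneous {F : Type*} [NormedAddCommGroup F] [NormedSpace ℝ F]
    {f : Amb n → F} {c : ℝ} {t : ℝ} (ht : t ≠ 0) (h : ∀ x, f (t • x) = c • f x) (x : Amb n) :
    fderiv ℝ f (t • x) = (t⁻¹ * c) • fderiv ℝ f x := by
  have h1 := fderiv_comp_smul (𝕜 := ℝ) (f := f) (x := x) (c := t)
  have h2 : (fun y => f (t • y)) = fun y => c • f y := funext h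
  rw [h2] at h1
  have h3 : fderiv ℝ (fun y => c • f y) x = c • fderiv ℝ f x :=
    congrFun (fderiv_const_smul_field (𝕜 := ℝ) (f := f) c) x
  rw [mul_smul, ← h3, h1, inv_smul_smul₀ ht]

namespace IsHomC2

variable {f g : Amb n → ℝ}

theorem fderiv_smul (hf : IsHomC2 f) {t : ℝ} (ht : 0 < t) (x : Amb n) :
    fderiv ℝ f (t • x) = fderiv ℝ f x := by
  rw [fderiv_of_homogeneous ht.ne' (c := t) (fun y => by rw [hf.hom t ht, smul_eq_mul]),
    inv_mul_cancel₀ ht.ne', one_smul]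

theorem hess_smul (hf : IsHomC2 f) {t : ℝ} (ht : 0 < t) (x v w : Amb n) :
    hess f (t • x) v w = t⁻¹ * hess f x v w := by
  rw [hess, fderiv_of_homogeneous ht.ne' (c := 1)
    (fun y => by rw [hf.fderiv_smul ht, one_smul]), mul_one]
  rfl

theorem hessM_smul (hf : IsHomC2 f) {t : ℝ} (ht : 0 < t) (x : Amb n) :
    hessM f (t • x) = t⁻¹ • hessM f x := by
  ext i j
  exact hf.hess_smul ht x _ _

/-- The differential is homogeneous of degree zero, so its derivative in the radial direction
vanishes. -/
theorem hess_self_left (hf : IsHomC2 f) {x : Amb n} (hx : x ≠ 0) (w : Amb n) :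
    hess f x x w = 0 := by
  have h1 : HasDerivAt (fun t : ℝ => x + t • x) x 0 := by
    simpa using ((hasDerivAt_id (0 : ℝ)).smul_const x).const_add x
  have h2 : HasDerivAt (fun t : ℝ => fderiv ℝ f (x + t • x)) (fderiv ℝ (fderiv ℝ f) x x) 0 := by
    have := (differentiableAt_fderiv (hf.contDiffAt hx)).hasFDerivAt
    refine HasFDerivAt.comp_hasDerivAt (0 : ℝ) ?_ h1
    simpa using this
  have h3 : (fun t : ℝ => fderiv ℝ f (x + t • x)) =ᶠ[𝓝 0] fun _ => fderiv ℝ f x := by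
    filter_upwards [eventually_gt_nhds (show (-1 : ℝ) < 0 by norm_num)] with t ht
    rw [show x + t • x = (1 + t) • x by rw [add_smul, one_smul], hf.fderiv_smul (by linarith)]
  have h4 := (h2.congr_of_eventuallyEq h3.symm).unique (hasDerivAt_const (0 : ℝ) (fderiv ℝ f x))
  rw [hess, h4]
  rfl

theorem hessM_mulVec_self (hf : IsHomC2 f) {x : Amb n} (hx : x ≠ 0) :
    hessM f x *ᵥ x.ofLp = 0 := by
  ext i
  have h : hess f x (EuclideanSpace.single i 1) x = 0 := by
    rw [hess_comm (hf.contDiffAt hx), hf.hess_self_left hx]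
  have hx1 : x = ∑ j, x.ofLp j • (EuclideanSpace.single j (1 : ℝ) : Amb n) := by
    conv_lhs => rw [← (EuclideanSpace.basisFun (Fin (n + 1)) ℝ).sum_repr x]
    simp
  simp only [mulVec, dotProduct, Pi.zero_apply, hessM, of_apply]
  rw [← h, hess]
  conv_rhs => rw [congrArg (fderiv ℝ (fderiv ℝ f) x (EuclideanSpace.single i 1)) hx1, map_sum]
  refine Finset.sum_congr rfl fun j _ => ?_
  rw [map_smul, smul_eq_mul, mul_comm]
  rfl

theorem continuousOn_hess (hf : IsHomC2 f) (v w : Amb n) :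
    ContinuousOn (fun x => hess f x v w) {0}ᶜ := by
  have h1 : ContDiffOn ℝ 1 (fderiv ℝ f) {0}ᶜ :=
    hf.smooth.fderiv_of_isOpen isOpen_compl_singleton (by norm_num)
  have h2 := h1.continuousOn_fderiv_of_isOpen isOpen_compl_singleton le_rfl
  exact (h2.clm_apply continuousOn_const).clm_apply continuousOn_const

theorem add (hf : IsHomC2 f) (hg : IsHomC2 g) : IsHomC2 fun x => f x + g x where
  hom t ht x := by rw [hf.hom t ht, hg.hom t ht, mul_add]
  smooth := hf.smooth.add hg.smooth

theorem const_mul (hf : IsHomC2 f) (c : ℝ) : IsHomC2 fun x => c * f x where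
  hom t ht x := by rw [hf.hom t ht]; ring
  smooth := contDiffOn_const.mul hf.smooth

theorem hessM_add (hf : IsHomC2 f) (hg : IsHomC2 g) {x : Amb n} (hx : x ≠ 0) :
    hessM (fun y => f y + g y) x = hessM f x + hessM g x := by
  ext i j
  exact hess_add (hf.contDiffAt hx) (hg.contDiffAt hx) _ _

theorem hessM_const_mul (hf : IsHomC2 f) (c : ℝ) {x : Amb n} (hx : x ≠ 0) :
    hessM (fun y => c * f y) x = c • hessM f x := by
  ext i j
  exact hess_const_mul (hf.contDiffAt hx) c _ _

end IsHomC2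

theorem isHomC2_norm : IsHomC2 (fun x : Amb n => ‖x‖) where
  hom t ht x := by rw [norm_smul, Real.norm_of_nonneg ht.le]
  smooth := fun x hx => (contDiffAt_norm ℝ hx).contDiffWithinAt

theorem fderiv_norm_apply {x : Amb n} (hx : x ≠ 0) (v : Amb n) :
    fderiv ℝ (fun y : Amb n => ‖y‖) x v = ‖x‖⁻¹ * inner ℝ x v := by
  have h1 : DifferentiableAt ℝ (fun y : Amb n => ‖y‖) x :=
    (contDiffAt_norm ℝ (n := 1) hx).differentiableAt one_ne_zero
  have h2 : fderiv ℝ (fun y : Amb n => ‖y‖ ^ 2) x v = 2 * inner ℝ x v := by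
    rw [fderiv_norm_sq_apply]; simp
  have h3 : fderiv ℝ (fun y : Amb n => ‖y‖ ^ 2) x v
      = 2 * ‖x‖ * fderiv ℝ (fun y : Amb n => ‖y‖) x v := by
    rw [fderiv_fun_pow 2 h1]; simp
  have h4 : ‖x‖ ≠ 0 := norm_ne_zero_iff.2 hx
  field_simp
  nlinarith

theorem hess_norm {x : Amb n} (hx : ‖x‖ = 1) (v w : Amb n) :
    hess (fun y : Amb n => ‖y‖) x v w = inner ℝ v w - inner ℝ x v * inner ℝ x w := by
  have hx0 : x ≠ 0 := by rintro rfl; simp at hx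
  have hc : ContDiffAt ℝ 2 (fun y : Amb n => ‖y‖) x := contDiffAt_norm ℝ hx0
  have h1 := hess_mul hc hc v w
  have h2 : hess (fun y : Amb n => ‖y‖ * ‖y‖) x v w = 2 * inner ℝ v w := by
    have h3 : fderiv ℝ (fun y : Amb n => ‖y‖ * ‖y‖) = fun y => (2 : ℝ) • innerSL ℝ y := by
      ext y
      simp_rw [← pow_two]
      rw [fderiv_norm_sq_apply]
      simp
    rw [hess, h3]
    have h4 : HasFDerivAt (fun y : Amb n => (2 : ℝ) • innerSL ℝ y) ((2 : ℝ) • innerSL ℝ) x :=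
      ((innerSL ℝ).hasFDerivAt (x := x)).const_smul (2 : ℝ)
    rw [h4.fderiv]
    simp only [_root_.smul_apply, smul_eq_mul]
    rw [innerSL_apply_apply]
  rw [h2, fderiv_norm_apply hx0, fderiv_norm_apply hx0, hx] at h1
  linarith

theorem hessM_norm {x : Amb n} (hx : ‖x‖ = 1) : hessM (fun y : Amb n => ‖y‖) x = 1 - radM x := by
  ext i j
  rw [hessM, of_apply, hess_norm hx]
  simp [radM, vecMulVec_apply, Matrix.one_apply, EuclideanSpace.inner_single_right, eq_comm]

theorem dotProduct_self_of_norm {x : Amb n} (hx : ‖x‖ = 1) : x.ofLp ⬝ᵥ x.ofLp = 1 := by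
  have h := EuclideanSpace.real_norm_sq_eq x
  rw [hx, one_pow] at h
  rw [h, dotProduct]
  exact Finset.sum_congr rfl fun i _ => (pow_two _).symm

end Homogeneous

/-! ### Symmetry of the mixed area form -/

section Symmetry

open Matrix

section Algebra

variable {ι : Type*} [Fintype ι] [DecidableEq ι] {A V : Matrix ι ι ℝ} {θ : ι → ℝ}

/-- Among the second derivatives of a radial function only the radial one contributes to the
mixed determinant with matrices annihilating `θ`. -/
theorem interpDeriv_trace_adjugate_radial {N : ℕ} (hN : N = Fintype.card ι) (hA : A *ᵥ θ = 0)
    (hV : V *ᵥ θ = 0) (hθ : θ ⬝ᵥ θ = 1) (κ γ : ℝ) :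
    interpDeriv N (fun τ =>
        ((A + τ • (κ • (1 - vecMulVec θ θ) + γ • vecMulVec θ θ)).adjugate * V).trace)
      = γ * ((A + vecMulVec θ θ).adjugate * V).trace := by
  set P := vecMulVec θ θ
  have hP : P *ᵥ θ = θ := by
    simp only [P]; rw [vecMulVec_mulVec, hθ]; simp
  have h1 : ∀ τ : ℝ, ((A + τ • (κ • (1 - P) + γ • P)).adjugate * V).trace
      = interpDeriv N fun s => ((A + s • V) + τ • (κ • (1 - P) + γ • P)).det := fun τ => by
    rw [← interpDeriv_det hN]
    congr 1
    ext s
    congr 1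
    abel
  simp_rw [h1]
  rw [interpDeriv_comm, ← interpDeriv_det hN, ← interpDeriv_const_mul]
  congr 1
  ext s
  have hAs : (A + s • V) *ᵥ θ = 0 := by rw [add_mulVec, hA, smul_mulVec, hV]; simp
  refine interpDeriv_eq (hN ▸ isPolyDeg_det _ _) ?_
  have h2 : ∀ τ : ℝ, ((A + s • V) + τ • (κ • (1 - P) + γ • P)).det
      = (τ * γ) * ((A + s • V + P) + τ • (κ • (1 - P))).det := fun τ => by
    have hk : ((A + s • V) + τ • (κ • (1 - P))) *ᵥ θ = 0 := by
      rw [add_mulVec, hAs, smul_mulVec, smul_mulVec, sub_mulVec, hP]; simp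
    have := det_add_smul_vecMulVec hk hθ (τ * γ)
    rw [show (A + s • V + P) + τ • (κ • (1 - P)) = (A + s • V) + τ • (κ • (1 - P)) + P by abel,
      ← this]
    congr 1
    rw [smul_add, smul_smul τ γ, ← add_assoc]
  simp_rw [h2]
  have h3 := ((hasDerivAt_id (0 : ℝ)).mul_const γ).mul
    (hasDerivAt_det (A + s • V + P) (κ • (1 - P)))
  refine h3.congr_deriv ?_
  simp only [id, one_mul, zero_mul, zero_smul, add_zero]
  rw [show A + P + s • V = A + s • V + P by abel]

/-- The mixed determinant on `θ^⊥` is homogeneous of degree `n` in both entries jointly. -/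
theorem trace_adjugate_smul {n : ℕ} (hn : Fintype.card ι = n + 1) (hA : A *ᵥ θ = 0)
    (hV : V *ᵥ θ = 0) (hθ : θ ⬝ᵥ θ = 1) {c : ℝ} (hc : c ≠ 0) :
    ((c • A + vecMulVec θ θ).adjugate * (c • V)).trace
      = c ^ n * ((A + vecMulVec θ θ).adjugate * V).trace := by
  rw [← interpDeriv_det rfl, ← interpDeriv_det rfl, ← interpDeriv_const_mul]
  congr 1
  ext s
  have hAs : (A + s • V) *ᵥ θ = 0 := by rw [add_mulVec, hA, smul_mulVec, hV]; simp
  rw [show A + vecMulVec θ θ + s • V = A + s • V + vecMulVec θ θ by abel,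
    ← det_smul_add_vecMulVec hn hAs hθ hc]
  congr 1
  rw [smul_add, smul_comm c s]
  abel

end Algebra

variable {n : ℕ}

/-- The density `det H` for a function in place of a support function. -/
def aDen (f : Amb n → ℝ) (x : Amb n) : ℝ := (hessM f x + radM x).det

/-- The mixed density `U^{ij} (g_{ij} + g δ_{ij})`, `U` being the cofactor matrix of `H` for `f`:
the derivative of `aDen` at `f` in direction `g`. -/
def mDen (f g : Amb n → ℝ) (x : Amb n) : ℝ :=
  ((hessM f x + radM x).adjugate * hessM g x).trace

/-- A bump function on `(0, ∞)`. -/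
def gBump : ContDiffBump (5 / 2 : ℝ) := ⟨1 / 2, 3 / 4, by norm_num, by norm_num⟩

/-- A cutoff function on `(0, ∞)`, equal to one near the support of `gBump`. -/
def etaBump : ContDiffBump (5 / 2 : ℝ) := ⟨1, 2, by norm_num, by norm_num⟩

/-- The derivative of `r ↦ gBump (r ^ 2) * r`. -/
def radDeriv (r : ℝ) : ℝ := gBump (r ^ 2) + 2 * r ^ 2 * deriv gBump (r ^ 2)

/-- The components of the vector field `η (∇f + s φ ∇v) + τ X`, where `X` is radial and the cutoff
`η` is one near the support of `X`. -/
def fieldComp (f φ v : Amb n → ℝ) (s τ : ℝ) (i : Fin (n + 1)) (y : Amb n) : ℝ :=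
  etaBump (‖y‖ ^ 2) * (gradV f y i + s * (φ y * gradV v y i)) + τ * (gBump (‖y‖ ^ 2) * y i)

/-- The vector field with components `fieldComp`. -/
def field (f φ v : Amb n → ℝ) (s τ : ℝ) (y : Amb n) : Amb n :=
  WithLp.toLp 2 fun i => fieldComp f φ v s τ i y

theorem contDiff_etaBump_mul {h : Amb n → ℝ} (hh : ∀ x, x ≠ 0 → ContDiffAt ℝ 1 h x) :
    ContDiff ℝ 1 fun y => etaBump (‖y‖ ^ 2) * h y := by
  rw [contDiff_iff_contDiffAt]
  intro x
  by_cases hx : x = 0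
  · have h0 : (fun y => etaBump (‖y‖ ^ 2) * h y) =ᶠ[𝓝 x] fun _ => 0 := by
      have hc : Continuous fun y : Amb n => ‖y‖ ^ 2 := by fun_prop
      have : ∀ᶠ y : Amb n in 𝓝 x, ‖y‖ ^ 2 < 1 / 2 :=
        hc.continuousAt.eventually (eventually_lt_nhds (by rw [hx]; norm_num))
      filter_upwards [this] with y hy
      rw [etaBump.zero_of_le_dist, zero_mul]
      rw [Real.dist_eq, abs_of_nonpos (by linarith)]
      simp only [etaBump]
      linarith
    exact contDiffAt_const.congr_of_eventuallyEq h0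
  · exact ((etaBump.contDiff.contDiffAt).comp x ((contDiff_norm_sq ℝ).contDiffAt)).mul (hh x hx)

theorem IsHomC2.contDiffAt_gradV {f : Amb n → ℝ} (hf : IsHomC2 f) {x : Amb n} (hx : x ≠ 0)
    (i : Fin (n + 1)) : ContDiffAt ℝ 1 (fun y => gradV f y i) x :=
  ((hf.contDiffAt hx).fderiv_right (m := 1) (by norm_num)).clm_apply contDiffAt_const

theorem contDiff_fieldComp {f φ v : Amb n → ℝ} (hf : IsHomC2 f) (hφ : IsHomC2 φ) (hv : IsHomC2 v)
    (s τ : ℝ) (i : Fin (n + 1)) : ContDiff ℝ 1 (fieldComp f φ v s τ i) := by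
  refine (contDiff_etaBump_mul fun x hx => ?_).add (contDiff_const.mul ?_)
  · exact (hf.contDiffAt_gradV hx i).add (contDiffAt_const.mul
      (((hφ.contDiffAt hx).of_le (by norm_num)).mul (hv.contDiffAt_gradV hx i)))
  · exact (gBump.contDiff.comp (contDiff_norm_sq ℝ)).mul
      (EuclideanSpace.proj (𝕜 := ℝ) i).contDiff

theorem contDiff_field {f φ v : Amb n → ℝ} (hf : IsHomC2 f) (hφ : IsHomC2 φ) (hv : IsHomC2 v)
    (s τ : ℝ) : ContDiff ℝ 1 (field f φ v s τ) :=
  contDiff_euclidean.2 fun i => contDiff_fieldComp hf hφ hv s τ i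

theorem hasCompactSupport_field (f φ v : Amb n → ℝ) (s τ : ℝ) :
    HasCompactSupport (field f φ v s τ) := by
  refine HasCompactSupport.intro (isCompact_closedBall (0 : Amb n) 3) fun x hx => ?_
  have h3 : 3 < ‖x‖ := by simpa using hx
  have h9 : 9 < ‖x‖ ^ 2 := by nlinarith
  have hd : dist (‖x‖ ^ 2) (5 / 2 : ℝ) = ‖x‖ ^ 2 - 5 / 2 := by
    rw [Real.dist_eq, abs_of_nonneg (by linarith)]
  have h1 : etaBump (‖x‖ ^ 2) = 0 := etaBump.zero_of_le_dist (by
    rw [hd]; simp only [etaBump]; linarith)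
  have h2 : gBump (‖x‖ ^ 2) = 0 := gBump.zero_of_le_dist (by
    rw [hd]; simp only [gBump]; linarith)
  ext i
  simp [field, fieldComp, h1, h2]

/-- The Jacobian matrix of `field`. -/
def fieldJac (f φ v : Amb n → ℝ) (s τ : ℝ) (x : Amb n) :
    Matrix (Fin (n + 1)) (Fin (n + 1)) ℝ :=
  Matrix.of fun i j => fderiv ℝ (fieldComp f φ v s τ i) x (EuclideanSpace.single j 1)

theorem det_fieldJac {f φ v : Amb n → ℝ} (hf : IsHomC2 f) (hφ : IsHomC2 φ) (hv : IsHomC2 v)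
    (s τ : ℝ) (x : Amb n) :
    (fieldJac f φ v s τ x).det = (fderiv ℝ (field f φ v s τ) x).det := by
  rw [ContinuousLinearMap.det,
    ← LinearMap.det_toMatrix (EuclideanSpace.basisFun (Fin (n + 1)) ℝ).toBasis]
  congr 1
  ext i j
  have hd := ((contDiff_field hf hφ hv s τ).differentiable one_ne_zero x).hasFDerivAt
  have h2 := ((EuclideanSpace.proj (𝕜 := ℝ) i).hasFDerivAt.comp x hd).fderiv
  have h3 : fderiv ℝ (fieldComp f φ v s τ i) x
    = (EuclideanSpace.proj (𝕜 := ℝ) i).comp (fderiv ℝ (field f φ v s τ) x) := h2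
  simp [fieldJac, h3, LinearMap.toMatrix_apply]

theorem integrable_det_fieldJac {f φ v : Amb n → ℝ} (hf : IsHomC2 f) (hφ : IsHomC2 φ)
    (hv : IsHomC2 v) (s τ : ℝ) : Integrable fun x => (fieldJac f φ v s τ x).det := by
  simp_rw [det_fieldJac hf hφ hv]
  have hc := (contDiff_field hf hφ hv s τ).continuous_fderiv one_ne_zero
  refine (ContinuousLinearMap.continuous_det.comp hc).integrable_of_hasCompactSupport ?_
  refine (hasCompactSupport_field f φ v s τ).fderiv (𝕜 := ℝ) |>.comp_left
    (g := ContinuousLinearMap.det) ?_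
  simp [ContinuousLinearMap.det]

theorem integral_det_fieldJac {f φ v : Amb n → ℝ} (hf : IsHomC2 f) (hφ : IsHomC2 φ)
    (hv : IsHomC2 v) (s τ : ℝ) : ∫ x, (fieldJac f φ v s τ x).det = 0 := by
  simp_rw [det_fieldJac hf hφ hv]
  exact integral_det_fderiv_eq_zero _ (contDiff_field hf hφ hv s τ)
    (hasCompactSupport_field f φ v s τ)

/-- Where the cutoff is one, the Jacobian matrix of `field` is affine in `s` and `τ`. -/
theorem fieldJac_of_mem {f φ v : Amb n → ℝ} (hf : IsHomC2 f) (hφ : IsHomC2 φ) (hv : IsHomC2 v)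
    (s τ : ℝ) {x : Amb n} (hx : x ≠ 0) (hxU : ‖x‖ ^ 2 ∈ Metric.ball (5 / 2 : ℝ) 1) :
    fieldJac f φ v s τ x
      = hessM f x + s • (φ x • hessM v x + vecMulVec (gradV v x) (gradV φ x))
        + τ • (gBump (‖x‖ ^ 2) • (1 : Matrix _ _ ℝ)
          + (2 * deriv gBump (‖x‖ ^ 2)) • radM x) := by
  ext i j
  have h1 : (fun y : Amb n => etaBump (‖y‖ ^ 2)) =ᶠ[𝓝 x] fun _ => 1 := by
    have hc : Continuous fun y : Amb n => ‖y‖ ^ 2 := by fun_prop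
    exact hc.continuousAt.eventually (etaBump.eventuallyEq_one_of_mem_ball hxU)
  have h2 : fieldComp f φ v s τ i =ᶠ[𝓝 x] fun y =>
      (gradV f y i + s * (φ y * gradV v y i)) + τ * (gBump (‖y‖ ^ 2) * y i) := by
    filter_upwards [h1] with y hy
    rw [fieldComp, hy, one_mul]
  have d1 : ∀ {u : Amb n → ℝ}, IsHomC2 u → HasFDerivAt (fun y => gradV u y i)
      ((fderiv ℝ (fderiv ℝ u) x).flip (EuclideanSpace.single i 1)) x := fun {u} hu => by
    have := (differentiableAt_fderiv (hu.contDiffAt hx)).hasFDerivAt.clm_apply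
      (hasFDerivAt_const (EuclideanSpace.single i (1 : ℝ)) x)
    refine this.congr_fderiv ?_
    ext w
    simp
  have d2 := ((hφ.contDiffAt hx).differentiableAt two_ne_zero).hasFDerivAt
  have d3 : HasFDerivAt (fun y : Amb n => ‖y‖ ^ 2) ((2 : ℝ) • innerSL ℝ x) x := by
    have := (hasStrictFDerivAt_norm_sq x).hasFDerivAt
    refine this.congr_fderiv ?_
    ext w; simp
  have d4 : HasFDerivAt (fun y : Amb n => gBump (‖y‖ ^ 2))
      (deriv gBump (‖x‖ ^ 2) • ((2 : ℝ) • innerSL ℝ x)) x :=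
    HasDerivAt.comp_hasFDerivAt (h₂ := fun r => gBump r) x
      ((gBump.contDiff (n := 1)).differentiable one_ne_zero (‖x‖ ^ 2)).hasDerivAt d3
  have d5 : HasFDerivAt (fun y : Amb n => y i) (EuclideanSpace.proj (𝕜 := ℝ) i) x :=
    (EuclideanSpace.proj (𝕜 := ℝ) i).hasFDerivAt
  have d6 := ((d1 hf).add ((d2.mul (d1 hv)).const_mul s)).add ((d4.mul d5).const_mul τ)
  rw [fieldJac, of_apply, h2.fderiv_eq]
  have e1 : fderiv ℝ (fderiv ℝ f) x (EuclideanSpace.single j 1) (EuclideanSpace.single i 1)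
      = hessM f x i j := hess_comm (hf.contDiffAt hx) _ _
  have e2 : fderiv ℝ (fderiv ℝ v) x (EuclideanSpace.single j 1) (EuclideanSpace.single i 1)
      = hessM v x i j := hess_comm (hv.contDiffAt hx) _ _
  have d7 := d6.fderiv
  have d8 := congrArg (fun L : Amb n →L[ℝ] ℝ => L (EuclideanSpace.single j 1)) d7
  refine d8.trans ?_
  simp only [_root_.add_apply, _root_.smul_apply, ContinuousLinearMap.flip_apply, e1, e2,
    smul_eq_mul]
  rw [innerSL_apply_apply]
  have i1 : inner ℝ x (EuclideanSpace.single j (1 : ℝ)) = x j := by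
    simp [EuclideanSpace.inner_single_right]
  have i2 : (EuclideanSpace.proj (𝕜 := ℝ) i) (EuclideanSpace.single j (1 : ℝ) : Amb n)
      = (1 : Matrix (Fin (n + 1)) (Fin (n + 1)) ℝ) i j := by
    simp [Matrix.one_apply]
  rw [i1, i2]
  simp only [Matrix.add_apply, Matrix.smul_apply, smul_eq_mul, vecMulVec_apply, radM, gradV]
  ring

theorem gBump_eventually_zero {r : ℝ} (hr : r ∉ Metric.ball (5 / 2 : ℝ) 1) :
    (gBump : ℝ → ℝ) =ᶠ[𝓝 r] fun _ => 0 := by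
  have h1 : r ∉ tsupport gBump := by
    rw [gBump.tsupport_eq]
    intro h
    refine hr (lt_of_le_of_lt (Metric.mem_closedBall.1 h) ?_)
    simp only [gBump]; norm_num
  exact notMem_tsupport_iff_eventuallyEq.1 h1

theorem fieldJac_of_notMem (f φ v : Amb n → ℝ) (s τ : ℝ) {x : Amb n}
    (hxU : ‖x‖ ^ 2 ∉ Metric.ball (5 / 2 : ℝ) 1) :
    fieldJac f φ v s τ x = fieldJac f φ v s 0 x := by
  have hc : Continuous fun y : Amb n => ‖y‖ ^ 2 := by fun_prop
  have h1 := hc.continuousAt.eventually (gBump_eventually_zero hxU)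
  ext i j
  simp only [fieldJac, of_apply]
  have h2 : fieldComp f φ v s τ i =ᶠ[𝓝 x] fieldComp f φ v s 0 i := by
    filter_upwards [h1] with y hy
    rw [fieldComp, fieldComp, hy]
    simp
  rw [h2.fderiv_eq]

theorem radDeriv_of_notMem {r : ℝ} (hr : r ^ 2 ∉ Metric.ball (5 / 2 : ℝ) 1) : radDeriv r = 0 := by
  have h := gBump_eventually_zero hr
  rw [radDeriv, h.eq_of_nhds, h.deriv_eq]
  simp

/-- The coefficient of `s τ` in the Jacobian determinant of `field`. -/
def mixedJac (f φ v : Amb n → ℝ) (x : Amb n) : ℝ :=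
  interpDeriv (n + 1) fun τ => interpDeriv (n + 1) fun s => (fieldJac f φ v s τ x).det

theorem integrable_mixedJac {f φ v : Amb n → ℝ} (hf : IsHomC2 f) (hφ : IsHomC2 φ)
    (hv : IsHomC2 v) : Integrable (mixedJac f φ v) :=
  integrable_interpDeriv _ fun τ => integrable_interpDeriv _ fun s =>
    integrable_det_fieldJac hf hφ hv s τ

theorem integral_mixedJac {f φ v : Amb n → ℝ} (hf : IsHomC2 f) (hφ : IsHomC2 φ)
    (hv : IsHomC2 v) : ∫ x, mixedJac f φ v x = 0 := by
  simp only [mixedJac]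
  rw [integral_interpDeriv _ fun τ => integrable_interpDeriv _ fun s =>
    integrable_det_fieldJac hf hφ hv s τ]
  simp_rw [integral_interpDeriv _ fun s => integrable_det_fieldJac hf hφ hv s _,
    integral_det_fieldJac hf hφ hv, interpDeriv_const]

theorem norm_normalize {x : Amb n} (hx : x ≠ 0) : ‖‖x‖⁻¹ • x‖ = 1 := by
  rw [norm_smul, norm_inv, norm_norm, inv_mul_cancel₀ (norm_ne_zero_iff.2 hx)]

theorem ne_zero_of_norm {x : Amb n} (hx : ‖x‖ = 1) : x ≠ 0 := by
  rintro rfl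
  simp at hx

/-- Up to a term symmetric in `φ` and `v`, which cancels, the mixed Jacobian is the product of a
radial factor and of `φ` times the mixed area density. -/
theorem mixedJac_sub {f φ v : Amb n → ℝ} (hf : IsHomC2 f) (hφ : IsHomC2 φ)
    (hv : IsHomC2 v) {x : Amb n} (hx : x ≠ 0) :
    mixedJac f φ v x - mixedJac f v φ x = (‖x‖ * ‖x‖⁻¹ ^ n * radDeriv ‖x‖) *
      (φ (‖x‖⁻¹ • x) * mDen f v (‖x‖⁻¹ • x) - v (‖x‖⁻¹ • x) * mDen f φ (‖x‖⁻¹ • x)) := by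
  by_cases hU : ‖x‖ ^ 2 ∈ Metric.ball (5 / 2 : ℝ) 1
  swap
  · rw [radDeriv_of_notMem hU, mul_zero, zero_mul]
    simp only [mixedJac]
    have h : ∀ φ v : Amb n → ℝ, (fun τ => interpDeriv (n + 1) fun s => (fieldJac f φ v s τ x).det)
        = fun _ => interpDeriv (n + 1) fun s => (fieldJac f φ v s 0 x).det := fun φ v => by
      ext τ
      simp_rw [fieldJac_of_notMem f φ v _ τ hU]
    rw [h, h, interpDeriv_const, interpDeriv_const, sub_self]
  set r := ‖x‖ with hr
  have hr0 : 0 < r := norm_pos_iff.2 hx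
  set θ : Amb n := r⁻¹ • x with hθ
  have hxθ : x = r • θ := by rw [hθ, smul_inv_smul₀ hr0.ne']
  have hθ1 : ‖θ‖ = 1 := norm_normalize hx
  have hθ0 : θ ≠ 0 := ne_zero_of_norm hθ1
  have hdot := dotProduct_self_of_norm hθ1
  set Y : Matrix (Fin (n + 1)) (Fin (n + 1)) ℝ :=
    gBump (r ^ 2) • (1 : Matrix _ _ ℝ) + (2 * deriv gBump (r ^ 2)) • radM x with hY
  have hrad : radM x = r ^ 2 • radM θ := by
    ext i j
    simp only [radM, vecMulVec_apply, Matrix.smul_apply, smul_eq_mul]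
    rw [hxθ]
    simp only [PiLp.smul_apply, smul_eq_mul]
    ring
  have hY' : Y = gBump (r ^ 2) • (1 - radM θ) + radDeriv r • radM θ := by
    rw [hY, hrad, radDeriv, smul_smul, smul_sub, add_smul]
    rw [show 2 * r ^ 2 * deriv gBump (r ^ 2) = 2 * deriv gBump (r ^ 2) * r ^ 2 by ring]
    abel
  have hYs : Y.IsSymm := (isSymm_one.smul _).add ((radM_isSymm x).smul _)
  have hA : hessM f x *ᵥ θ.ofLp = 0 := by
    rw [hxθ, hf.hessM_smul hr0, smul_mulVec, hf.hessM_mulVec_self hθ0, smul_zero]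
  have key : ∀ {u : Amb n → ℝ}, IsHomC2 u →
      interpDeriv (n + 1) (fun τ => ((hessM f x + τ • Y).adjugate * hessM u x).trace)
        = radDeriv r * (r⁻¹ ^ n * mDen f u θ) := fun {u} hu => by
    have hV : hessM u x *ᵥ θ.ofLp = 0 := by
      rw [hxθ, hu.hessM_smul hr0, smul_mulVec, hu.hessM_mulVec_self hθ0, smul_zero]
    rw [hY']
    refine (interpDeriv_trace_adjugate_radial (by simp) hA hV hdot _ _).trans ?_
    rw [hxθ, hf.hessM_smul hr0, hu.hessM_smul hr0,
      trace_adjugate_smul (Fintype.card_fin _) (hf.hessM_mulVec_self hθ0)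
        (hu.hessM_mulVec_self hθ0) hdot (inv_ne_zero hr0.ne')]
    rfl
  have inner : ∀ {φ v : Amb n → ℝ}, IsHomC2 φ → IsHomC2 v → ∀ τ,
      (interpDeriv (n + 1) fun s => (fieldJac f φ v s τ x).det)
        = φ x * ((hessM f x + τ • Y).adjugate * hessM v x).trace
          + ((hessM f x + τ • Y).adjugate * vecMulVec (gradV v x) (gradV φ x)).trace := by
    intro φ v hφ hv τ
    have h1 : ∀ s, fieldJac f φ v s τ x = (hessM f x + τ • Y)
        + s • (φ x • hessM v x + vecMulVec (gradV v x) (gradV φ x)) := fun s => by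
      rw [fieldJac_of_mem hf hφ hv s τ hx hU]
      abel
    simp_rw [h1]
    rw [interpDeriv_det (by simp), mul_add, trace_add, Matrix.mul_smul, trace_smul, smul_eq_mul]
  rw [mixedJac, mixedJac, ← interpDeriv_sub]
  have h2 : ∀ τ, (interpDeriv (n + 1) fun s => (fieldJac f φ v s τ x).det)
      - (interpDeriv (n + 1) fun s => (fieldJac f v φ s τ x).det)
      = φ x * ((hessM f x + τ • Y).adjugate * hessM v x).trace
        - v x * ((hessM f x + τ • Y).adjugate * hessM φ x).trace := fun τ => by
    rw [inner hφ hv, inner hv hφ, trace_adjugate_mul_vecMulVec_comm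
      ((hessM_isSymm (hf.contDiffAt hx)).add (hYs.smul τ)) (gradV v x)]
    ring
  simp_rw [h2]
  rw [interpDeriv_sub, interpDeriv_const_mul, interpDeriv_const_mul, key hv, key hφ]
  have e1 : φ x = r * φ θ := by rw [← hφ.hom r hr0, ← hxθ]
  have e2 : v x = r * v θ := by rw [← hv.hom r hr0, ← hxθ]
  rw [e1, e2]
  ring

/-- Integration in polar coordinates of a product of a radial and a spherical function. -/
theorem integral_radial_mul_spherical (ρ : ℝ → ℝ) (q : Amb n → ℝ) :
    ∫ x : Amb n, ρ ‖x‖ * q (‖x‖⁻¹ • x)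
      = (∫ x : Sph n, q x ∂(sphArea n)) * ∫ r in Set.Ioi (0 : ℝ), r ^ n * ρ r := by
  set μ : Measure (Amb n) := volume
  have hdim : Module.finrank ℝ (Amb n) - 1 = n := by simp
  calc ∫ x : Amb n, ρ ‖x‖ * q (‖x‖⁻¹ • x) ∂μ
      = ∫ x : ({(0)}ᶜ : Set (Amb n)), ρ ‖x.1‖ * q (‖x.1‖⁻¹ • x.1) ∂(μ.comap (↑)) := by
        rw [integral_subtype_comap (measurableSet_singleton _).compl
          fun x : Amb n => ρ ‖x‖ * q (‖x‖⁻¹ • x), restrict_compl_singleton]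
    _ = ∫ p : Sph n × Set.Ioi (0 : ℝ), q p.1 * ρ p.2
          ∂(μ.toSphere.prod (.volumeIoiPow (Module.finrank ℝ (Amb n) - 1))) := by
        rw [← μ.measurePreserving_homeomorphUnitSphereProd.integral_comp
          (Homeomorph.measurableEmbedding _)]
        refine integral_congr_ae (Eventually.of_forall fun x => ?_)
        simp [mul_comm]
    _ = (∫ x : Sph n, q x ∂μ.toSphere) * ∫ r : Set.Ioi (0 : ℝ), ρ r
          ∂(.volumeIoiPow (Module.finrank ℝ (Amb n) - 1)) :=
        integral_prod_mul (fun x : Sph n => q x) fun r : Set.Ioi (0 : ℝ) => ρ r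
    _ = _ := by
        rw [hdim]
        congr 1
        simp only [Measure.volumeIoiPow, ENNReal.ofReal]
        rw [integral_withDensity_eq_integral_smul,
          integral_subtype_comap measurableSet_Ioi fun a => Real.toNNReal (a ^ n) • ρ a]
        · refine setIntegral_congr_fun measurableSet_Ioi fun x hx => ?_
          simp only [NNReal.smul_def, smul_eq_mul]
          rw [Real.coe_toNNReal _ (pow_nonneg (le_of_lt hx) _)]
        · exact (measurable_subtype_coe.pow_const _).real_toNNReal

theorem radDeriv_of_gt {r : ℝ} (hr : 3 < r) : radDeriv r = 0 := by
  refine radDeriv_of_notMem fun h => ?_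
  rw [Metric.mem_ball, Real.dist_eq, abs_lt] at h
  nlinarith [h.2]

/-- By parts, the integral is `-∫ gBump (r ^ 2) * r`. -/
theorem setIntegral_mul_radDeriv_ne_zero :
    ∫ r in Set.Ioi (0 : ℝ), r * radDeriv r ≠ 0 := by
  have hg : Differentiable ℝ gBump := (gBump.contDiff (n := 1)).differentiable one_ne_zero
  have hgc : Continuous (deriv gBump) := (gBump.contDiff (n := 1)).continuous_deriv_one
  have hd : ∀ r : ℝ, HasDerivAt (fun r => gBump (r ^ 2) * r) (radDeriv r) r := fun r => by
    have h1 : HasDerivAt (fun r : ℝ => gBump (r ^ 2)) (deriv gBump (r ^ 2) * (2 * r)) r := by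
      have := HasDerivAt.comp (h₂ := fun q => gBump q) (h := fun r : ℝ => r ^ 2) r
        (hg (r ^ 2)).hasDerivAt (hasDerivAt_pow 2 r)
      exact this.congr_deriv (by simp)
    refine (h1.mul (hasDerivAt_id r)).congr_deriv ?_
    simp only [radDeriv, id]
    ring
  have hrc : Continuous radDeriv := by
    unfold radDeriv
    exact (gBump.continuous.comp (continuous_pow 2)).add
      ((by fun_prop : Continuous fun r : ℝ => 2 * r ^ 2).mul (hgc.comp (continuous_pow 2)))
  have h1 : ∫ r in Set.Ioi (0 : ℝ), r * radDeriv r = ∫ r in (0 : ℝ)..3, r * radDeriv r := by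
    rw [intervalIntegral.integral_of_le (by norm_num)]
    refine (setIntegral_eq_of_subset_of_forall_sdiff_eq_zero measurableSet_Ioi
      Set.Ioc_subset_Ioi_self fun x hx => ?_)
    have : 3 < x := by
      by_contra h
      exact hx.2 ⟨hx.1, not_lt.1 h⟩
    rw [radDeriv_of_gt this, mul_zero]
  have h2 := intervalIntegral.integral_mul_deriv_eq_deriv_mul (a := (0 : ℝ)) (b := 3)
    (u := fun r => r) (u' := fun _ => 1) (v := fun r => gBump (r ^ 2) * r) (v' := radDeriv)
    (fun r _ => hasDerivAt_id r) (fun r _ => hd r) (by simp) (hrc.intervalIntegrable _ _)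
  have h3 : gBump ((3 : ℝ) ^ 2) = 0 := gBump.zero_of_le_dist (by
    rw [Real.dist_eq]; simp only [gBump]; norm_num)
  have hc : Continuous fun r : ℝ => gBump (r ^ 2) * r :=
    (gBump.continuous.comp (continuous_pow 2)).mul continuous_id
  have h4 : 0 < ∫ r in (0 : ℝ)..3, gBump (r ^ 2) * r := by
    refine intervalIntegral.integral_pos (by norm_num) hc.continuousOn
      (fun r hr => mul_nonneg gBump.nonneg hr.1.le) ⟨3 / 2, by norm_num, ?_⟩
    refine mul_pos (gBump.pos_of_mem_ball ?_) (by norm_num)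
    rw [Metric.mem_ball, Real.dist_eq]
    simp only [gBump]
    norm_num [abs_lt]
  rw [h1, h2, h3]
  simp only [one_mul]
  intro h
  simp at h
  linarith

theorem IsHomC2.continuousOn {f : Amb n → ℝ} (hf : IsHomC2 f) : ContinuousOn f {0}ᶜ :=
  hf.smooth.continuousOn

theorem coe_sph_ne_zero (x : Sph n) : (x : Amb n) ≠ 0 := ne_zero_of_norm (by simp)

theorem continuous_sph_of_continuousOn {Y : Type*} [TopologicalSpace Y] {F : Amb n → Y}
    (hF : ContinuousOn F {0}ᶜ) : Continuous fun x : Sph n => F x :=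
  hF.comp_continuous continuous_subtype_val fun x => coe_sph_ne_zero x

theorem IsHomC2.continuous_sph {f : Amb n → ℝ} (hf : IsHomC2 f) : Continuous fun x : Sph n => f x :=
  continuous_sph_of_continuousOn hf.continuousOn

theorem IsHomC2.continuous_hessM {f : Amb n → ℝ} (hf : IsHomC2 f) :
    Continuous fun x : Sph n => hessM f x :=
  continuous_matrix fun _ _ => continuous_sph_of_continuousOn (hf.continuousOn_hess _ _)

theorem continuous_radM : Continuous fun x : Sph n => radM (x : Amb n) :=
  continuous_matrix fun i j => by
    simp only [radM, vecMulVec_apply]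
    fun_prop

theorem IsHomC2.continuous_aDen {f : Amb n → ℝ} (hf : IsHomC2 f) :
    Continuous fun x : Sph n => aDen f x :=
  (hf.continuous_hessM.add continuous_radM).matrix_det

theorem IsHomC2.continuous_mDen {f g : Amb n → ℝ} (hf : IsHomC2 f) (hg : IsHomC2 g) :
    Continuous fun x : Sph n => mDen f g x :=
  ((hf.continuous_hessM.add continuous_radM).matrix_adjugate.matrix_mul
    hg.continuous_hessM).matrix_trace

instance : IsFiniteMeasure (sphArea n) := by unfold sphArea; infer_instance

theorem integrable_sph {q : Sph n → ℝ} (hq : Continuous q) (μ : Measure (Sph n))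
    [IsFiniteMeasure μ] : Integrable q μ := by
  rw [← integrableOn_univ]
  exact hq.continuousOn.integrableOn_compact isCompact_univ

/-- The mixed area form is symmetric. The integral over `ℝ^{n+1}` of the difference of the two mixed
Jacobians vanishes, and in polar coordinates it is a nonzero constant times the difference of the
two sides. -/
theorem integral_mul_mDen_comm {f φ v : Amb n → ℝ} (hf : IsHomC2 f) (hφ : IsHomC2 φ)
    (hv : IsHomC2 v) :
    ∫ x : Sph n, φ x * mDen f v x ∂(sphArea n) = ∫ x : Sph n, v x * mDen f φ x ∂(sphArea n) := by
  have h0 : ∫ x : Amb n, (mixedJac f φ v x - mixedJac f v φ x) = 0 := by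
    rw [integral_sub (integrable_mixedJac hf hφ hv) (integrable_mixedJac hf hv hφ),
      integral_mixedJac hf hφ hv, integral_mixedJac hf hv hφ, sub_zero]
  have h1 : ∫ x : Amb n, (mixedJac f φ v x - mixedJac f v φ x)
      = ∫ x : Amb n, (‖x‖ * ‖x‖⁻¹ ^ n * radDeriv ‖x‖) *
      (φ (‖x‖⁻¹ • x) * mDen f v (‖x‖⁻¹ • x) - v (‖x‖⁻¹ • x) * mDen f φ (‖x‖⁻¹ • x)) := by
    refine integral_congr_ae ?_
    have : ∀ᵐ x : Amb n, x ≠ 0 := by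
      simp [ae_iff]
    filter_upwards [this] with x hx
    exact mixedJac_sub hf hφ hv hx
  rw [h1, integral_radial_mul_spherical (fun r => r * r⁻¹ ^ n * radDeriv r)
    fun x => φ x * mDen f v x - v x * mDen f φ x] at h0
  have h2 : ∫ r in Set.Ioi (0 : ℝ), r ^ n * (r * r⁻¹ ^ n * radDeriv r)
      = ∫ r in Set.Ioi (0 : ℝ), r * radDeriv r := by
    refine setIntegral_congr_fun measurableSet_Ioi fun r hr => ?_
    have hr0 : r ≠ 0 := (Set.mem_Ioi.1 hr).ne'
    have e : r ^ n * (r * r⁻¹ ^ n * radDeriv r) = (r * r⁻¹) ^ n * (r * radDeriv r) := by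
      rw [mul_pow]
      ring
    rw [mul_inv_cancel₀ hr0, one_pow, one_mul] at e
    exact e
  rw [h2] at h0
  have h3 := (mul_eq_zero.1 h0).resolve_right setIntegral_mul_radDeriv_ne_zero
  have i1 : Integrable (fun x : Sph n => φ x * mDen f v x) (sphArea n) :=
    integrable_sph (hφ.continuous_sph.mul (hf.continuous_mDen hv)) _
  have i2 : Integrable (fun x : Sph n => v x * mDen f φ x) (sphArea n) :=
    integrable_sph (hv.continuous_sph.mul (hf.continuous_mDen hφ)) _
  rw [integral_sub i1 i2] at h3
  linarith

end Symmetry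

/-! ### Support functions of class `C²` with positive curvature -/

section SupportFunctions

open Matrix

variable {n : ℕ}

/-- Support functions of class `C²` with `∇²f + f Id > 0`. -/
structure IsSuppC2 (f : Amb n → ℝ) : Prop where
  homC2 : IsHomC2 f
  pos : ∀ x : Amb n, ‖x‖ = 1 → ∀ v : Amb n, inner ℝ x v = 0 → v ≠ 0 → 0 < hess f x v v

theorem dotProduct_hessM (f : Amb n → ℝ) (x v w : Amb n) :
    v.ofLp ⬝ᵥ (hessM f x *ᵥ w.ofLp) = hess f x v w := by
  have h : ∀ v : Amb n, v = ∑ j, v.ofLp j • (EuclideanSpace.single j (1 : ℝ) : Amb n) := fun v => by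
    conv_lhs => rw [← (EuclideanSpace.basisFun (Fin (n + 1)) ℝ).sum_repr v]
    simp
  have h1 : hess f x v w = ∑ i, ∑ j, v.ofLp i * (w.ofLp j * hessM f x i j) := by
    rw [hess, congrArg (fderiv ℝ (fderiv ℝ f) x) (h v), map_sum, _root_.sum_apply]
    refine Finset.sum_congr rfl fun i _ => ?_
    rw [map_smul, _root_.smul_apply,
      congrArg (fderiv ℝ (fderiv ℝ f) x (EuclideanSpace.single i 1)) (h w), map_sum, smul_eq_mul,
      Finset.mul_sum]
    refine Finset.sum_congr rfl fun j _ => ?_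
    rw [map_smul, smul_eq_mul]
    rfl
  rw [h1, dotProduct]
  refine Finset.sum_congr rfl fun i _ => ?_
  rw [mulVec, dotProduct, Finset.mul_sum]
  exact Finset.sum_congr rfl fun j _ => by ring

theorem inner_eq_dotProduct (x y : Amb n) : inner ℝ x y = x.ofLp ⬝ᵥ y.ofLp := by
  rw [PiLp.inner_apply, dotProduct]
  exact Finset.sum_congr rfl fun i _ => by simp [mul_comm]

/-- The Hessian at a unit vector only sees tangential components. -/
theorem IsHomC2.hess_tangential {f : Amb n → ℝ} (hf : IsHomC2 f) {x : Amb n} (hx : ‖x‖ = 1)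
    (w : Amb n) : hess f x w w
      = hess f x (w - (inner ℝ x w : ℝ) • x) (w - (inner ℝ x w : ℝ) • x) := by
  have hx0 := ne_zero_of_norm hx
  have h1 : ∀ y, hess f x y x = 0 := fun y => by
    rw [hess_comm (hf.contDiffAt hx0), hf.hess_self_left hx0]
  have h2 : ∀ y, hess f x x y = 0 := fun y => hf.hess_self_left hx0 y
  simp only [hess] at h1 h2 ⊢
  simp [h1, h2]

theorem inner_tangential {x : Amb n} (hx : ‖x‖ = 1) (w : Amb n) :
    inner ℝ x (w - (inner ℝ x w : ℝ) • x) = 0 := by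
  rw [inner_sub_right, inner_smul_right, real_inner_self_eq_norm_sq, hx]
  ring

namespace IsSuppC2

variable {f g : Amb n → ℝ}

theorem hess_nonneg (hf : IsSuppC2 f) {x : Amb n} (hx : ‖x‖ = 1) (w : Amb n) :
    0 ≤ hess f x w w := by
  rw [hf.homC2.hess_tangential hx]
  by_cases h : w - (inner ℝ x w : ℝ) • x = 0
  · rw [h]; simp [hess]
  · exact (hf.pos x hx _ (inner_tangential hx w) h).le

theorem posSemidef (hf : IsSuppC2 f) {x : Amb n} (hx : ‖x‖ = 1) : (hessM f x).PosSemidef := by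
  refine .of_dotProduct_mulVec_nonneg ?_ fun v => ?_
  · exact hessM_isSymm (hf.homC2.contDiffAt (ne_zero_of_norm hx))
  · have := hf.hess_nonneg hx (WithLp.toLp 2 v)
    rw [← dotProduct_hessM] at this
    simpa using this

/-- The Hessian is positive on `x^⊥` and vanishes in direction `x`, where `x ⊗ x` is positive. -/
theorem posDef (hf : IsSuppC2 f) {x : Amb n} (hx : ‖x‖ = 1) : (hessM f x + radM x).PosDef := by
  refine .of_dotProduct_mulVec_pos ?_ fun v hv => ?_
  · exact (hessM_isSymm (hf.homC2.contDiffAt (ne_zero_of_norm hx))).add (radM_isSymm x)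
  set w : Amb n := WithLp.toLp 2 v with hw
  have hw0 : w ≠ 0 := fun h => hv (by simpa [hw] using congrArg WithLp.ofLp h)
  have h1 : star v ⬝ᵥ ((hessM f x + radM x) *ᵥ v) = hess f x w w + (inner ℝ x w : ℝ) ^ 2 := by
    rw [← dotProduct_hessM, inner_eq_dotProduct, add_mulVec, dotProduct_add, radM,
      vecMulVec_mulVec]
    simp only [hw, star_trivial, dotProduct_smul, MulOpposite.smul_eq_mul_unop,
      MulOpposite.unop_op]
    rw [dotProduct_comm v x.ofLp]
    ring
  rw [h1]
  by_cases h : w - (inner ℝ x w : ℝ) • x = 0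
  · have : (inner ℝ x w : ℝ) ≠ 0 := fun h0 => hw0 (by simpa [h0] using h)
    have := hf.hess_nonneg hx w
    positivity
  · have := hf.pos x hx _ (inner_tangential hx w) h
    rw [← hf.homC2.hess_tangential hx] at this
    positivity

theorem aDen_pos (hf : IsSuppC2 f) {x : Amb n} (hx : ‖x‖ = 1) : 0 < aDen f x :=
  (hf.posDef hx).det_pos

theorem adjugate_posSemidef (hf : IsSuppC2 f) {x : Amb n} (hx : ‖x‖ = 1) :
    (hessM f x + radM x).adjugate.PosSemidef := by
  have h := hf.posDef hx
  have h1 : (hessM f x + radM x).adjugate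
      = (hessM f x + radM x).det • (hessM f x + radM x)⁻¹ := by
    rw [Matrix.inv_def, smul_smul, Ring.mul_inverse_cancel _ h.det_pos.ne'.isUnit, one_smul]
  rw [h1]
  exact h.inv.posSemidef.smul h.det_pos.le

open scoped MatrixOrder in
theorem mDen_nonneg (hf : IsSuppC2 f) (hg : IsSuppC2 g) {x : Amb n} (hx : ‖x‖ = 1) :
    0 ≤ mDen f g x := by
  obtain ⟨B, hB⟩ := CStarAlgebra.nonneg_iff_eq_star_mul_self.mp (hg.posSemidef hx).nonneg
  rw [mDen, hB, star_eq_conjTranspose, ← mul_assoc, trace_mul_comm, ← mul_assoc]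
  exact ((hf.adjugate_posSemidef hx).mul_mul_conjTranspose_same B).trace_nonneg

theorem add_mul (hf : IsSuppC2 f) (hg : IsSuppC2 g) {t : ℝ} (ht : 0 ≤ t) :
    IsSuppC2 fun x => f x + t * g x where
  homC2 := hf.homC2.add (hg.homC2.const_mul t)
  pos x hx v hv hv0 := by
    have hx0 := ne_zero_of_norm hx
    rw [hess_add (hf.homC2.contDiffAt hx0) ((hg.homC2.const_mul t).contDiffAt hx0),
      hess_const_mul (hg.homC2.contDiffAt hx0)]
    have h1 := hf.pos x hx v hv hv0
    have h2 := hg.pos x hx v hv hv0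
    positivity

theorem const_mul (hf : IsSuppC2 f) {c : ℝ} (hc : 0 < c) : IsSuppC2 fun x => c * f x where
  homC2 := hf.homC2.const_mul c
  pos x hx v hv hv0 := by
    rw [hess_const_mul (hf.homC2.contDiffAt (ne_zero_of_norm hx))]
    exact mul_pos hc (hf.pos x hx v hv hv0)

end IsSuppC2

theorem isSuppC2_norm : IsSuppC2 (fun x : Amb n => ‖x‖) where
  homC2 := isHomC2_norm
  pos x hx v hv hv0 := by
    rw [hess_norm hx, hv, real_inner_self_eq_norm_sq]
    have := norm_pos_iff.2 hv0
    nlinarith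

/-- Every `C²` function becomes a positive support function after adding a multiple of the
support function of the ball. -/
theorem IsHomC2.exists_isSuppC2_add_norm {f : Amb n → ℝ} (hf : IsHomC2 f) :
    ∃ c : ℝ, 0 < c ∧ IsSuppC2 (fun x => f x + c * ‖x‖) ∧
      ∀ x : Amb n, ‖x‖ = 1 → 0 < f x + c * ‖x‖ := by
  have hS : IsCompact (Metric.sphere (0 : Amb n) 1) := isCompact_sphere _ _
  have hsub : Metric.sphere (0 : Amb n) 1 ⊆ {0}ᶜ := fun x hx =>
    ne_zero_of_norm (by simpa using hx)
  have h1 : ContDiffOn ℝ 1 (fderiv ℝ f) {0}ᶜ :=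
    hf.smooth.fderiv_of_isOpen isOpen_compl_singleton (by norm_num)
  have h2 := h1.continuousOn_fderiv_of_isOpen isOpen_compl_singleton le_rfl
  obtain ⟨a, ha⟩ := hS.exists_bound_of_continuousOn (h2.mono hsub)
  obtain ⟨b, hb⟩ := hS.exists_bound_of_continuousOn (hf.continuousOn.mono hsub)
  refine ⟨max a b + 1 + |max a b|, ?_, ⟨hf.add (isHomC2_norm.const_mul _), ?_⟩, ?_⟩
  · have := neg_abs_le (max a b); linarith
  · intro x hx v hv hv0
    have hx0 := ne_zero_of_norm hx
    rw [hess_add (hf.contDiffAt hx0) ((isHomC2_norm.const_mul _).contDiffAt hx0),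
      hess_const_mul (isHomC2_norm.contDiffAt hx0), hess_norm hx, hv, real_inner_self_eq_norm_sq]
    have h3 := ha x (by simpa using hx)
    have h4 : |hess f x v v| ≤ a * ‖v‖ * ‖v‖ := by
      refine ((fderiv ℝ (fderiv ℝ f) x v).le_opNorm v).trans ?_
      gcongr
      refine ((fderiv ℝ (fderiv ℝ f) x).le_opNorm v).trans ?_
      gcongr
    have h5 := (abs_le.1 h4).1
    have h6 : 0 < ‖v‖ ^ 2 := by have := norm_pos_iff.2 hv0; positivity
    have h7 := le_max_left a b
    have h8 := abs_nonneg (max a b)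
    nlinarith
  · intro x hx
    have h3 := (abs_le.1 (hb x (by simpa using hx))).1
    have h7 := le_max_right a b
    have h8 := abs_nonneg (max a b)
    rw [hx]
    linarith

/-! ### The volume functional -/

theorem hessM_line {f w : Amb n → ℝ} (hf : IsHomC2 f) (hw : IsHomC2 w) (t : ℝ) {x : Amb n}
    (hx : x ≠ 0) : hessM (fun y => f y + t * w y) x = hessM f x + t • hessM w x := by
  rw [hf.hessM_add (hw.const_mul t) hx, hw.hessM_const_mul t hx]

theorem aDen_line {f w : Amb n → ℝ} (hf : IsHomC2 f) (hw : IsHomC2 w) (t : ℝ) {x : Amb n}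
    (hx : x ≠ 0) :
    aDen (fun y => f y + t * w y) x = ((hessM f x + radM x) + t • hessM w x).det := by
  rw [aDen, hessM_line hf hw t hx]
  congr 1
  abel

theorem isPolyDeg_aDen {f w : Amb n → ℝ} (hf : IsHomC2 f) (hw : IsHomC2 w) {x : Amb n}
    (hx : x ≠ 0) : IsPolyDeg (n + 1) fun t => aDen (fun y => f y + t * w y) x := by
  simp_rw [aDen_line hf hw _ hx]
  simpa using isPolyDeg_det (hessM f x + radM x) (hessM w x)

theorem hasDerivAt_aDen {f w : Amb n → ℝ} (hf : IsHomC2 f) (hw : IsHomC2 w) {x : Amb n}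
    (hx : x ≠ 0) : HasDerivAt (fun t : ℝ => aDen (fun y => f y + t * w y) x) (mDen f w x) 0 := by
  simp_rw [aDen_line hf hw _ hx]
  exact hasDerivAt_det _ _

theorem interpDeriv_aDen {f w : Amb n → ℝ} (hf : IsHomC2 f) (hw : IsHomC2 w) {x : Amb n}
    (hx : x ≠ 0) :
    interpDeriv (n + 1) (fun t => aDen (fun y => f y + t * w y) x) = mDen f w x :=
  interpDeriv_eq (isPolyDeg_aDen hf hw hx) (hasDerivAt_aDen hf hw hx)

/-- `U^{ij} (f_{ij} + f δ_{ij}) = n det H` for the cofactor matrix `U` of `H = ∇²f + f Id`. -/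
theorem mDen_self {f : Amb n → ℝ} (hf : IsHomC2 f) {x : Amb n} (hx : ‖x‖ = 1) :
    mDen f f x = n * aDen f x :=
  trace_adjugate_mul_self (Fintype.card_fin _) (hf.hessM_mulVec_self (ne_zero_of_norm hx))
    (dotProduct_self_of_norm hx)

theorem norm_sph (x : Sph n) : ‖(x : Amb n)‖ = 1 := by simp

/-- The functional `∫ f det(∇²f + f Id) dS`, which is `n + 1` times the volume if `f` is a support
function. -/
def vol (f : Amb n → ℝ) : ℝ := ∫ x : Sph n, f x * aDen f x ∂(sphArea n)

theorem isPolyDeg_vol_integrand {f w : Amb n → ℝ} (hf : IsHomC2 f) (hw : IsHomC2 w) {x : Amb n}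
    (hx : x ≠ 0) :
    IsPolyDeg (n + 2) fun t => (f x + t * w x) * aDen (fun y => f y + t * w y) x :=
  (isPolyDeg_aDen hf hw hx).affine_mul _ _

theorem integrable_vol {f : Amb n → ℝ} (hf : IsHomC2 f) :
    Integrable (fun x : Sph n => f x * aDen f x) (sphArea n) :=
  integrable_sph (hf.continuous_sph.mul hf.continuous_aDen) _

theorem isPolyDeg_vol {f w : Amb n → ℝ} (hf : IsHomC2 f) (hw : IsHomC2 w) :
    IsPolyDeg (n + 2) fun t => vol fun y => f y + t * w y :=
  IsPolyDeg.integral (fun x : Sph n => isPolyDeg_vol_integrand hf hw (coe_sph_ne_zero x))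
    fun t => integrable_vol (hf.add (hw.const_mul t))

/-- The first variation of the volume is the area measure. -/
theorem hasDerivAt_vol {f w : Amb n → ℝ} (hf : IsHomC2 f) (hw : IsHomC2 w) :
    HasDerivAt (fun t : ℝ => vol fun y => f y + t * w y)
      ((n + 1) * ∫ x : Sph n, w x * aDen f x ∂(sphArea n)) 0 := by
  have h := hasDerivAt_integral_of_isPolyDeg (μ := sphArea n)
    (p := fun (x : Sph n) t => (f x + t * w x) * aDen (fun y => f y + t * w y) x)
    (d := fun x : Sph n => w x * aDen f x + f x * mDen f w x)
    (fun x => isPolyDeg_vol_integrand hf hw (coe_sph_ne_zero x))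
    (fun t => integrable_vol (hf.add (hw.const_mul t))) (fun x => by
      have h1 := (((hasDerivAt_id (0 : ℝ)).mul_const (w x)).const_add (f x)).mul
        (hasDerivAt_aDen hf hw (coe_sph_ne_zero x))
      refine h1.congr_deriv ?_
      simp)
  refine h.congr_deriv ?_
  have i1 : Integrable (fun x : Sph n => w x * aDen f x) (sphArea n) :=
    integrable_sph (hw.continuous_sph.mul hf.continuous_aDen) _
  have i2 : Integrable (fun x : Sph n => f x * mDen f w x) (sphArea n) :=
    integrable_sph (hf.continuous_sph.mul (hf.continuous_mDen hw)) _
  rw [integral_add i1 i2, integral_mul_mDen_comm hf hf hw]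
  have h2 : ∀ x : Sph n, w x * mDen f f x = n * (w x * aDen f x) := fun x => by
    rw [mDen_self hf (norm_sph x)]; ring
  simp_rw [h2, integral_const_mul]
  ring

/-- The volume is monotone, since its first variation is integration against the positive density
`aDen`. -/
theorem IsSuppC2.vol_mono {f g : Amb n → ℝ} (hf : IsSuppC2 f) (hg : IsSuppC2 g)
    (hfg : ∀ x : Amb n, ‖x‖ = 1 → f x ≤ g x) : vol f ≤ vol g := by
  set w : Amb n → ℝ := fun x => g x + (-1) * f x with hw
  have hwC : IsHomC2 w := hg.homC2.add (hf.homC2.const_mul _)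
  -- The functions `f + t w`, `0 ≤ t ≤ 1`, join `f` to `g` by support functions.
  set F : ℝ → ℝ := fun t => vol fun y => f y + t * w y with hF
  have hder : ∀ t, HasDerivAt F ((n + 1) *
      ∫ x : Sph n, w x * aDen (fun y => f y + t * w y) x ∂(sphArea n)) t := fun t => by
    have h1 := hasDerivAt_vol (hf.homC2.add (hwC.const_mul t)) hwC
    have h2 : HasDerivAt (fun s : ℝ => s - t) 1 t := (hasDerivAt_id t).sub_const t
    have h3 := HasDerivAt.comp_of_eq t h1 h2 (sub_self t).symm
    have h4 : F = (fun s => vol fun y => f y + t * w y + s * w y) ∘ fun s : ℝ => s - t := by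
      ext s
      simp only [hF, Function.comp]
      congr 1
      ext y
      ring
    rw [h4]
    exact h3.congr_deriv (mul_one _)
  have hmono : MonotoneOn F (Set.Icc 0 1) := by
    refine monotoneOn_of_deriv_nonneg (convex_Icc 0 1)
      (fun t _ => (hder t).continuousAt.continuousWithinAt)
      (fun t _ => (hder t).differentiableAt.differentiableWithinAt) fun t ht => ?_
    rw [interior_Icc] at ht
    rw [(hder t).deriv]
    have hft : IsSuppC2 fun y => f y + t * w y := by
      have h1 := (hf.const_mul (show 0 < 1 - t by linarith [ht.2])).add_mul hg ht.1.le
      convert h1 using 2 with y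
      simp only [hw]
      ring
    refine mul_nonneg (by positivity) (integral_nonneg fun x => ?_)
    refine mul_nonneg ?_ (hft.aDen_pos (norm_sph x)).le
    have := hfg x (norm_sph x)
    simp only [hw]
    linarith
  have h := hmono (by simp) (by simp) (zero_le_one (α := ℝ))
  simpa [hF, hw] using h

theorem aDen_const_mul {f : Amb n → ℝ} (hf : IsHomC2 f) {c : ℝ} (hc : c ≠ 0) {x : Amb n}
    (hx : ‖x‖ = 1) : aDen (fun y => c * f y) x = c ^ n * aDen f x := by
  rw [aDen, hf.hessM_const_mul c (ne_zero_of_norm hx)]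
  exact det_smul_add_vecMulVec (Fintype.card_fin _) (hf.hessM_mulVec_self (ne_zero_of_norm hx))
    (dotProduct_self_of_norm hx) hc

theorem vol_const_mul {f : Amb n → ℝ} (hf : IsHomC2 f) {c : ℝ} (hc : c ≠ 0) :
    vol (fun y => c * f y) = c ^ (n + 1) * vol f := by
  rw [vol, vol, ← integral_const_mul]
  refine integral_congr_ae (Eventually.of_forall fun x => ?_)
  simp only [aDen_const_mul hf hc (norm_sph x)]
  ring

end SupportFunctions

/-! ### Restrictions to the sphere and homogeneous extensions -/

section Density

variable {n : ℕ}

theorem radialExt_of_ne {u : Sph n → ℝ} {x : Amb n} (hx : x ≠ 0) :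
    radialExt u x = u ⟨‖x‖⁻¹ • x, by simpa using norm_normalize hx⟩ := by
  rw [radialExt, dif_pos hx]

theorem radialExt_coe (u : Sph n → ℝ) (x : Sph n) : radialExt u x = u x := by
  rw [radialExt_of_ne (coe_sph_ne_zero x)]
  congr 1
  ext1
  simp

theorem radialExt_smul (u : Sph n → ℝ) {t : ℝ} (ht : 0 < t) (x : Amb n) :
    radialExt u (t • x) = radialExt u x := by
  by_cases hx : x = 0
  · simp [hx]
  · rw [radialExt_of_ne hx, radialExt_of_ne (smul_ne_zero ht.ne' hx)]
    congr 2
    rw [norm_smul, Real.norm_of_nonneg ht.le, smul_smul, mul_inv, mul_comm t⁻¹, mul_assoc,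
      inv_mul_cancel₀ ht.ne', mul_one]

/-- `u` is of class `C²`, in terms of its radial extension. -/
def IsC2Sph (u : Sph n → ℝ) : Prop := ContDiffOn ℝ 2 (radialExt u) {0}ᶜ

/-- The extension of a function on the sphere which is homogeneous of degree one. -/
def homExt (u : Sph n → ℝ) (x : Amb n) : ℝ := ‖x‖ * radialExt u x

theorem homExt_coe (u : Sph n → ℝ) (x : Sph n) : homExt u x = u x := by
  rw [homExt, radialExt_coe, norm_sph, one_mul]

theorem IsC2Sph.isHomC2 {u : Sph n → ℝ} (hu : IsC2Sph u) : IsHomC2 (homExt u) where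
  hom t ht x := by
    simp only [homExt]
    rw [radialExt_smul u ht, norm_smul, Real.norm_of_nonneg ht.le, mul_assoc]
  smooth := isHomC2_norm.smooth.mul hu

theorem IsC2Sph.congr {u : Sph n → ℝ} {F : Amb n → ℝ} (hF : ContDiffOn ℝ 2 F {0}ᶜ)
    (h : ∀ x : Amb n, x ≠ 0 → radialExt u x = F x) : IsC2Sph u :=
  hF.congr fun x hx => h x hx

theorem IsC2Sph.add {u v : Sph n → ℝ} (hu : IsC2Sph u) (hv : IsC2Sph v) :
    IsC2Sph fun x => u x + v x :=
  .congr (ContDiffOn.add hu hv) fun x hx => by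
    simp only [radialExt_of_ne hx]

theorem IsC2Sph.mul {u v : Sph n → ℝ} (hu : IsC2Sph u) (hv : IsC2Sph v) :
    IsC2Sph fun x => u x * v x :=
  .congr (ContDiffOn.mul hu hv) fun x hx => by
    simp only [radialExt_of_ne hx]

theorem isC2Sph_const (c : ℝ) : IsC2Sph fun _ : Sph n => c :=
  .congr contDiffOn_const fun x hx => by rw [radialExt_of_ne hx]

theorem contDiffOn_normalize : ContDiffOn ℝ 2 (fun x : Amb n => ‖x‖⁻¹ • x) {0}ᶜ :=
  ((isHomC2_norm.smooth).inv fun _ hx => norm_ne_zero_iff.2 hx).smul contDiffOn_id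

theorem isC2Sph_coord (i : Fin (n + 1)) : IsC2Sph fun x : Sph n => (x : Amb n) i :=
  .congr ((EuclideanSpace.proj (𝕜 := ℝ) i).contDiff.comp_contDiffOn contDiffOn_normalize)
    fun x hx => by rw [radialExt_of_ne hx]; rfl

theorem IsHomC2.isC2Sph {f : Amb n → ℝ} (hf : IsHomC2 f) : IsC2Sph fun x : Sph n => f x := by
  refine .congr ((isHomC2_norm.smooth.inv fun _ hx => norm_ne_zero_iff.2 hx).mul hf.smooth)
    fun x hx => ?_
  rw [radialExt_of_ne hx]
  exact hf.hom _ (inv_pos.2 (norm_pos_iff.2 hx)) x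

theorem IsC2Sph.inv {u : Sph n → ℝ} (hu : IsC2Sph u) (h0 : ∀ x, u x ≠ 0) :
    IsC2Sph fun x => (u x)⁻¹ := by
  refine .congr (ContDiffOn.inv hu fun x hx => ?_) fun x hx => ?_
  · rw [radialExt_of_ne hx]; exact h0 _
  · rw [Pi.inv_apply, radialExt_of_ne hx, radialExt_of_ne hx]

theorem IsC2Sph.continuous {u : Sph n → ℝ} (hu : IsC2Sph u) : Continuous u := by
  have h := continuous_sph_of_continuousOn (ContDiffOn.continuousOn hu)
  simpa only [radialExt_coe] using h

/-- The algebra of `C²` functions on the sphere. -/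
def c2Subalgebra (n : ℕ) : Subalgebra ℝ C(Sph n, ℝ) where
  carrier := {φ | IsC2Sph φ}
  mul_mem' ha hb := IsC2Sph.mul ha hb
  add_mem' ha hb := IsC2Sph.add ha hb
  algebraMap_mem' c := isC2Sph_const c

/-- `C²` functions are uniformly dense (Stone–Weierstrass). -/
theorem c2Subalgebra_dense (φ : C(Sph n, ℝ)) {ε : ℝ} (hε : 0 < ε) :
    ∃ ψ : C(Sph n, ℝ), IsC2Sph ψ ∧ ∀ x, |φ x - ψ x| < ε := by
  have hsep : (c2Subalgebra n).SeparatesPoints := by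
    intro x y hxy
    have : ∃ i, (x : Amb n) i ≠ (y : Amb n) i := by
      by_contra! h
      exact hxy (Subtype.ext (PiLp.ext h))
    obtain ⟨i, hi⟩ := this
    exact ⟨_, ⟨⟨fun x : Sph n => (x : Amb n) i, (isC2Sph_coord i).continuous⟩,
      isC2Sph_coord i, rfl⟩, hi⟩
  have hden := ContinuousMap.subalgebra_topologicalClosure_eq_top_of_separatesPoints _ hsep
  have hφ : φ ∈ (c2Subalgebra n).topologicalClosure := by rw [hden]; trivial
  obtain ⟨ψ, hψ, hd⟩ := Metric.mem_closure_iff.1 hφ ε hε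
  refine ⟨ψ, hψ, fun x => ?_⟩
  have := (ContinuousMap.dist_lt_iff hε).1 hd x
  rwa [Real.dist_eq] at this

end Density

/-! ### Convergence of area measures under uniform convergence of support functions -/

section Convergence

variable {n : ℕ}

/-- The `C²` support functions at uniform distance at most `ε` from `h` on the sphere. -/
def nearSet (h : Amb n → ℝ) (ε : ℝ) : Set (Amb n → ℝ) :=
  {f | IsSuppC2 f ∧ ∀ x : Amb n, ‖x‖ = 1 → |f x - h x| ≤ ε}

/-- The filter of `C²` support functions converging uniformly on the sphere to `h`. -/
def nearFilter (h : Amb n → ℝ) : Filter (Amb n → ℝ) :=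
  ⨅ ε : {ε : ℝ // 0 < ε}, 𝓟 (nearSet h ε)

theorem nearSet_mono (h : Amb n → ℝ) {ε δ : ℝ} (hεδ : ε ≤ δ) : nearSet h ε ⊆ nearSet h δ :=
  fun _ hf => ⟨hf.1, fun x hx => (hf.2 x hx).trans hεδ⟩

theorem nearFilter_hasBasis (h : Amb n → ℝ) :
    (nearFilter h).HasBasis (fun ε : ℝ => 0 < ε) (nearSet h) := by
  have hne : Nonempty {ε : ℝ // 0 < ε} := ⟨⟨1, one_pos⟩⟩
  have hb := hasBasis_iInf_principal (s := fun ε : {ε : ℝ // 0 < ε} => nearSet h ε) (by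
    intro a b
    exact ⟨⟨min a b, lt_min a.2 b.2⟩, nearSet_mono h (min_le_left _ _),
      nearSet_mono h (min_le_right _ _)⟩)
  refine hb.to_hasBasis (fun ε _ => ⟨ε, ε.2, subset_rfl⟩) fun ε hε => ⟨⟨ε, hε⟩, trivial, subset_rfl⟩

theorem nearSet_mem (h : Amb n → ℝ) {ε : ℝ} (hε : 0 < ε) : nearSet h ε ∈ nearFilter h :=
  (nearFilter_hasBasis h).mem_of_mem hε

theorem eventually_isSuppC2 (h : Amb n → ℝ) : ∀ᶠ f in nearFilter h, IsSuppC2 f :=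
  mem_of_superset (nearSet_mem h one_pos) fun _ hf => hf.1

theorem tendsto_near {ι : Type*} {l : Filter ι} {F : ι → Amb n → ℝ} {h : Amb n → ℝ}
    (hF : ∀ᶠ i in l, IsSuppC2 (F i))
    (hu : TendstoUniformlyOn F h l (Metric.sphere 0 1)) : Tendsto F l (nearFilter h) := by
  rw [(nearFilter_hasBasis h).tendsto_right_iff]
  intro ε hε
  filter_upwards [hF, Metric.tendstoUniformlyOn_iff.1 hu ε hε] with i h1 h2
  refine ⟨h1, fun x hx => ?_⟩
  have := h2 x (by simpa using hx)
  rw [dist_comm, Real.dist_eq] at this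
  exact this.le

/-- `h` is bounded below and above by positive constants on the sphere. -/
def IsPosBdd (h : Amb n → ℝ) : Prop :=
  ∃ c : ℝ, 0 < c ∧ ∃ M : ℝ, ∀ x : Amb n, ‖x‖ = 1 → c ≤ h x ∧ h x ≤ M

theorem IsHomC2.isPosBdd {g : Amb n → ℝ} (hg : IsHomC2 g)
    (hpos : ∀ x : Amb n, ‖x‖ = 1 → 0 < g x) : IsPosBdd g := by
  have hS : IsCompact (Metric.sphere (0 : Amb n) 1) := isCompact_sphere _ _
  have hsub : Metric.sphere (0 : Amb n) 1 ⊆ {0}ᶜ := fun x hx =>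
    ne_zero_of_norm (by simpa using hx)
  have hne : (Metric.sphere (0 : Amb n) 1).Nonempty := NormedSpace.sphere_nonempty.2 zero_le_one
  obtain ⟨a, ha, hamin⟩ := hS.exists_isMinOn hne (hg.continuousOn.mono hsub)
  obtain ⟨b, hb⟩ := hS.exists_bound_of_continuousOn (hg.continuousOn.mono hsub)
  refine ⟨g a, hpos a (by simpa using ha), b, fun x hx => ⟨?_, ?_⟩⟩
  · exact hamin (show x ∈ Metric.sphere (0 : Amb n) 1 by simpa using hx)
  · exact (le_abs_self _).trans (hb x (by simpa using hx))

theorem IsPosBdd.add_mul {h g : Amb n → ℝ} (hh : IsPosBdd h) (hg : IsPosBdd g) {t : ℝ}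
    (ht : 0 ≤ t) : IsPosBdd fun x => h x + t * g x := by
  obtain ⟨c, hc, M, hM⟩ := hh
  obtain ⟨c', hc', M', hM'⟩ := hg
  refine ⟨c, hc, M + t * M', fun x hx => ⟨?_, ?_⟩⟩
  · nlinarith [(hM x hx).1, (hM' x hx).1, mul_nonneg ht (hc'.le.trans (hM' x hx).1)]
  · nlinarith [(hM x hx).2, (hM' x hx).2]

theorem tendsto_near_add_mul (h : Amb n → ℝ) {g : Amb n → ℝ} (hg : IsSuppC2 g) {t : ℝ}
    (ht : 0 ≤ t) :
    Tendsto (fun f x => f x + t * g x) (nearFilter h) (nearFilter fun x => h x + t * g x) := by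
  rw [(nearFilter_hasBasis h).tendsto_iff (nearFilter_hasBasis _)]
  refine fun ε hε => ⟨ε, hε, fun f hf => ⟨hf.1.add_mul hg ht, fun x hx => ?_⟩⟩
  simpa using hf.2 x hx

theorem tendsto_near_prod (h : Amb n → ℝ) {t : ℝ} (ht : 0 ≤ t) :
    Tendsto (fun (p : (Amb n → ℝ) × (Amb n → ℝ)) x => p.1 x + t * p.2 x)
      (nearFilter h ×ˢ nearFilter h) (nearFilter fun x => h x + t * h x) := by
  rw [(nearFilter_hasBasis _).tendsto_right_iff]
  intro ε hε
  have h1 : 0 < ε / (1 + t) := by positivity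
  filter_upwards [prod_mem_prod (nearSet_mem h h1) (nearSet_mem h h1)] with p hp
  obtain ⟨hp1, hp2⟩ := hp
  refine ⟨hp1.1.add_mul hp2.1 ht, fun x hx => ?_⟩
  have e : p.1 x + t * p.2 x - (h x + t * h x) = (p.1 x - h x) + t * (p.2 x - h x) := by ring
  rw [e]
  calc |(p.1 x - h x) + t * (p.2 x - h x)| ≤ |p.1 x - h x| + t * |p.2 x - h x| := by
        refine (abs_add_le _ _).trans ?_
        rw [abs_mul, abs_of_nonneg ht]
    _ ≤ ε / (1 + t) + t * (ε / (1 + t)) := by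
        gcongr
        exacts [hp1.2 x hx, hp2.2 x hx]
    _ = ε := by field_simp

theorem exists_tendsto_of_oscillation {α : Type*} {l : Filter α} {Φ : α → ℝ}
    (h : ∀ ε : ℝ, 0 < ε → ∃ s ∈ l, ∀ a ∈ s, ∀ b ∈ s, |Φ a - Φ b| < ε) :
    ∃ ℓ, Tendsto Φ l (𝓝 ℓ) := by
  rcases l.eq_or_neBot with rfl | hl
  · exact ⟨0, tendsto_bot⟩
  · rw [← cauchy_map_iff_exists_tendsto, Metric.cauchy_iff]
    refine ⟨inferInstance, fun ε hε => ?_⟩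
    obtain ⟨s, hs, hsε⟩ := h ε hε
    refine ⟨Φ '' s, image_mem_map hs, ?_⟩
    rintro _ ⟨a, ha, rfl⟩ _ ⟨b, hb, rfl⟩
    exact hsε a ha b hb

/-- The volume converges when the support functions converge uniformly, by monotonicity and
homogeneity: functions close to `h` are comparable up to factors close to one. -/
theorem IsPosBdd.exists_tendsto_vol {h : Amb n → ℝ} (hh : IsPosBdd h) :
    ∃ ℓ, Tendsto vol (nearFilter h) (𝓝 ℓ) := by
  obtain ⟨c, hc, M, hM⟩ := hh
  have hMc : 0 < M + c := by
    obtain ⟨x, hx⟩ := NormedSpace.sphere_nonempty (E := Amb n) (x := 0) |>.2 zero_le_one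
    have := hM x (by simpa using hx)
    linarith
  set W := vol (fun x : Amb n => (M + c) * ‖x‖)
  have hlim : Tendsto (fun η : ℝ => ((1 + 4 * η / c) ^ (n + 1) - 1) * W) (𝓝[>] 0) (𝓝 0) := by
    have hcont : Continuous fun η : ℝ => ((1 + 4 * η / c) ^ (n + 1) - 1) * W := by fun_prop
    have := hcont.tendsto 0
    simp only [mul_zero, zero_div, add_zero, one_pow, sub_self, zero_mul] at this
    exact this.mono_left nhdsWithin_le_nhds
  refine exists_tendsto_of_oscillation fun ε hε => ?_
  obtain ⟨η, hη1, hη2, hη0⟩ : ∃ η : ℝ, ((1 + 4 * η / c) ^ (n + 1) - 1) * W < ε ∧ η < c / 2 ∧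
      0 < η := by
    have h1 := hlim.eventually (eventually_lt_nhds hε)
    have h2 : ∀ᶠ η : ℝ in 𝓝[>] 0, η < c / 2 :=
      nhdsWithin_le_nhds (eventually_lt_nhds (by positivity))
    exact (h1.and (h2.and self_mem_nhdsWithin)).exists
  refine ⟨nearSet h η, nearSet_mem h hη0, ?_⟩
  have hlow : ∀ f ∈ nearSet h η, ∀ x : Amb n, ‖x‖ = 1 → c / 2 ≤ f x := fun f hf x hx => by
    have := (abs_le.1 (hf.2 x hx)).1
    linarith [(hM x hx).1]
  have hone : ∀ f ∈ nearSet h η, ∀ g ∈ nearSet h η, vol g - vol f < ε := by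
    intro f hf g hg
    have hk : 0 < 1 + 4 * η / c := by positivity
    -- `g ≤ f + 2 η ≤ (1 + 4 η / c) f` because `f ≥ c / 2`.
    have h1 : vol g ≤ (1 + 4 * η / c) ^ (n + 1) * vol f := by
      rw [← vol_const_mul hf.1.homC2 hk.ne']
      refine hg.1.vol_mono (hf.1.const_mul hk) fun x hx => ?_
      have h2 := (abs_le.1 (hf.2 x hx)).1
      have h3 := (abs_le.1 (hg.2 x hx)).2
      have h4 : 2 * η ≤ 4 * η / c * f x := by
        calc 2 * η = 4 * η / c * (c / 2) := by field_simp; norm_num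
          _ ≤ _ := by gcongr; exact hlow f hf x hx
      nlinarith
    have h5 : vol f ≤ W := by
      refine hf.1.vol_mono (isSuppC2_norm.const_mul hMc) fun x hx => ?_
      have h2 := (abs_le.1 (hf.2 x hx)).2
      rw [hx]
      linarith [(hM x hx).2]
    have h6 : (1 : ℝ) ≤ (1 + 4 * η / c) ^ (n + 1) := one_le_pow₀ (by
      have : 0 ≤ 4 * η / c := by positivity
      linarith)
    nlinarith [mul_le_mul_of_nonneg_left h5 (sub_nonneg.2 h6)]
  intro f hf g hg
  rw [abs_lt]
  constructor <;> linarith [hone f hf g hg, hone g hg f hf]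

/-- The interpolation nodes are nonnegative, so only parameters `t ≥ 0` matter. -/
theorem exists_tendsto_interpDeriv {α : Type*} {l : Filter α} (N : ℕ) {Φ : ℝ → α → ℝ}
    (hΦ : ∀ t : ℝ, 0 ≤ t → ∃ ℓ, Tendsto (Φ t) l (𝓝 ℓ)) :
    ∃ ℓ, Tendsto (fun a => interpDeriv N fun t => Φ t a) l (𝓝 ℓ) := by
  choose ℓ hℓ using fun i : ℕ => hΦ i i.cast_nonneg
  exact ⟨_, tendsto_finsetSum _ fun i _ => (hℓ i).const_mul (derivWeight N i)⟩

/-- `(n + 1) ∫ g aDen f` is the first variation of the volume at `f` in direction `g`, hence a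
combination of values `vol (f + t g)` with `t ≥ 0`. -/
theorem exists_tendsto_integral_mul_aDen_of_pos {h g : Amb n → ℝ} (hh : IsPosBdd h)
    (hg : IsSuppC2 g) (hpos : ∀ x : Amb n, ‖x‖ = 1 → 0 < g x) :
    ∃ ℓ, Tendsto (fun f => ∫ x : Sph n, g x * aDen f x ∂(sphArea n)) (nearFilter h) (𝓝 ℓ) := by
  have h1 : ∃ ℓ, Tendsto (fun f : Amb n → ℝ => interpDeriv (n + 2) fun t =>
      vol fun y => f y + t * g y) (nearFilter h) (𝓝 ℓ) :=
    exists_tendsto_interpDeriv _ fun t ht => by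
      obtain ⟨ℓ, hℓ⟩ := (hh.add_mul (hg.homC2.isPosBdd hpos) ht).exists_tendsto_vol
      exact ⟨ℓ, hℓ.comp (tendsto_near_add_mul h hg ht)⟩
  obtain ⟨ℓ, hℓ⟩ := h1
  refine ⟨((n : ℝ) + 1)⁻¹ * ℓ, (hℓ.const_mul ((n : ℝ) + 1)⁻¹).congr' ?_⟩
  filter_upwards [eventually_isSuppC2 h] with f hf
  rw [interpDeriv_eq (isPolyDeg_vol hf.homC2 hg.homC2) (hasDerivAt_vol hf.homC2 hg.homC2),
    inv_mul_cancel_left₀ (by positivity)]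

/-- A family of densities `d f`, continuous for `C²` support functions `f`, such that the measures
`d f dS` converge weakly as `f` tends uniformly to `h`. -/
structure ConvergesNear (h : Amb n → ℝ) (d : (Amb n → ℝ) → Sph n → ℝ) : Prop where
  cont : ∀ f, IsSuppC2 f → Continuous (d f)
  lim : ∀ φ : C(Sph n, ℝ), ∃ ℓ, Tendsto (fun f => ∫ x, φ x * d f x ∂(sphArea n))
    (nearFilter h) (𝓝 ℓ)

namespace ConvergesNear

variable {h : Amb n → ℝ} {d e : (Amb n → ℝ) → Sph n → ℝ}

theorem integrable (hd : ConvergesNear h d) (φ : C(Sph n, ℝ)) {f : Amb n → ℝ} (hf : IsSuppC2 f) :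
    Integrable (fun x => φ x * d f x) (sphArea n) :=
  integrable_sph (φ.continuous.mul (hd.cont f hf)) _

theorem add (hd : ConvergesNear h d) (he : ConvergesNear h e) :
    ConvergesNear h fun f x => d f x + e f x where
  cont f hf := (hd.cont f hf).add (he.cont f hf)
  lim φ := by
    obtain ⟨ℓ, hℓ⟩ := hd.lim φ
    obtain ⟨m, hm⟩ := he.lim φ
    refine ⟨ℓ + m, (hℓ.add hm).congr' ?_⟩
    filter_upwards [eventually_isSuppC2 h] with f hf
    rw [← integral_add (hd.integrable φ hf) (he.integrable φ hf)]
    simp only [mul_add]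

theorem mul (hd : ConvergesNear h d) {ψ : Sph n → ℝ} (hψ : Continuous ψ) :
    ConvergesNear h fun f x => ψ x * d f x where
  cont f hf := hψ.mul (hd.cont f hf)
  lim φ := by
    obtain ⟨ℓ, hℓ⟩ := hd.lim (φ * ⟨ψ, hψ⟩)
    refine ⟨ℓ, hℓ.congr fun f => ?_⟩
    simp [mul_assoc]

theorem congr (hd : ConvergesNear h d) (hde : ∀ f, IsSuppC2 f → ∀ x, d f x = e f x) :
    ConvergesNear h e where
  cont f hf := by
    have : e f = d f := funext fun x => (hde f hf x).symm
    rw [this]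
    exact hd.cont f hf
  lim φ := by
    obtain ⟨ℓ, hℓ⟩ := hd.lim φ
    refine ⟨ℓ, hℓ.congr' ?_⟩
    filter_upwards [eventually_isSuppC2 h] with f hf
    simp only [hde f hf]

end ConvergesNear

theorem exists_tendsto_integral_homC2_mul_aDen {h g : Amb n → ℝ} (hh : IsPosBdd h)
    (hg : IsHomC2 g) :
    ∃ ℓ, Tendsto (fun f => ∫ x : Sph n, g x * aDen f x ∂(sphArea n)) (nearFilter h) (𝓝 ℓ) := by
  obtain ⟨c, hc, hg', hpos⟩ := hg.exists_isSuppC2_add_norm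
  obtain ⟨ℓ, hℓ⟩ := exists_tendsto_integral_mul_aDen_of_pos hh hg' hpos
  obtain ⟨m, hm⟩ := exists_tendsto_integral_mul_aDen_of_pos hh isSuppC2_norm
    (fun x hx => by rw [hx]; exact one_pos)
  refine ⟨ℓ - c * m, (hℓ.sub (hm.const_mul c)).congr' ?_⟩
  filter_upwards [eventually_isSuppC2 h] with f hf
  have i1 : Integrable (fun x : Sph n => (g x + c * ‖(x : Amb n)‖) * aDen f x) (sphArea n) :=
    integrable_sph (hg'.homC2.continuous_sph.mul hf.homC2.continuous_aDen) _
  have i2 : Integrable (fun x : Sph n => ‖(x : Amb n)‖ * aDen f x) (sphArea n) :=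
    integrable_sph (isHomC2_norm.continuous_sph.mul hf.homC2.continuous_aDen) _
  rw [← integral_const_mul, ← integral_sub i1 (i2.const_mul c)]
  congr 1
  ext x
  ring

/-- Area measures converge weakly when support functions converge uniformly. -/
theorem IsPosBdd.convergesNear_aDen {h : Amb n → ℝ} (hh : IsPosBdd h) :
    ConvergesNear h fun f (x : Sph n) => aDen f x where
  cont f hf := hf.homC2.continuous_aDen
  lim φ := by
    have hmass : ∃ B : ℝ, 0 < B ∧ ∃ s ∈ nearFilter h, ∀ f ∈ s, IsSuppC2 f ∧
        ∫ x : Sph n, aDen f x ∂(sphArea n) ≤ B := by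
      obtain ⟨m, hm⟩ := exists_tendsto_integral_homC2_mul_aDen hh isHomC2_norm
      refine ⟨|m| + 1, by positivity, _, inter_mem (eventually_isSuppC2 h)
        (hm.eventually (eventually_le_nhds (show m < |m| + 1 by
          linarith [le_abs_self m]))), fun f hf => ⟨hf.1, ?_⟩⟩
      have := hf.2
      simpa using this
    obtain ⟨B, hB, s, hs, hsB⟩ := hmass
    refine exists_tendsto_of_oscillation fun ε hε => ?_
    obtain ⟨ψ, hψ, hφψ⟩ := c2Subalgebra_dense φ (show 0 < ε / (4 * B) by positivity)
    obtain ⟨ℓ, hℓ⟩ := exists_tendsto_integral_homC2_mul_aDen hh hψ.isHomC2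
    simp only [homExt_coe] at hℓ
    have hs' := hℓ.eventually (Metric.ball_mem_nhds ℓ (show 0 < ε / 4 by positivity))
    have hclose : ∀ f ∈ s, |∫ x : Sph n, φ x * aDen f x ∂(sphArea n)
        - ∫ x : Sph n, ψ x * aDen f x ∂(sphArea n)| ≤ ε / 4 := by
      intro f hf
      obtain ⟨hfS, hfB⟩ := hsB f hf
      have hc := hfS.homC2.continuous_aDen
      have i1 : Integrable (fun x : Sph n => φ x * aDen f x) (sphArea n) :=
        integrable_sph (φ.continuous.mul hc) _
      have i2 : Integrable (fun x : Sph n => ψ x * aDen f x) (sphArea n) :=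
        integrable_sph (ψ.continuous.mul hc) _
      rw [← integral_sub i1 i2]
      calc |∫ x : Sph n, (φ x * aDen f x - ψ x * aDen f x) ∂(sphArea n)|
          ≤ ∫ x : Sph n, |φ x * aDen f x - ψ x * aDen f x| ∂(sphArea n) :=
            abs_integral_le_integral_abs
        _ ≤ ∫ x : Sph n, ε / (4 * B) * aDen f x ∂(sphArea n) := by
            refine integral_mono (i1.sub i2).abs (integrable_sph (continuous_const.mul hc) _)
              fun x => ?_
            have h0 := (hfS.aDen_pos (norm_sph x)).le
            change |φ x * aDen f x - ψ x * aDen f x| ≤ ε / (4 * B) * aDen f x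
            rw [← sub_mul, abs_mul, abs_of_nonneg h0]
            exact mul_le_mul_of_nonneg_right (hφψ x).le h0
        _ ≤ ε / (4 * B) * B := by
            rw [integral_const_mul]
            gcongr
        _ = ε / 4 := by field_simp
    refine ⟨_, inter_mem hs hs', fun f hf g hg => ?_⟩
    have h1 := abs_le.1 (hclose f hf.1)
    have h2 := abs_le.1 (hclose g hg.1)
    have h3 : |∫ x : Sph n, ψ x * aDen f x ∂(sphArea n) - ℓ| < ε / 4 := hf.2
    have h4 : |∫ x : Sph n, ψ x * aDen g x ∂(sphArea n) - ℓ| < ε / 4 := hg.2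
    rw [abs_lt] at h3 h4 ⊢
    constructor <;> linarith [h1.1, h1.2, h2.1, h2.2, h3.1, h3.2, h4.1, h4.2]

theorem integral_mul_mDen_eq_interpDeriv {f g : Amb n → ℝ} (hf : IsHomC2 f) (hg : IsHomC2 g)
    (φ : C(Sph n, ℝ)) :
    ∫ x : Sph n, φ x * mDen f g x ∂(sphArea n) = interpDeriv (n + 1) fun t =>
      ∫ x : Sph n, φ x * aDen (fun y => f y + t * g y) x ∂(sphArea n) := by
  rw [← integral_interpDeriv]
  · congr 1
    ext x
    rw [interpDeriv_const_mul, interpDeriv_aDen hf hg (coe_sph_ne_zero x)]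
  · exact fun t => integrable_sph
      (φ.continuous.mul (hf.add (hg.const_mul t)).continuous_aDen) _

theorem mDen_sub_norm {f g : Amb n → ℝ} (hg : IsHomC2 g) (c : ℝ) {x : Amb n} (hx : x ≠ 0) :
    mDen f g x = mDen f (fun y => g y + c * ‖y‖) x + (-c) * mDen f (fun y => ‖y‖) x := by
  simp only [mDen]
  rw [hessM_line hg isHomC2_norm c hx, mul_add, Matrix.mul_smul, Matrix.trace_add,
    Matrix.trace_smul, smul_eq_mul]
  ring

theorem IsPosBdd.convergesNear_mDen_of_pos {h g : Amb n → ℝ} (hh : IsPosBdd h)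
    (hg : IsSuppC2 g) (hpos : ∀ x : Amb n, ‖x‖ = 1 → 0 < g x) :
    ConvergesNear h fun f (x : Sph n) => mDen f g x where
  cont f hf := hf.homC2.continuous_mDen hg.homC2
  lim φ := by
    have h1 : ∃ ℓ, Tendsto (fun f : Amb n → ℝ => interpDeriv (n + 1) fun t =>
        ∫ x : Sph n, φ x * aDen (fun y => f y + t * g y) x ∂(sphArea n)) (nearFilter h) (𝓝 ℓ) :=
      exists_tendsto_interpDeriv _ fun t ht => by
        obtain ⟨ℓ, hℓ⟩ := (hh.add_mul (hg.homC2.isPosBdd hpos) ht).convergesNear_aDen.lim φ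
        exact ⟨ℓ, hℓ.comp (tendsto_near_add_mul h hg ht)⟩
    obtain ⟨ℓ, hℓ⟩ := h1
    refine ⟨ℓ, hℓ.congr' ?_⟩
    filter_upwards [eventually_isSuppC2 h] with f hf
    rw [integral_mul_mDen_eq_interpDeriv hf.homC2 hg.homC2]

/-- Mixed area measures with one fixed `C²` entry converge weakly when support functions converge
uniformly. -/
theorem IsPosBdd.convergesNear_mDen {h g : Amb n → ℝ} (hh : IsPosBdd h) (hg : IsHomC2 g) :
    ConvergesNear h fun f (x : Sph n) => mDen f g x := by
  obtain ⟨c, hc, hg', hpos⟩ := hg.exists_isSuppC2_add_norm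
  refine ((hh.convergesNear_mDen_of_pos hg' hpos).add
    ((hh.convergesNear_mDen_of_pos isSuppC2_norm
      (fun x hx => by rw [hx]; exact one_pos)).mul (continuous_const (y := -c)))).congr
    fun f _ x => ?_
  rw [mDen_sub_norm hg c (coe_sph_ne_zero x)]

/-- If both entries of the mixed area measure tend to `h`, it converges to `n` times the area
measure of `h`. -/
theorem IsPosBdd.tendsto_integral_mul_mDen_prod {h : Amb n → ℝ} (hh : IsPosBdd h)
    [(nearFilter h).NeBot] (φ : C(Sph n, ℝ)) {ℓ : ℝ}
    (hℓ : Tendsto (fun f => ∫ x : Sph n, φ x * aDen f x ∂(sphArea n)) (nearFilter h) (𝓝 ℓ)) :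
    Tendsto (fun p : (Amb n → ℝ) × (Amb n → ℝ) => ∫ x : Sph n, φ x * mDen p.1 p.2 x ∂(sphArea n))
      (nearFilter h ×ˢ nearFilter h) (𝓝 (n * ℓ)) := by
  have h1 : ∃ m, Tendsto (fun p : (Amb n → ℝ) × (Amb n → ℝ) => interpDeriv (n + 1) fun t =>
      ∫ x : Sph n, φ x * aDen (fun y => p.1 y + t * p.2 y) x ∂(sphArea n))
      (nearFilter h ×ˢ nearFilter h) (𝓝 m) :=
    exists_tendsto_interpDeriv _ fun t ht => by
      obtain ⟨ℓ, hℓ⟩ := (hh.add_mul hh ht).convergesNear_aDen.lim φ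
      exact ⟨ℓ, hℓ.comp (tendsto_near_prod h ht)⟩
  obtain ⟨m, hm⟩ := h1
  have hm' : Tendsto (fun p : (Amb n → ℝ) × (Amb n → ℝ) =>
      ∫ x : Sph n, φ x * mDen p.1 p.2 x ∂(sphArea n)) (nearFilter h ×ˢ nearFilter h) (𝓝 m) := by
    refine hm.congr' ?_
    filter_upwards [prod_mem_prod (eventually_isSuppC2 h) (eventually_isSuppC2 h)] with p hp
    rw [integral_mul_mDen_eq_interpDeriv hp.1.homC2 hp.2.homC2]
  have hdiag : Tendsto (fun f : Amb n → ℝ => (f, f)) (nearFilter h)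
      (nearFilter h ×ˢ nearFilter h) := tendsto_id.prodMk tendsto_id
  have h2 : Tendsto (fun f : Amb n → ℝ => ∫ x : Sph n, φ x * mDen f f x ∂(sphArea n))
      (nearFilter h) (𝓝 (n * ℓ)) := by
    refine (hℓ.const_mul (n : ℝ)).congr' ?_
    filter_upwards [eventually_isSuppC2 h] with f hf
    rw [← integral_const_mul]
    congr 1
    ext x
    rw [mDen_self hf.homC2 (norm_sph x)]
    ring
  rw [← tendsto_nhds_unique (hm'.comp hdiag) h2]
  exact hm'

end Convergence

/-! ### Energy and trace densities -/

section Densities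

open Matrix

variable {n : ℕ}

/-- A `C²` function on the manifold `S^n` has a `C²` extension of degree zero. -/
theorem isC2Sph_of_contMDiff {u : Sph n → ℝ} (hu : ContMDiff (𝓡 n) 𝓘(ℝ, ℝ) 2 u) : IsC2Sph u := by
  have := Fact.mk (@finrank_euclideanSpace_fin ℝ _ (n + 1))
  intro x hx
  let U : TopologicalSpace.Opens (Amb n) := ⟨{0}ᶜ, isOpen_compl_singleton⟩
  have hU : ∀ y : U, ‖(y : Amb n)‖⁻¹ • (y : Amb n) ∈ Metric.sphere (0 : Amb n) 1 := fun y => by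
    simpa using norm_normalize y.2
  have h1 : ContMDiff 𝓘(ℝ, Amb n) 𝓘(ℝ, Amb n) 2
      fun y : U => ‖(y : Amb n)‖⁻¹ • (y : Amb n) := fun y => by
    rw [contMDiffAt_subtype_iff (f := fun y : Amb n => ‖y‖⁻¹ • y)]
    exact (contDiffOn_normalize.contDiffAt (isOpen_compl_singleton.mem_nhds y.2)).contMDiffAt
  have h2 := hu.comp (h1.codRestrict_sphere hU)
  have h3 : (fun y : U => radialExt u y) = u ∘ Set.codRestrict _ _ hU := by
    ext y
    rw [radialExt_of_ne y.2]
    rfl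
  rw [← h3] at h2
  have h4 := contMDiffAt_subtype_iff.1 (h2 ⟨x, hx⟩)
  exact h4.contDiffAt.contDiffWithinAt

theorem IsC2Sph.contMDiff {u : Sph n → ℝ} (hu : IsC2Sph u) : ContMDiff (𝓡 n) 𝓘(ℝ, ℝ) 2 u := by
  have := Fact.mk (@finrank_euclideanSpace_fin ℝ _ (n + 1))
  intro x
  have h1 : ContMDiffAt 𝓘(ℝ, Amb n) 𝓘(ℝ, ℝ) 2 (radialExt u) (x : Amb n) :=
    (ContDiffOn.contDiffAt hu (isOpen_compl_singleton.mem_nhds (coe_sph_ne_zero x))).contMDiffAt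
  have h2 := h1.comp x (contMDiff_coe_sphere (n := n) x)
  have h3 : radialExt u ∘ ((↑) : Sph n → Amb n) = u := funext fun y => radialExt_coe u y
  rwa [h3] at h2

theorem mem_C2Even_iff {u : Sph n → ℝ} : u ∈ C2Even n ↔ IsC2Sph u ∧ ∀ x : Sph n, u (-x) = u x :=
  ⟨fun h => ⟨isC2Sph_of_contMDiff h.1, h.2⟩, fun h => ⟨h.1.contMDiff, h.2⟩⟩

/-- Multiplication of a homogeneous function by a function on the sphere. -/
theorem IsC2Sph.radialExt_mul {u : Sph n → ℝ} (hu : IsC2Sph u) {g : Amb n → ℝ} (hg : IsHomC2 g) :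
    IsHomC2 fun x => radialExt u x * g x where
  hom t ht x := by
    rw [radialExt_smul u ht, hg.hom t ht]; ring
  smooth := ContDiffOn.mul hu hg.smooth

/-- The density `U^{ij} u_i u_j` for a function in place of a support function. -/
def eDen (u : Sph n → ℝ) (f : Amb n → ℝ) (x : Sph n) : ℝ :=
  sphGrad u x ⬝ᵥ ((hessM f x + radM x).adjugate *ᵥ sphGrad u x)

theorem areaDensity_eq (L : ConvexBody (Amb n)) (x : Sph n) :
    areaDensity L x = aDen (supp L) x := rfl

theorem energyDensity_eq (u : Sph n → ℝ) (L : ConvexBody (Amb n)) (x : Sph n) :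
    energyDensity u L x = eDen u (supp L) x := rfl

theorem traceDensity_eq {L : ConvexBody (Amb n)} (hL : IsHomC2 (supp L)) (x : Sph n) :
    traceDensity L x = mDen (supp L) (fun y => ‖y‖) x := by
  have h1 : bigHess L x = hessM (supp L) x + radM x := rfl
  have h2 := trace_adjugate_mul_vecMulVec (hL.hessM_mulVec_self (coe_sph_ne_zero x))
    (dotProduct_self_of_norm (norm_sph x))
  rw [traceDensity, h1, mDen, hessM_norm (norm_sph x), mul_sub, mul_one, trace_sub]
  congr 1
  exact h2.symm

/-- The energy density in terms of mixed densities: the Leibniz rule gives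
`g D²(u²g) - 2ug D²(ug) + u²g D²g = 2g² ∇u ⊗ ∇u`. -/
theorem sq_mul_eDen {u : Sph n → ℝ} (hu : IsC2Sph u) {f g : Amb n → ℝ} (hg : IsHomC2 g)
    (x : Sph n) :
    2 * (g x ^ 2 * eDen u f x)
      = g x * mDen f (fun y => radialExt u y * (radialExt u y * g y)) x
        - 2 * (u x * g x) * mDen f (fun y => radialExt u y * g y) x
        + u x ^ 2 * g x * mDen f g x := by
  have hx := coe_sph_ne_zero x
  have cU : ContDiffAt ℝ 2 (radialExt u) (x : Amb n) :=
    ContDiffOn.contDiffAt hu (isOpen_compl_singleton.mem_nhds hx)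
  have cG := hg.contDiffAt hx
  have cW := (hu.radialExt_mul hg).contDiffAt hx
  have hU : radialExt u (x : Amb n) = u x := radialExt_coe u x
  have hfd : ∀ w, fderiv ℝ (fun y => radialExt u y * g y) (x : Amb n) w
      = u x * fderiv ℝ g x w + g x * fderiv ℝ (radialExt u) x w := fun w => by
    rw [fderiv_fun_mul (cU.differentiableAt two_ne_zero) (cG.differentiableAt two_ne_zero), hU]
    rfl
  have hM : (2 * g x ^ 2) • vecMulVec (sphGrad u x) (sphGrad u x)
      = g x • hessM (fun y => radialExt u y * (radialExt u y * g y)) x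
        - (2 * (u x * g x)) • hessM (fun y => radialExt u y * g y) x
        + (u x ^ 2 * g x) • hessM g x := by
    ext i j
    simp only [Matrix.add_apply, Matrix.sub_apply, Matrix.smul_apply, smul_eq_mul, hessM, of_apply,
      vecMulVec_apply, sphGrad]
    rw [hess_mul cU cW, hess_mul cU cG, hfd, hfd, hU]
    ring
  have hT := congrArg (fun M => ((hessM f x + radM x).adjugate * M).trace) hM
  simp only [mul_add, mul_sub, Matrix.mul_smul, trace_add, trace_sub, trace_smul,
    smul_eq_mul] at hT
  rw [mul_vecMulVec, trace_vecMulVec, dotProduct_comm] at hT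
  simp only [mDen, eDen]
  linarith

theorem IsSuppC2.eDen_nonneg {f : Amb n → ℝ} (hf : IsSuppC2 f) (u : Sph n → ℝ) (x : Sph n) :
    0 ≤ eDen u f x := by
  have := (hf.adjugate_posSemidef (norm_sph x)).dotProduct_mulVec_nonneg (sphGrad u x)
  simpa [eDen] using this

theorem IsPosBdd.convergesNear_eDen {h : Amb n → ℝ} (hh : IsPosBdd h) {u : Sph n → ℝ}
    (hu : IsC2Sph u) : ConvergesNear h (eDen u) := by
  have huc := hu.continuous
  have h1 := hu.radialExt_mul (g := fun y => ‖y‖) isHomC2_norm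
  refine (((hh.convergesNear_mDen (hu.radialExt_mul h1)).mul (continuous_const (y := 1 / 2))).add
    (((hh.convergesNear_mDen h1).mul (huc.neg)).add
      ((hh.convergesNear_mDen isHomC2_norm).mul
        ((huc.pow 2).mul (continuous_const (y := 1 / 2)))))).congr fun f hf x => ?_
  have h2 := sq_mul_eDen hu (f := f) isHomC2_norm x
  simp only [norm_sph] at h2
  simp only [Pi.neg_apply, Pi.mul_apply, Pi.pow_apply]
  linarith

/-- Integrated form of the energy identity. -/
theorem integral_sq_mul_eDen {u : Sph n → ℝ} (hu : IsC2Sph u) {f g : Amb n → ℝ}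
    (hf : IsHomC2 f) (hg : IsHomC2 g) :
    ∫ x : Sph n, g x ^ 2 * eDen u f x ∂(sphArea n)
      = ∫ x : Sph n, u x ^ 2 * g x * mDen f g x ∂(sphArea n)
        - ∫ x : Sph n, u x * g x * mDen f (fun y => radialExt u y * g y) x ∂(sphArea n) := by
  have h1 := hu.radialExt_mul hg
  have h2 := hu.radialExt_mul h1
  have c1 := hf.continuous_mDen h1
  have c2 := hf.continuous_mDen h2
  have c3 := hf.continuous_mDen hg
  have cg := hg.continuous_sph
  have cu := hu.continuous
  have i1 : Integrable (fun x : Sph n =>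
      g x * mDen f (fun y => radialExt u y * (radialExt u y * g y)) x) (sphArea n) :=
    integrable_sph (cg.mul c2) _
  have i2 : Integrable (fun x : Sph n =>
      u x * g x * mDen f (fun y => radialExt u y * g y) x) (sphArea n) :=
    integrable_sph ((cu.mul cg).mul c1) _
  have i3 : Integrable (fun x : Sph n => u x ^ 2 * g x * mDen f g x) (sphArea n) :=
    integrable_sph (((cu.pow 2).mul cg).mul c3) _
  have hsym := integral_mul_mDen_comm hf hg h2
  have e1 : ∀ x : Sph n, radialExt u x * (radialExt u x * g x) * mDen f g x
      = u x ^ 2 * g x * mDen f g x := fun x => by rw [radialExt_coe]; ring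
  simp_rw [e1] at hsym
  have hpt : ∀ x : Sph n, g x ^ 2 * eDen u f x
      = 1 / 2 * (g x * mDen f (fun y => radialExt u y * (radialExt u y * g y)) x)
        - u x * g x * mDen f (fun y => radialExt u y * g y) x
        + 1 / 2 * (u x ^ 2 * g x * mDen f g x) := fun x => by
    have := sq_mul_eDen hu (f := f) hg x
    linarith
  have i4 : Integrable (fun x : Sph n =>
      1 / 2 * (g x * mDen f (fun y => radialExt u y * (radialExt u y * g y)) x)
        - u x * g x * mDen f (fun y => radialExt u y * g y) x) (sphArea n) :=
    (i1.const_mul _).sub i2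
  simp_rw [hpt]
  rw [integral_add i4 (i3.const_mul _), integral_sub (i1.const_mul _) i2,
    integral_const_mul, integral_const_mul, hsym]
  ring

/-- The substitution `z = u g` in the energy: for a smooth body with support function `f`,
`∫ U^{ij} z_i z_j - ∫ U^{ij} δ_{ij} z² = ∫ g² U^{ij} u_i u_j - ∫ u² g U^{ij} (g_{ij} + g δ_{ij})`. -/
theorem integral_eDen_mul {u : Sph n → ℝ} (hu : IsC2Sph u) {f g : Amb n → ℝ}
    (hf : IsHomC2 f) (hg : IsHomC2 g) :
    ∫ x : Sph n, eDen (fun x => u x * g x) f x ∂(sphArea n)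
        - ∫ x : Sph n, (u x * g x) ^ 2 * mDen f (fun y => ‖y‖) x ∂(sphArea n)
      = ∫ x : Sph n, g x ^ 2 * eDen u f x ∂(sphArea n)
        - ∫ x : Sph n, u x ^ 2 * g x * mDen f g x ∂(sphArea n) := by
  have hz : IsC2Sph fun x : Sph n => u x * g x := hu.mul hg.isC2Sph
  have h1 := integral_sq_mul_eDen hz hf isHomC2_norm
  have h2 := integral_sq_mul_eDen hu hf hg
  have e : ∀ x : Sph n, mDen f (fun y => radialExt (fun x : Sph n => u x * g x) y * ‖y‖) x
      = mDen f (fun y => radialExt u y * g y) x := fun x => by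
    have : (fun y => radialExt (fun x : Sph n => u x * g x) y * ‖y‖)
        =ᶠ[𝓝 (x : Amb n)] fun y => radialExt u y * g y := by
      filter_upwards [eventually_ne_zero (coe_sph_ne_zero x)] with y hy
      rw [radialExt_of_ne hy, radialExt_of_ne hy]
      simp only
      rw [hg.hom _ (inv_pos.2 (norm_pos_iff.2 hy))]
      have := norm_ne_zero_iff.2 hy
      field_simp
    have hM : hessM (fun y => radialExt (fun x : Sph n => u x * g x) y * ‖y‖) (x : Amb n)
        = hessM (fun y => radialExt u y * g y) x := by
      ext i j
      exact hess_congr this _ _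
    rw [mDen, mDen, hM]
  simp only [norm_sph, one_pow, one_mul, mul_one, e] at h1
  rw [h1, h2]
  ring

end Densities

/-! ### Weak limits -/

section WeakLimits

variable {n : ℕ}

theorem supp_smul (K : ConvexBody (Amb n)) {t : ℝ} (ht : 0 < t) (x : Amb n) :
    supp K (t • x) = t * supp K x := by
  rw [supp, supp, ← smul_eq_mul, ← Real.sSup_smul_of_nonneg ht.le]
  congr 1
  ext r
  simp [Set.mem_smul_set, inner_smul_left]

theorem IsSmoothPosEven.isSuppC2 {L : ConvexBody (Amb n)} (hL : IsSmoothPosEven L) :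
    IsSuppC2 (supp L) :=
  ⟨⟨fun _ ht x => supp_smul L ht x, hL.2.1⟩, hL.2.2⟩

/-- `μ` is the weak limit of the measures `d f dS` as `f` tends to `h`. -/
def IsNearLimit (h : Amb n → ℝ) (d : (Amb n → ℝ) → Sph n → ℝ) (μ : Measure (Sph n)) : Prop :=
  IsFiniteMeasure μ ∧ ∀ φ : C(Sph n, ℝ), Tendsto (fun f => ∫ x, φ x * d f x ∂(sphArea n))
    (nearFilter h) (𝓝 (∫ x, φ x ∂μ))

/-- The limit of convergent nonnegative densities is represented by a measure
(Riesz–Markov–Kakutani). -/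
theorem ConvergesNear.exists_isNearLimit {h : Amb n → ℝ} {d : (Amb n → ℝ) → Sph n → ℝ}
    (hd : ConvergesNear h d) [(nearFilter h).NeBot]
    (hpos : ∀ f, IsSuppC2 f → ∀ x, 0 ≤ d f x) : ∃ μ, IsNearLimit h d μ := by
  choose ℓ hℓ using hd.lim
  have hadd : ∀ φ ψ, ℓ (φ + ψ) = ℓ φ + ℓ ψ := fun φ ψ => by
    refine tendsto_nhds_unique (hℓ (φ + ψ)) (((hℓ φ).add (hℓ ψ)).congr' ?_)
    filter_upwards [eventually_isSuppC2 h] with f hf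
    rw [← integral_add (hd.integrable φ hf) (hd.integrable ψ hf)]
    simp only [ContinuousMap.add_apply, add_mul]
  have hsmul : ∀ (c : ℝ) φ, ℓ (c • φ) = c * ℓ φ := fun c φ => by
    refine tendsto_nhds_unique (hℓ (c • φ)) (((hℓ φ).const_mul c).congr fun f => ?_)
    rw [← integral_const_mul]
    simp only [ContinuousMap.smul_apply, smul_eq_mul, mul_assoc]
  have hnn : ∀ φ : C(Sph n, ℝ), (∀ x, 0 ≤ φ x) → 0 ≤ ℓ φ := fun φ hφ => by
    refine ge_of_tendsto (hℓ φ) ?_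
    filter_upwards [eventually_isSuppC2 h] with f hf
    exact integral_nonneg fun x => mul_nonneg (hφ x) (hpos f hf x)
  let Λ : CompactlySupportedContinuousMap (Sph n) ℝ →ₗ[ℝ] ℝ :=
    { toFun := fun φ => ℓ φ.toContinuousMap
      map_add' := fun φ ψ => hadd _ _
      map_smul' := fun c φ => hsmul _ _ }
  let Λp := PositiveLinearMap.mk₀ Λ fun φ hφ => hnn _ (CompactlySupportedContinuousMap.le_def.1 hφ)
  refine ⟨RealRMK.rieszMeasure Λp, inferInstance, fun φ => ?_⟩
  have h1 := RealRMK.integral_rieszMeasure Λp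
    (CompactlySupportedContinuousMap.continuousMapEquiv φ)
  have h2 : ∫ x, φ x ∂(RealRMK.rieszMeasure Λp) = ℓ φ := h1
  rw [h2]
  exact hℓ φ

/-- `h_K` is a uniform limit of support functions of smooth symmetric bodies. -/
def HasSmoothApprox (K : ConvexBody (Amb n)) : Prop :=
  ∃ L : ℕ → ConvexBody (Amb n), (∀ k, IsSmoothPosEven (L k)) ∧
    TendstoUniformlyOn (fun k => supp (L k)) (supp K) atTop (Metric.sphere 0 1)

theorem HasSmoothApprox.neBot {K : ConvexBody (Amb n)} (hK : HasSmoothApprox K) :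
    (nearFilter (supp K)).NeBot := by
  obtain ⟨L, hL, hu⟩ := hK
  exact (tendsto_near (Eventually.of_forall fun k => (hL k).isSuppC2) hu).neBot

/-- The weak limit along the filter is the only measure which is a weak limit along sequences. -/
theorem isWeakLimitMeasure_iff {K : ConvexBody (Amb n)} (hK : HasSmoothApprox K)
    {D : ConvexBody (Amb n) → Sph n → ℝ} {d : (Amb n → ℝ) → Sph n → ℝ}
    (hDd : ∀ L, IsSmoothPosEven L → ∀ x, D L x = d (supp L) x) {μ : Measure (Sph n)}
    (hμ : IsNearLimit (supp K) d μ) (ν : Measure (Sph n)) :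
    IsWeakLimitMeasure D K ν ↔ ν = μ := by
  have hlim : ∀ L : ℕ → ConvexBody (Amb n), (∀ k, IsSmoothPosEven (L k)) →
      TendstoUniformlyOn (fun k => supp (L k)) (supp K) atTop (Metric.sphere 0 1) →
      ∀ φ : C(Sph n, ℝ),
        Tendsto (fun k => ∫ x, φ x * D (L k) x ∂(sphArea n)) atTop (𝓝 (∫ x, φ x ∂μ)) := by
    intro L hL hu φ
    have h1 := (hμ.2 φ).comp (tendsto_near (Eventually.of_forall fun k => (hL k).isSuppC2) hu)
    refine h1.congr fun k => ?_
    simp only [Function.comp, hDd _ (hL k)]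
  constructor
  · rintro ⟨hν, h⟩
    obtain ⟨L, hL, hu⟩ := hK
    have := hμ.1
    refine ext_of_forall_integral_eq_of_IsFiniteMeasure fun φ => ?_
    exact tendsto_nhds_unique (h L hL hu φ.toContinuousMap) (hlim L hL hu φ.toContinuousMap)
  · rintro rfl
    exact ⟨hμ.1, hlim⟩

/-- For nonnegative densities which converge, the limit measure along sequences of smooth bodies
exists, is unique, and is the weak limit along `nearFilter`. -/
theorem existsUnique_isWeakLimitMeasure {K : ConvexBody (Amb n)} (hK : HasSmoothApprox K)
    {D : ConvexBody (Amb n) → Sph n → ℝ} {d : (Amb n → ℝ) → Sph n → ℝ}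
    (hDd : ∀ L, IsSmoothPosEven L → ∀ x, D L x = d (supp L) x)
    (hd : ConvergesNear (supp K) d) (hpos : ∀ f, IsSuppC2 f → ∀ x, 0 ≤ d f x) :
    (∃! μ, IsWeakLimitMeasure D K μ) ∧ IsNearLimit (supp K) d (limitMeasure D K) := by
  have := hK.neBot
  obtain ⟨μ, hμ⟩ := hd.exists_isNearLimit hpos
  have hiff := isWeakLimitMeasure_iff hK hDd hμ
  have h1 : IsWeakLimitMeasure D K μ := (hiff μ).2 rfl
  have h2 : limitMeasure D K = μ := (hiff _).1 (Classical.epsilon_spec ⟨μ, h1⟩)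
  exact ⟨⟨μ, h1, fun ν hν => (hiff ν).1 hν⟩, h2 ▸ hμ⟩

end WeakLimits

/-! ### Approximation by smooth bodies -/

section Approximation

variable {n : ℕ}

/-- A nonnegative sublinear function is the support function of the convex body it defines
(Hahn–Banach). -/
theorem exists_convexBody_supp_eq {g : Amb n → ℝ} (hom : ∀ t : ℝ, 0 < t → ∀ x, g (t • x) = t * g x)
    (hadd : ∀ x y, g (x + y) ≤ g x + g y) (hnn : ∀ x, 0 ≤ g x) {M : ℝ} (hM : ∀ x, g x ≤ M * ‖x‖) :
    ∃ L : ConvexBody (Amb n), supp L = g ∧ ∀ y, y ∈ L ↔ ∀ x, inner ℝ x y ≤ g x := by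
  have hg0 : g 0 = 0 := by
    have := hom 2 two_pos 0
    rw [smul_zero] at this
    linarith
  let S : Set (Amb n) := {y | ∀ x, inner ℝ x y ≤ g x}
  have h0 : (0 : Amb n) ∈ S := fun x => by simpa using hnn x
  have hS : S = ⋂ x, {y | inner ℝ x y ≤ g x} := by
    ext y
    simp [S]
  have hconv : Convex ℝ S := by
    rw [hS]
    refine convex_iInter fun x => ?_
    exact convex_halfSpace_le ⟨fun a b => inner_add_right _ _ _, fun c a => inner_smul_right _ _ _⟩ _
  have hclosed : IsClosed S := by
    rw [hS]
    exact isClosed_iInter fun x => isClosed_le (by fun_prop) continuous_const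
  have hbdd : Bornology.IsBounded S := by
    refine isBounded_iff_forall_norm_le.2 ⟨M, fun y hy => ?_⟩
    have h1 := (hy y).trans (hM y)
    rw [real_inner_self_eq_norm_sq] at h1
    rcases (norm_nonneg y).eq_or_lt with h2 | h2
    · rw [← h2]
      obtain ⟨e, he⟩ := exists_norm_eq (Amb n) zero_le_one
      have := (hnn e).trans (hM e)
      rwa [he, mul_one] at this
    · nlinarith
  let L : ConvexBody (Amb n) :=
    ⟨S, hconv, Metric.isCompact_of_isClosed_isBounded hclosed hbdd, ⟨0, h0⟩⟩
  refine ⟨L, funext fun x => ?_, fun y => Iff.rfl⟩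
  have hle : ∀ r ∈ (fun y : Amb n => inner ℝ x y) '' (L : Set (Amb n)), r ≤ g x := by
    rintro _ ⟨y, hy, rfl⟩
    exact hy x
  have hne : ((fun y : Amb n => inner ℝ x y) '' (L : Set (Amb n))).Nonempty := ⟨_, 0, h0, rfl⟩
  refine le_antisymm (csSup_le hne hle) ?_
  rcases eq_or_ne x 0 with rfl | hx
  · rw [hg0]
    exact le_csSup ⟨_, hle⟩ ⟨0, h0, inner_zero_left _⟩
  have hdom : ∀ v : (LinearPMap.mkSpanSingleton (σ := RingHom.id ℝ) x (g x) hx).domain,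
      LinearPMap.mkSpanSingleton (σ := RingHom.id ℝ) x (g x) hx v ≤ g v := by
    rintro ⟨v, hv⟩
    obtain ⟨c, rfl⟩ := Submodule.mem_span_singleton.1 hv
    rw [LinearPMap.mkSpanSingleton'_apply]
    simp only [RingHom.id_apply, smul_eq_mul]
    rcases lt_trichotomy c 0 with hc | rfl | hc
    · exact (mul_nonpos_of_nonpos_of_nonneg hc.le (hnn x)).trans (hnn _)
    · simp [hg0]
    · rw [hom c hc]
  obtain ⟨F, hF, hFg⟩ := exists_extension_of_le_sublinear _ g hom hadd hdom
  let y : Amb n := (InnerProductSpace.toDual ℝ (Amb n)).symm (LinearMap.toContinuousLinearMap F)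
  have hy : ∀ z, inner ℝ z y = F z := fun z => by
    rw [real_inner_comm]
    exact InnerProductSpace.toDual_symm_apply
  have hFx : F x = g x := by
    have := hF ⟨x, Submodule.mem_span_singleton_self x⟩
    rwa [LinearPMap.mkSpanSingleton_apply] at this
  refine le_csSup ⟨_, hle⟩ ⟨y, fun z => (hy z).trans_le (hFg z), ?_⟩
  exact (hy x).trans hFx

/-- The Hessian of a sublinear function is nonnegative in directions orthogonal to the base
point. -/
theorem IsHomC2.hess_nonneg_of_sublinear {g : Amb n → ℝ} (hg : IsHomC2 g)
    (hadd : ∀ x y, g (x + y) ≤ g x + g y) {x v : Amb n} (hx : ‖x‖ = 1)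
    (hxv : inner ℝ x v = 0) : 0 ≤ hess g x v v := by
  have hne : ∀ t : ℝ, x + t • v ≠ 0 := fun t h => by
    have h1 : inner ℝ x (x + t • v) = 0 := by rw [h, inner_zero_right]
    rw [inner_add_right, inner_smul_right, hxv, real_inner_self_eq_norm_sq, hx] at h1
    norm_num at h1
  have hline : ∀ t : ℝ, HasDerivAt (fun t : ℝ => x + t • v) v t := fun t => by
    simpa using ((hasDerivAt_id t).smul_const v).const_add x
  have hd : ∀ t : ℝ, HasDerivAt (fun t : ℝ => g (x + t • v)) (fderiv ℝ g (x + t • v) v) t :=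
    fun t => ((hg.contDiffAt (hne t)).differentiableAt two_ne_zero).hasFDerivAt.comp_hasDerivAt t
      (hline t)
  have hle : ∀ c : ℝ, 0 ≤ c → ∀ y, g (c • y) ≤ c * g y := fun c hc y => by
    rcases hc.eq_or_lt with rfl | hc
    · have := hg.hom 2 two_pos 0
      rw [smul_zero] at this
      rw [zero_smul]
      linarith
    · exact (hg.hom c hc y).le
  have hconv : ConvexOn ℝ Set.univ fun t : ℝ => g (x + t • v) := by
    refine ⟨convex_univ, fun s _ t _ a b ha hb hab => ?_⟩
    have e : x + (a • s + b • t) • v = a • (x + s • v) + b • (x + t • v) := by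
      have : x = (a + b) • x := by rw [hab, one_smul]
      nth_rewrite 1 [this]
      simp only [smul_eq_mul]
      module
    simp only
    rw [e]
    exact (hadd _ _).trans (add_le_add (hle a ha _) (hle b hb _))
  have hmono : Monotone fun t : ℝ => fderiv ℝ g (x + t • v) v := by
    have h1 := hconv.monotoneOn_deriv fun t _ => (hd t).differentiableAt
    rw [monotoneOn_univ] at h1
    have h2 : deriv (fun t : ℝ => g (x + t • v)) = fun t : ℝ => fderiv ℝ g (x + t • v) v :=
      funext fun t => (hd t).deriv
    rwa [h2] at h1
  have hdd : HasDerivAt (fun t : ℝ => fderiv ℝ g (x + t • v) v)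
      (fderiv ℝ (fderiv ℝ g) (x + (0 : ℝ) • v) v v) 0 := by
    have h1 := (differentiableAt_fderiv (hg.contDiffAt (hne 0))).hasFDerivAt.comp_hasDerivAt
      (0 : ℝ) (hline 0)
    exact ((ContinuousLinearMap.apply ℝ ℝ v).hasFDerivAt).comp_hasDerivAt (0 : ℝ) h1
  have h3 := hmono.deriv_nonneg (x := 0)
  rw [hdd.deriv] at h3
  simpa [hess] using h3

/-- The `ℓᵖ` norm, `p = 2m`, of the family of inner products with the points of `t`. -/
def lpSupp (t : Finset (Amb n)) (m : ℕ) (x : Amb n) : ℝ :=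
  (∑ y ∈ t, |inner ℝ x y| ^ ((2 * m : ℕ) : ℝ)) ^ (1 / ((2 * m : ℕ) : ℝ))

theorem lpSupp_nonneg (t : Finset (Amb n)) (m : ℕ) (x : Amb n) : 0 ≤ lpSupp t m x :=
  Real.rpow_nonneg (Finset.sum_nonneg fun _ _ => Real.rpow_nonneg (abs_nonneg _) _) _

theorem lpSupp_neg (t : Finset (Amb n)) (m : ℕ) (x : Amb n) : lpSupp t m (-x) = lpSupp t m x := by
  simp [lpSupp, inner_neg_left]

theorem lpSupp_add_le (t : Finset (Amb n)) {m : ℕ} (hm : m ≠ 0) (x y : Amb n) :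
    lpSupp t m (x + y) ≤ lpSupp t m x + lpSupp t m y := by
  have h1 : (1 : ℝ) ≤ ((2 * m : ℕ) : ℝ) := by exact_mod_cast (by omega : 1 ≤ 2 * m)
  simp only [lpSupp, inner_add_left]
  exact Real.Lp_add_le t _ _ h1

theorem lpSupp_smul (t : Finset (Amb n)) {m : ℕ} (hm : m ≠ 0) {c : ℝ} (hc : 0 < c) (x : Amb n) :
    lpSupp t m (c • x) = c * lpSupp t m x := by
  have h1 : ((2 * m : ℕ) : ℝ) ≠ 0 := by exact_mod_cast (by omega : 2 * m ≠ 0)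
  have h2 : ∀ y, |inner ℝ (c • x) y| ^ ((2 * m : ℕ) : ℝ)
      = c ^ ((2 * m : ℕ) : ℝ) * |inner ℝ x y| ^ ((2 * m : ℕ) : ℝ) := fun y => by
    rw [real_inner_smul_left, abs_mul, abs_of_pos hc, Real.mul_rpow hc.le (abs_nonneg _)]
  simp only [lpSupp, h2, ← Finset.mul_sum]
  rw [Real.mul_rpow (Real.rpow_nonneg hc.le _)
    (Finset.sum_nonneg fun _ _ => Real.rpow_nonneg (abs_nonneg _) _), ← Real.rpow_mul hc.le,
    mul_one_div_cancel h1, Real.rpow_one]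

theorem abs_inner_le_lpSupp {t : Finset (Amb n)} {m : ℕ} (hm : m ≠ 0) (x : Amb n) {y : Amb n}
    (hy : y ∈ t) : |inner ℝ x y| ≤ lpSupp t m x := by
  have h1 : ((2 * m : ℕ) : ℝ) ≠ 0 := by exact_mod_cast (by omega : 2 * m ≠ 0)
  have h2 := Finset.single_le_sum
    (f := fun y : Amb n => |inner ℝ x y| ^ ((2 * m : ℕ) : ℝ))
    (fun _ _ => Real.rpow_nonneg (abs_nonneg _) _) hy
  calc |inner ℝ x y| = (|inner ℝ x y| ^ ((2 * m : ℕ) : ℝ)) ^ (1 / ((2 * m : ℕ) : ℝ)) := by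
        rw [← Real.rpow_mul (abs_nonneg _), mul_one_div_cancel h1, Real.rpow_one]
    _ ≤ _ := Real.rpow_le_rpow (Real.rpow_nonneg (abs_nonneg _) _) h2 (by positivity)

theorem lpSupp_le {t : Finset (Amb n)} {m : ℕ} (hm : m ≠ 0) {x : Amb n} {M : ℝ} (hM : 0 ≤ M)
    (h : ∀ y ∈ t, |inner ℝ x y| ≤ M) :
    lpSupp t m x ≤ (t.card : ℝ) ^ (1 / ((2 * m : ℕ) : ℝ)) * M := by
  have h1 : ((2 * m : ℕ) : ℝ) ≠ 0 := by exact_mod_cast (by omega : 2 * m ≠ 0)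
  have h2 : ∑ y ∈ t, |inner ℝ x y| ^ ((2 * m : ℕ) : ℝ) ≤ t.card * M ^ ((2 * m : ℕ) : ℝ) := by
    rw [← nsmul_eq_mul]
    exact Finset.sum_le_card_nsmul _ _ _ fun y hy =>
      Real.rpow_le_rpow (abs_nonneg _) (h y hy) (Nat.cast_nonneg _)
  calc lpSupp t m x ≤ (t.card * M ^ ((2 * m : ℕ) : ℝ)) ^ (1 / ((2 * m : ℕ) : ℝ)) :=
        Real.rpow_le_rpow (Finset.sum_nonneg fun _ _ => Real.rpow_nonneg (abs_nonneg _) _) h2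
          (by positivity)
    _ = _ := by
        rw [Real.mul_rpow (Nat.cast_nonneg _) (Real.rpow_nonneg hM _), ← Real.rpow_mul hM,
          mul_one_div_cancel h1, Real.rpow_one]

theorem isHomC2_lpSupp {t : Finset (Amb n)} {m : ℕ} (hm : m ≠ 0)
    (hpos : ∀ x : Amb n, x ≠ 0 → ∃ y ∈ t, inner ℝ x y ≠ 0) : IsHomC2 (lpSupp t m) where
  hom c hc x := lpSupp_smul t hm hc x
  smooth := by
    have h1 : ∀ x : Amb n, ∑ y ∈ t, |inner ℝ x y| ^ ((2 * m : ℕ) : ℝ)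
        = ∑ y ∈ t, inner ℝ x y ^ (2 * m) := fun x => by
      refine Finset.sum_congr rfl fun y _ => ?_
      rw [Real.rpow_natCast, (even_two_mul m).pow_abs]
    have h2 : lpSupp t m
        = fun x : Amb n => (∑ y ∈ t, inner ℝ x y ^ (2 * m)) ^ (1 / ((2 * m : ℕ) : ℝ)) := by
      ext x
      rw [lpSupp, h1]
    rw [h2]
    refine ContDiffOn.rpow_const_of_ne (ContDiff.contDiffOn
      (ContDiff.sum fun y _ => (contDiff_id.inner ℝ contDiff_const).pow _)) fun x hx => ?_
    obtain ⟨y, hy, hxy⟩ := hpos x hx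
    exact (Finset.sum_pos' (fun z _ => (even_two_mul m).pow_nonneg _)
      ⟨y, hy, (even_two_mul m).pow_pos hxy⟩).ne'

theorem exists_supp_eq_inner (K : ConvexBody (Amb n)) (x : Amb n) :
    ∃ y ∈ K, supp K x = inner ℝ x y :=
  K.isCompact.exists_sSup_image_eq K.nonempty (by fun_prop)

theorem inner_le_supp (K : ConvexBody (Amb n)) (x : Amb n) {y : Amb n} (hy : y ∈ K) :
    inner ℝ x y ≤ supp K x :=
  le_csSup (K.isCompact.image (by fun_prop : Continuous fun y : Amb n => inner ℝ x y)).bddAbove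
    ⟨y, hy, rfl⟩

theorem IsOriginSymmetric.abs_inner_le_supp {K : ConvexBody (Amb n)} (hK : IsOriginSymmetric K)
    (x : Amb n) {y : Amb n} (hy : y ∈ K) : |inner ℝ x y| ≤ supp K x := by
  refine abs_le'.2 ⟨inner_le_supp K x hy, ?_⟩
  rw [← inner_neg_right]
  exact inner_le_supp K x (hK y hy)

theorem IsOriginSymmetric.supp_neg {K : ConvexBody (Amb n)} (hK : IsOriginSymmetric K)
    (x : Amb n) : supp K (-x) = supp K x := by
  have key : ∀ x, supp K (-x) ≤ supp K x := fun x => by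
    obtain ⟨y, hy, h⟩ := exists_supp_eq_inner K (-x)
    rw [h, inner_neg_left, ← inner_neg_right]
    exact inner_le_supp K x (hK y hy)
  exact le_antisymm (key x) (by simpa using key (-x))

/-- The body with support function `(∑ |x · y_j| ^ p) ^ (1 / p) + ε / 4 |x|`, for a finite net `y_j`
of `K` and a large even `p`, is smooth and close to `K`. The `ℓᵖ` norm exceeds the maximum of the
`|x · y_j|` by a factor at most `N ^ (1 / p)`, `N` being the number of points, and these are at most
`h_K` because `K` is symmetric. -/
theorem IsOriginSymmetric.exists_isSmoothPosEven_near {K : ConvexBody (Amb n)}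
    (hK : IsOriginSymmetric K) (hh : IsPosBdd (supp K)) {ε : ℝ} (hε : 0 < ε) :
    ∃ L : ConvexBody (Amb n), IsSmoothPosEven L ∧ ∀ x, ‖x‖ = 1 → |supp L x - supp K x| < ε := by
  obtain ⟨c, hc, M, hM⟩ := hh
  set δ := min (ε / 4) (c / 2) with hδ
  have hδ0 : 0 < δ := lt_min (by linarith) (by linarith)
  obtain ⟨s, hsK, hsf, hs⟩ := K.isCompact.finite_cover_balls hδ0
  obtain ⟨t, rfl⟩ := hsf.exists_finset_coe
  have hnet : ∀ x : Amb n, ‖x‖ = 1 → ∃ y ∈ t, supp K x - δ ≤ inner ℝ x y := fun x hx => by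
    obtain ⟨y, hy, h⟩ := exists_supp_eq_inner K x
    obtain ⟨z, hz, hyz⟩ := Set.mem_iUnion₂.1 (hs hy)
    refine ⟨z, hz, ?_⟩
    have h1 : inner ℝ x (y - z) ≤ δ := by
      refine (real_inner_le_norm _ _).trans ?_
      rw [hx, one_mul, ← dist_eq_norm]
      exact (Metric.mem_ball.1 hyz).le
    rw [inner_sub_right] at h1
    rw [h]
    linarith
  have hpos : ∀ x : Amb n, x ≠ 0 → ∃ y ∈ t, inner ℝ x y ≠ 0 := fun x hx => by
    obtain ⟨y, hy, h⟩ := hnet _ (norm_normalize hx)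
    refine ⟨y, hy, fun h0 => ?_⟩
    rw [real_inner_smul_left, h0, mul_zero] at h
    have h1 := (hM _ (norm_normalize hx)).1
    have h2 : δ ≤ c / 2 := min_le_right _ _
    linarith
  obtain ⟨e, he⟩ := exists_norm_eq (Amb n) zero_le_one
  have hM0 : 0 < M := hc.trans_le ((hM e he).1.trans (hM e he).2)
  have hcard : (t.card : ℝ) ≠ 0 := by
    obtain ⟨y, hy, -⟩ := hnet e he
    exact_mod_cast Finset.card_ne_zero_of_mem hy
  have hlim : Tendsto (fun m : ℕ => (t.card : ℝ) ^ (1 / ((2 * m : ℕ) : ℝ))) atTop (𝓝 1) := by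
    have h1 : Tendsto (fun m : ℕ => 1 / ((2 * m : ℕ) : ℝ)) atTop (𝓝 0) :=
      tendsto_one_div_atTop_nhds_zero_nat.comp (tendsto_id.const_mul_atTop' two_pos)
    have h2 := (Real.continuousAt_const_rpow hcard (b := 0)).tendsto.comp h1
    rwa [Real.rpow_zero] at h2
  obtain ⟨m, hm1, hm0⟩ := ((hlim.eventually (gt_mem_nhds
    (show (1 : ℝ) < 1 + ε / (4 * M) from lt_add_of_pos_right _ (by positivity)))).and
    (eventually_ne_atTop 0)).exists
  have hG := isHomC2_lpSupp hm0 hpos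
  set g : Amb n → ℝ := fun x => lpSupp t m x + ε / 4 * ‖x‖ with hg
  have hgC : IsHomC2 g := hG.add (isHomC2_norm.const_mul _)
  have hupper : ∀ x : Amb n, ‖x‖ = 1 → lpSupp t m x ≤ supp K x + ε / 4 := fun x hx => by
    have hx1 := hM x hx
    have hx0 : 0 ≤ supp K x := hc.le.trans hx1.1
    have h1 := lpSupp_le hm0 hx0 fun y hy => hK.abs_inner_le_supp x (hsK hy)
    have h2 : (t.card : ℝ) ^ (1 / ((2 * m : ℕ) : ℝ)) * supp K x
        ≤ (1 + ε / (4 * M)) * supp K x := mul_le_mul_of_nonneg_right hm1.le hx0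
    have h3 : ε / (4 * M) * supp K x ≤ ε / (4 * M) * M :=
      mul_le_mul_of_nonneg_left hx1.2 (by positivity)
    have h4 : ε / (4 * M) * M = ε / 4 := by field_simp
    linarith
  have hg0 : g 0 = 0 := by
    have := hgC.hom 2 two_pos 0
    rw [smul_zero] at this
    linarith
  have hadd : ∀ x y, g (x + y) ≤ g x + g y := fun x y => by
    have h1 := lpSupp_add_le t hm0 x y
    have h2 := mul_le_mul_of_nonneg_left (norm_add_le x y) (show 0 ≤ ε / 4 by linarith)
    simp only [hg]
    linarith
  have hbd : ∀ x, g x ≤ (M + ε / 2) * ‖x‖ := fun x => by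
    rcases eq_or_ne x 0 with rfl | hx
    · simp [hg0]
    · have hx' := norm_pos_iff.2 hx
      have h1 := hupper _ (norm_normalize hx)
      have h2 := (hM _ (norm_normalize hx)).2
      rw [lpSupp_smul t hm0 (inv_pos.2 hx')] at h1
      have h3 : ‖x‖⁻¹ * lpSupp t m x ≤ M + ε / 4 := by linarith
      rw [inv_mul_le_iff₀ hx'] at h3
      simp only [hg]
      linarith
  obtain ⟨L, hL, hmem⟩ := exists_convexBody_supp_eq hgC.hom hadd
    (fun x => add_nonneg (lpSupp_nonneg _ _ _) (by positivity)) hbd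
  refine ⟨L, ⟨fun y hy => ?_, hL ▸ hgC.smooth, fun x hx v hxv hv => ?_⟩, fun x hx => ?_⟩
  · rw [hmem] at hy ⊢
    intro x
    have h1 := hy (-x)
    rw [inner_neg_left] at h1
    rw [inner_neg_right]
    refine h1.trans_eq ?_
    simp only [hg, lpSupp_neg, norm_neg]
  · have hx0 := ne_zero_of_norm hx
    rw [hL, hess_add (hG.contDiffAt hx0) ((isHomC2_norm.const_mul _).contDiffAt hx0),
      hess_const_mul (isHomC2_norm.contDiffAt hx0), hess_norm hx, hxv, real_inner_self_eq_norm_sq]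
    have h1 := hG.hess_nonneg_of_sublinear (lpSupp_add_le t hm0) hx hxv
    have h2 := norm_pos_iff.2 hv
    have : 0 < ε / 4 * (‖v‖ ^ 2 - 0 * 0) := by
      rw [mul_zero, sub_zero]
      positivity
    linarith
  · obtain ⟨y, hy, h⟩ := hnet x hx
    have h1 := (le_abs_self _).trans (abs_inner_le_lpSupp (m := m) hm0 x hy)
    have h2 := hupper x hx
    have h3 : δ ≤ ε / 4 := min_le_left _ _
    rw [hL, abs_lt]
    simp only [hg, hx]
    constructor <;> linarith

theorem IsOriginSymmetric.hasSmoothApprox {K : ConvexBody (Amb n)}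
    (hK : IsOriginSymmetric K) (hh : IsPosBdd (supp K)) : HasSmoothApprox K := by
  choose L hL hLK using fun k : ℕ =>
    hK.exists_isSmoothPosEven_near hh (Nat.one_div_pos_of_nat (α := ℝ) (n := k))
  refine ⟨L, hL, Metric.tendstoUniformlyOn_iff.2 fun ε hε => ?_⟩
  filter_upwards [tendsto_one_div_add_atTop_nhds_zero_nat.eventually (gt_mem_nhds hε)]
    with k hk x hx
  rw [dist_comm, Real.dist_eq]
  exact (hLK k x (by simpa using hx)).trans hk

end Approximation

/-! ### Comparison of the Rayleigh quotients -/

section Rayleigh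

variable {n : ℕ}

theorem integrable_sph_continuousMap (φ : C(Sph n, ℝ)) (μ : Measure (Sph n)) [IsFiniteMeasure μ] :
    Integrable φ μ :=
  integrable_sph φ.continuous μ

theorem continuous_integral_sph (μ : Measure (Sph n)) [IsFiniteMeasure μ] :
    Continuous fun φ : C(Sph n, ℝ) => ∫ x, φ x ∂μ := by
  refine (LipschitzWith.of_dist_le' (K := μ.real Set.univ) fun φ ψ => ?_).continuous
  rw [Real.dist_eq, ← integral_sub (integrable_sph_continuousMap φ μ)
    (integrable_sph_continuousMap ψ μ), ← Real.norm_eq_abs, mul_comm]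
  exact norm_integral_le_of_norm_le_const
    (.of_forall fun x => by
      rw [Real.norm_eq_abs, ← Real.dist_eq]
      exact ContinuousMap.dist_apply_le_dist x)

/-- A sequence of smooth bodies approximating `K`, with the restrictions to the sphere of the
support functions and of their reciprocals as continuous functions. -/
structure ApproxSeq (K : ConvexBody (Amb n)) where
  /-- The approximating bodies. -/
  L : ℕ → ConvexBody (Amb n)
  /-- The support function of `K` on the sphere. -/
  h : C(Sph n, ℝ)
  /-- The reciprocal of the support function of `K`. -/
  hi : C(Sph n, ℝ)
  /-- The support functions of the approximating bodies on the sphere. -/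
  f : ℕ → C(Sph n, ℝ)
  /-- The reciprocals of the support functions of the approximating bodies. -/
  fi : ℕ → C(Sph n, ℝ)
  smooth : ∀ k, IsSmoothPosEven (L k)
  near : Tendsto (fun k => supp (L k)) atTop (nearFilter (supp K))
  h_apply : ∀ x, h x = supp K x
  hi_apply : ∀ x, hi x = (supp K x)⁻¹
  f_apply : ∀ k x, f k x = supp (L k) x
  fi_apply : ∀ k x, fi k x = (supp (L k) x)⁻¹
  h_pos : ∀ x : Sph n, 0 < supp K x
  f_pos : ∀ k, ∀ x : Sph n, 0 < supp (L k) x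
  f_tendsto : Tendsto f atTop (𝓝 h)
  fi_tendsto : Tendsto fi atTop (𝓝 hi)

theorem HasSmoothApprox.nonempty_approxSeq {K : ConvexBody (Amb n)} (hK : HasSmoothApprox K)
    (hh : IsPosBdd (supp K)) : Nonempty (ApproxSeq K) := by
  obtain ⟨c, hc, M, hM⟩ := hh
  obtain ⟨L, hL, hu⟩ := hK
  obtain ⟨k₀, hk₀⟩ := eventually_atTop.1 (Metric.tendstoUniformlyOn_iff.1 hu (c / 2) (half_pos hc))
  have hu' : TendstoUniformlyOn (fun k => supp (L (k + k₀))) (supp K) atTop (Metric.sphere 0 1) :=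
    fun s hs => (tendsto_add_atTop_nat k₀).eventually (hu s hs)
  have hlow : ∀ k, ∀ x : Sph n, c / 2 ≤ supp (L (k + k₀)) x := fun k x => by
    have h1 := hk₀ (k + k₀) (Nat.le_add_left _ _) x x.2
    rw [Real.dist_eq, abs_lt] at h1
    have h2 := (hM x (norm_sph x)).1
    linarith
  have hKlow : ∀ x : Sph n, c / 2 ≤ supp K x := fun x => by
    have h2 := (hM x (norm_sph x)).1
    linarith
  let f : ℕ → C(Sph n, ℝ) := fun k =>
    ⟨fun x => supp (L (k + k₀)) x, (hL (k + k₀)).isSuppC2.homC2.continuous_sph⟩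
  let h : C(Sph n, ℝ) := ⟨fun x => supp K x, continuousOn_iff_continuous_domRestrict.1
    (hu'.continuousOn (Frequently.of_forall fun k =>
      (hL (k + k₀)).isSuppC2.homC2.continuousOn.mono fun x hx h0 => by
        rw [Set.mem_singleton_iff] at h0
        simp [h0] at hx))⟩
  have hf : Tendsto f atTop (𝓝 h) := by
    rw [ContinuousMap.tendsto_iff_tendstoUniformly]
    exact tendstoUniformlyOn_iff_tendstoUniformly_comp_coe.1 hu'
  -- On `[c / 2, ∞)` the reciprocal agrees with a function which is continuous on all of `ℝ`.
  have hmax : ∀ t : ℝ, max t (c / 2) ≠ 0 := fun t => ((half_pos hc).trans_le (le_max_right _ _)).ne'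
  let j : C(ℝ, ℝ) :=
    ⟨fun t => (max t (c / 2))⁻¹, (continuous_id.max continuous_const).inv₀ hmax⟩
  exact ⟨{
    L := fun k => L (k + k₀)
    h := h
    hi := j.comp h
    f := f
    fi := fun k => j.comp (f k)
    smooth := fun k => hL _
    near := tendsto_near (Eventually.of_forall fun k => (hL _).isSuppC2) hu'
    h_apply := fun x => rfl
    hi_apply := fun x => by
      change (max (supp K x) (c / 2))⁻¹ = _
      rw [max_eq_left (hKlow x)]
    f_apply := fun k x => rfl
    fi_apply := fun k x => by
      change (max (supp (L (k + k₀)) x) (c / 2))⁻¹ = _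
      rw [max_eq_left (hlow k x)]
    h_pos := fun x => (half_pos hc).trans_le (hKlow x)
    f_pos := fun k x => (half_pos hc).trans_le (hlow k x)
    f_tendsto := hf
    fi_tendsto := ((ContinuousMap.continuous_postcomp j).tendsto h).comp hf }⟩

/-- The mixed measures `m_f(f_k) dS`, with first the limit `f → h` and then `k → ∞`, tend to `n`
times the surface area measure. -/
theorem IsPosBdd.tendsto_iterated_integral_mul_mDen {h : Amb n → ℝ} (hh : IsPosBdd h)
    [(nearFilter h).NeBot] {μ : Measure (Sph n)} (hμ : IsNearLimit h (fun f x => aDen f x) μ)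
    {f : ℕ → Amb n → ℝ} (hf : ∀ k, IsSuppC2 (f k)) (hfh : Tendsto f atTop (nearFilter h))
    {ψ : ℕ → C(Sph n, ℝ)} {ψ₀ : C(Sph n, ℝ)} (hψ : Tendsto ψ atTop (𝓝 ψ₀)) {F : ℕ → ℝ}
    (hF : ∀ k, Tendsto (fun g => ∫ x : Sph n, ψ k x * mDen g (f k) x ∂(sphArea n)) (nearFilter h)
      (𝓝 (F k))) :
    Tendsto F atTop (𝓝 (n * ∫ x, ψ₀ x ∂μ)) := by
  have hpair : ∀ φ : C(Sph n, ℝ), Tendsto (fun p : ℕ × (Amb n → ℝ) =>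
      ∫ x : Sph n, φ x * mDen p.2 (f p.1) x ∂(sphArea n)) (atTop ×ˢ nearFilter h)
      (𝓝 (n * ∫ x, φ x ∂μ)) := fun φ => by
    have h0 : Tendsto (fun f => ∫ x : Sph n, φ x * aDen f x ∂(sphArea n)) (nearFilter h)
        (𝓝 (∫ x, φ x ∂μ)) := hμ.2 φ
    have h1 := hh.tendsto_integral_mul_mDen_prod φ h0
    have h2 : Tendsto (fun p : ℕ × (Amb n → ℝ) => (p.2, f p.1)) (atTop ×ˢ nearFilter h)
        (nearFilter h ×ˢ nearFilter h) := tendsto_snd.prodMk (hfh.comp tendsto_fst)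
    simpa only [Function.comp_def] using h1.comp h2
  have hsupp : ∀ᶠ p : ℕ × (Amb n → ℝ) in atTop ×ˢ nearFilter h, IsSuppC2 p.2 :=
    tendsto_snd.eventually (eventually_isSuppC2 h)
  have hdiff : Tendsto (fun p : ℕ × (Amb n → ℝ) =>
      ∫ x : Sph n, ψ p.1 x * mDen p.2 (f p.1) x ∂(sphArea n)
        - ∫ x : Sph n, ψ₀ x * mDen p.2 (f p.1) x ∂(sphArea n)) (atTop ×ˢ nearFilter h) (𝓝 0) := by
    have h1 : Tendsto (fun p : ℕ × (Amb n → ℝ) => ‖ψ p.1 - ψ₀‖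
        * ∫ x : Sph n, (1 : C(Sph n, ℝ)) x * mDen p.2 (f p.1) x ∂(sphArea n))
        (atTop ×ˢ nearFilter h) (𝓝 0) := by
      have := ((tendsto_iff_norm_sub_tendsto_zero.1 hψ).comp tendsto_fst).mul (hpair 1)
      rwa [zero_mul] at this
    refine squeeze_zero_norm' ?_ h1
    filter_upwards [hsupp] with p hp
    have hc := hp.homC2.continuous_mDen (hf p.1).homC2
    have hint : ∀ φ : C(Sph n, ℝ),
        Integrable (fun x : Sph n => φ x * mDen p.2 (f p.1) x) (sphArea n) := fun φ =>
      integrable_sph (φ.continuous.mul hc) _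
    rw [← integral_sub (hint _) (hint _), ← integral_const_mul]
    refine norm_integral_le_of_norm_le ((hint 1).const_mul _) (.of_forall fun x => ?_)
    have h2 := hp.mDen_nonneg (hf p.1) (norm_sph x)
    rw [← sub_mul, norm_mul, Real.norm_of_nonneg h2, ContinuousMap.one_apply, one_mul]
    exact mul_le_mul_of_nonneg_right ((ψ p.1 - ψ₀).norm_coe_le_norm x) h2
  have hlim := hdiff.add (hpair ψ₀)
  simp only [sub_add_cancel, zero_add] at hlim
  refine Metric.tendsto_nhds.2 fun ε hε => ?_
  have h1 := (hlim.eventually (Metric.closedBall_mem_nhds _ (half_pos hε))).curry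
  filter_upwards [h1] with k hk
  have h2 := Metric.isClosed_closedBall.mem_of_tendsto (hF k) hk
  exact (Metric.mem_closedBall.1 h2).trans_lt (half_lt_self hε)

theorem IsPosBdd.isNearLimit_areaMeasure {K : ConvexBody (Amb n)} (hh : IsPosBdd (supp K))
    (hK : HasSmoothApprox K) : (∃! μ, IsWeakLimitMeasure areaDensity K μ) ∧
      IsNearLimit (supp K) (fun f x => aDen f x) (areaMeasure K) :=
  existsUnique_isWeakLimitMeasure hK (fun L _ x => areaDensity_eq L x) hh.convergesNear_aDen
    fun _ hf x => (hf.aDen_pos (norm_sph x)).le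

theorem IsPosBdd.isNearLimit_traceMeasure {K : ConvexBody (Amb n)} (hh : IsPosBdd (supp K))
    (hK : HasSmoothApprox K) : (∃! μ, IsWeakLimitMeasure traceDensity K μ) ∧
      IsNearLimit (supp K) (fun f x => mDen f (fun y => ‖y‖) x) (traceMeasure K) :=
  existsUnique_isWeakLimitMeasure hK (fun _ hL x => traceDensity_eq hL.isSuppC2.homC2 x)
    (hh.convergesNear_mDen isHomC2_norm) fun _ hf x => hf.mDen_nonneg isSuppC2_norm (norm_sph x)

theorem IsPosBdd.isNearLimit_energyMeasure {K : ConvexBody (Amb n)} (hh : IsPosBdd (supp K))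
    (hK : HasSmoothApprox K) {u : Sph n → ℝ} (hu : IsC2Sph u) :
    (∃! μ, IsWeakLimitMeasure (energyDensity u) K μ) ∧
      IsNearLimit (supp K) (eDen u) (energyMeasure K u) :=
  existsUnique_isWeakLimitMeasure hK (fun L _ x => energyDensity_eq u L x)
    (hh.convergesNear_eDen hu) fun _ hf x => hf.eDen_nonneg u x

/-- The substitution `z = u g` in the energy of the limit measures: `integral_eDen_mul` in the limit,
where the last integral has no expression by a limit measure of `K` and remains as a number. -/
theorem IsPosBdd.exists_energy_mul_eq {K : ConvexBody (Amb n)} (hh : IsPosBdd (supp K))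
    (hK : HasSmoothApprox K) {u : Sph n → ℝ} (hu : IsC2Sph u) {g : Amb n → ℝ} (hg : IsSuppC2 g) :
    ∃ F, Tendsto (fun f => ∫ x : Sph n, u x ^ 2 * g x * mDen f g x ∂(sphArea n))
        (nearFilter (supp K)) (𝓝 F) ∧
      (energyMeasure K fun x => u x * g x).real Set.univ
          - ∫ x : Sph n, (u x * g x) ^ 2 ∂(traceMeasure K)
        = ∫ x : Sph n, g x ^ 2 ∂(energyMeasure K u) - F := by
  have := hK.neBot
  have cu := hu.continuous
  have cg := hg.homC2.continuous_sph
  have hz : IsC2Sph fun x : Sph n => u x * g x := hu.mul hg.homC2.isC2Sph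
  obtain ⟨F, hF⟩ := (hh.convergesNear_mDen hg.homC2).lim
    ⟨fun x => u x ^ 2 * g x, (cu.pow 2).mul cg⟩
  refine ⟨F, hF, ?_⟩
  have h1 := (hh.isNearLimit_energyMeasure hK hz).2.2 1
  have h2 := (hh.isNearLimit_traceMeasure hK).2.2 ⟨fun x => (u x * g x) ^ 2, (cu.mul cg).pow 2⟩
  have h3 := (hh.isNearLimit_energyMeasure hK hu).2.2 ⟨fun x => g x ^ 2, cg.pow 2⟩
  have h4 := (h1.sub h2).congr' ((eventually_isSuppC2 (supp K)).mono fun f hf => by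
    simp only [ContinuousMap.one_apply, one_mul, ContinuousMap.coe_mk]
    exact integral_eDen_mul hu hf.homC2 hg.homC2)
  have h5 := tendsto_nhds_unique h4 (h3.sub hF)
  simpa using h5

variable {K : ConvexBody (Amb n)}

theorem ApproxSeq.isC2Sph_f (A : ApproxSeq K) (k : ℕ) : IsC2Sph (A.f k) :=
  (funext (A.f_apply k) : ⇑(A.f k) = _) ▸ (A.smooth k).isSuppC2.homC2.isC2Sph

theorem ApproxSeq.mul_f_mem (A : ApproxSeq K) (k : ℕ) {u : Sph n → ℝ} (hu : u ∈ C2Even n) :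
    (fun x => u x * A.f k x) ∈ C2Even n := by
  rw [mem_C2Even_iff] at hu ⊢
  refine ⟨hu.1.mul (A.isC2Sph_f k), fun x => ?_⟩
  simp only [hu.2, A.f_apply, coe_neg_sphere, (A.smooth k).1.supp_neg]

theorem ApproxSeq.mul_fi_mem (A : ApproxSeq K) (k : ℕ) {u : Sph n → ℝ} (hu : u ∈ C2Even n) :
    (fun x => u x * A.fi k x) ∈ C2Even n := by
  rw [mem_C2Even_iff] at hu ⊢
  refine ⟨hu.1.mul ?_, fun x => ?_⟩
  · have h1 := (A.smooth k).isSuppC2.homC2.isC2Sph.inv fun x => (A.f_pos k x).ne'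
    exact (funext (A.fi_apply k) : ⇑(A.fi k) = _) ▸ h1
  · simp only [hu.2, A.fi_apply, coe_neg_sphere, (A.smooth k).1.supp_neg]

theorem denL_eq (A : ApproxSeq K) [IsFiniteMeasure (areaMeasure K)] {u : Sph n → ℝ}
    (hu : Continuous u) :
    denL K u = ∫ x : Sph n, u x ^ 2 * A.h x ∂(areaMeasure K)
      - (∫ x : Sph n, A.h x ∂(areaMeasure K))⁻¹
        * (∫ x : Sph n, u x * A.h x ∂(areaMeasure K)) ^ 2 := by
  have hm : wMean K u = (∫ x : Sph n, A.h x ∂(areaMeasure K))⁻¹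
      * ∫ x : Sph n, u x * A.h x ∂(areaMeasure K) := by simp only [wMean, A.h_apply]
  have ch := A.h.continuous
  have hpt : ∀ x : Sph n, (u x - wMean K u) ^ 2 * supp K x
      = u x ^ 2 * A.h x - 2 * wMean K u * (u x * A.h x) + wMean K u ^ 2 * A.h x := fun x => by
    rw [A.h_apply]; ring
  rw [denL]
  simp_rw [hpt]
  rw [integral_add (integrable_sph (by fun_prop) _) (integrable_sph (by fun_prop) _),
    integral_sub (integrable_sph (by fun_prop) _) (integrable_sph (by fun_prop) _),
    integral_const_mul, integral_const_mul, hm]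
  -- Should the integral of `h` vanish, both sides reduce to the first term, as `0⁻¹ = 0`.
  rcases eq_or_ne (∫ x : Sph n, A.h x ∂(areaMeasure K)) 0 with h0 | h0
  · simp [h0]
  · field_simp
    ring

/-- The quotient of `z_k = u h_k` for `λ(K)` tends to the quotient of `u` for `λ(-L_K)`:
the numerators. -/
theorem ApproxSeq.tendsto_numK (A : ApproxSeq K) (hh : IsPosBdd (supp K)) (hK : HasSmoothApprox K)
    {u : Sph n → ℝ} (hu : IsC2Sph u) :
    Tendsto (fun k => numK K fun x => u x * A.f k x) atTop (𝓝 (numL K u)) := by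
  have := hK.neBot
  have hμ := (hh.isNearLimit_areaMeasure hK).2
  have := hμ.1
  have := (hh.isNearLimit_energyMeasure hK hu).2.1
  let U : C(Sph n, ℝ) := ⟨u, hu.continuous⟩
  choose F hF hFe using fun k => hh.exists_energy_mul_eq hK hu (A.smooth k).isSuppC2
  have h1 : Tendsto F atTop (𝓝 (n * ∫ x, (U ^ 2 * A.h) x ∂(areaMeasure K))) := by
    refine hh.tendsto_iterated_integral_mul_mDen hμ (fun k => (A.smooth k).isSuppC2) A.near
      (ψ := fun k => U ^ 2 * A.f k) (A.f_tendsto.const_mul _) fun k => ?_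
    simpa [U, A.f_apply] using hF k
  have h2 : Tendsto (fun k => ∫ x, (A.f k ^ 2) x ∂(energyMeasure K u)) atTop
      (𝓝 (∫ x, (A.h ^ 2) x ∂(energyMeasure K u))) :=
    ((continuous_integral_sph _).tendsto _).comp (A.f_tendsto.pow 2)
  have h3 : Tendsto (fun k => ∫ x, ((U * A.f k) ^ 2 * A.hi) x ∂(areaMeasure K)) atTop
      (𝓝 (∫ x, ((U * A.h) ^ 2 * A.hi) x ∂(areaMeasure K))) :=
    ((continuous_integral_sph _).tendsto _).comp
      (((A.f_tendsto.const_mul U).pow 2).mul_const _)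
  have e3 : ∀ x, ((U * A.h) ^ 2 * A.hi) x = (U ^ 2 * A.h) x := fun x => by
    have := (A.h_pos x).ne'
    simp only [ContinuousMap.mul_apply, ContinuousMap.pow_apply, A.hi_apply, A.h_apply]
    field_simp
  have h4 := (h2.sub h1).add (h3.const_mul (n : ℝ))
  simp_rw [e3] at h4
  rw [sub_add_cancel] at h4
  have e4 : ∫ x, (A.h ^ 2) x ∂(energyMeasure K u) = numL K u := by
    simp [numL, A.h_apply]
  rw [← e4]
  refine h4.congr fun k => ?_
  have e5 : (fun x => u x * A.f k x) = fun x : Sph n => u x * supp (A.L k) x :=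
    funext fun x => by rw [A.f_apply]
  rw [e5, numK, hFe]
  simp [U, A.f_apply, A.hi_apply]

/-- The quotient of `z_k = u h_k` for `λ(K)` tends to the quotient of `u` for `λ(-L_K)`:
the denominators. -/
theorem ApproxSeq.tendsto_denK (A : ApproxSeq K) [IsFiniteMeasure (areaMeasure K)]
    {u : Sph n → ℝ} (hu : Continuous u) :
    Tendsto (fun k => denK K fun x => u x * A.f k x) atTop (𝓝 (denL K u)) := by
  let U : C(Sph n, ℝ) := ⟨u, hu⟩
  have h1 : Tendsto (fun k => ∫ x, ((U * A.f k) ^ 2 * A.hi) x ∂(areaMeasure K)) atTop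
      (𝓝 (∫ x, ((U * A.h) ^ 2 * A.hi) x ∂(areaMeasure K))) :=
    ((continuous_integral_sph _).tendsto _).comp
      (((A.f_tendsto.const_mul U).pow 2).mul_const _)
  have h2 : Tendsto (fun k => ∫ x, (U * A.f k) x ∂(areaMeasure K)) atTop
      (𝓝 (∫ x, (U * A.h) x ∂(areaMeasure K))) :=
    ((continuous_integral_sph _).tendsto _).comp (A.f_tendsto.const_mul U)
  have e1 : ∀ x, ((U * A.h) ^ 2 * A.hi) x = u x ^ 2 * A.h x := fun x => by
    have := (A.h_pos x).ne'
    simp only [ContinuousMap.mul_apply, ContinuousMap.pow_apply, A.hi_apply, A.h_apply, U,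
      ContinuousMap.coe_mk]
    field_simp
  simp_rw [e1] at h1
  rw [denL_eq A hu]
  refine (h1.sub ((h2.pow 2).const_mul _)).congr fun k => ?_
  simp [denK, U, A.h_apply, A.hi_apply]

/-- The quotient of `u_k = z / h_k` for `λ(-L_K)` tends to the quotient of `z` for `λ(K)`:
the numerators. -/
theorem ApproxSeq.tendsto_numL (A : ApproxSeq K) (hh : IsPosBdd (supp K)) (hK : HasSmoothApprox K)
    {z : Sph n → ℝ} (hz : z ∈ C2Even n) :
    Tendsto (fun k => numL K fun x => z x * A.fi k x) atTop (𝓝 (numK K z)) := by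
  have := hK.neBot
  have hμ := (hh.isNearLimit_areaMeasure hK).2
  have := hμ.1
  have hu : ∀ k, IsC2Sph fun x => z x * A.fi k x := fun k =>
    (mem_C2Even_iff.1 (A.mul_fi_mem k hz)).1
  have hfin : ∀ k, IsFiniteMeasure (energyMeasure K fun x => z x * A.fi k x) := fun k =>
    (hh.isNearLimit_energyMeasure hK (hu k)).2.1
  let Z : C(Sph n, ℝ) := ⟨z, (mem_C2Even_iff.1 hz).1.continuous⟩
  choose F hF hFe using fun k => hh.exists_energy_mul_eq hK (hu k) (A.smooth k).isSuppC2
  have ez : ∀ k, (fun x : Sph n => z x * A.fi k x * supp (A.L k) x) = z := fun k => by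
    ext x
    rw [A.fi_apply, inv_mul_cancel_right₀ (A.f_pos k x).ne']
  have h1 : Tendsto F atTop (𝓝 (n * ∫ x, (Z ^ 2 * A.hi) x ∂(areaMeasure K))) := by
    refine hh.tendsto_iterated_integral_mul_mDen hμ (fun k => (A.smooth k).isSuppC2) A.near
      (ψ := fun k => Z ^ 2 * A.fi k) (A.fi_tendsto.const_mul _) fun k => ?_
    refine (hF k).congr fun g => integral_congr_ae (.of_forall fun x => ?_)
    have := (A.f_pos k x).ne'
    simp only [ContinuousMap.mul_apply, ContinuousMap.pow_apply, A.fi_apply, Z,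
      ContinuousMap.coe_mk]
    field_simp
  -- The energy of `u_k` weighted by `h_k²` in place of `h²`.
  have h2 : Tendsto (fun k => ∫ x, (A.f k ^ 2) x ∂(energyMeasure K fun x => z x * A.fi k x)) atTop
      (𝓝 (numK K z)) := by
    have e : numK K z = (energyMeasure K z).real Set.univ - ∫ x, z x ^ 2 ∂(traceMeasure K)
        + n * ∫ x, (Z ^ 2 * A.hi) x ∂(areaMeasure K) := by
      simp [numK, Z, A.hi_apply]
    rw [e]
    refine (h1.const_add _).congr fun k => ?_
    have h3 := hFe k
    rw [ez] at h3
    have e1 : ∀ x : Sph n, (z x * A.fi k x * supp (A.L k) x) ^ 2 = z x ^ 2 := fun x => by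
      rw [congrFun (ez k) x]
    simp only [e1] at h3
    simp only [ContinuousMap.pow_apply, A.f_apply]
    linarith
  -- The measures depend on `k`, but their weighted masses converge, so that replacing `h_k²` by `h²`
  -- costs at most `sup |h² / h_k² - 1|` times a bounded quantity.
  have h4 : Tendsto (fun k => ‖A.h ^ 2 * A.fi k ^ 2 - 1‖) atTop (𝓝 0) := by
    have h5 := ((A.fi_tendsto.pow 2).const_mul (A.h ^ 2))
    have e : A.h ^ 2 * A.hi ^ 2 = 1 := by
      ext x
      have := (A.h_pos x).ne'
      simp only [ContinuousMap.mul_apply, ContinuousMap.pow_apply, A.hi_apply, A.h_apply,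
        ContinuousMap.one_apply]
      field_simp
    rw [e] at h5
    exact tendsto_iff_norm_sub_tendsto_zero.1 h5
  have h5 : Tendsto (fun k => (numL K fun x => z x * A.fi k x)
      - ∫ x, (A.f k ^ 2) x ∂(energyMeasure K fun x => z x * A.fi k x)) atTop (𝓝 0) := by
    have h6 := h4.mul h2
    rw [zero_mul] at h6
    refine squeeze_zero_norm (fun k => ?_) h6
    have e : (numL K fun x => z x * A.fi k x)
        = ∫ x, (A.h ^ 2) x ∂(energyMeasure K fun x => z x * A.fi k x) := by
      simp [numL, A.h_apply]
    rw [e, ← integral_sub (integrable_sph_continuousMap _ _) (integrable_sph_continuousMap _ _),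
      ← integral_const_mul]
    refine norm_integral_le_of_norm_le ((integrable_sph_continuousMap _ _).const_mul _)
      (.of_forall fun x => ?_)
    have e1 : (A.h ^ 2) x - (A.f k ^ 2) x
        = (A.h ^ 2 * A.fi k ^ 2 - 1 : C(Sph n, ℝ)) x * (A.f k ^ 2) x := by
      have := (A.f_pos k x).ne'
      simp only [ContinuousMap.mul_apply, ContinuousMap.pow_apply, ContinuousMap.sub_apply,
        A.fi_apply, A.f_apply, ContinuousMap.one_apply]
      field_simp
    rw [e1, norm_mul, Real.norm_of_nonneg (r := (A.f k ^ 2) x) (sq_nonneg (A.f k x))]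
    exact mul_le_mul_of_nonneg_right (ContinuousMap.norm_coe_le_norm _ x) (sq_nonneg (A.f k x))
  simpa using h5.add h2

/-- The quotient of `u_k = z / h_k` for `λ(-L_K)` tends to the quotient of `z` for `λ(K)`:
the denominators. -/
theorem ApproxSeq.tendsto_denL (A : ApproxSeq K) [IsFiniteMeasure (areaMeasure K)]
    {z : Sph n → ℝ} (hz : Continuous z) :
    Tendsto (fun k => denL K fun x => z x * A.fi k x) atTop (𝓝 (denK K z)) := by
  let Z : C(Sph n, ℝ) := ⟨z, hz⟩
  have h1 : Tendsto (fun k => ∫ x, ((Z * A.fi k) ^ 2 * A.h) x ∂(areaMeasure K)) atTop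
      (𝓝 (∫ x, ((Z * A.hi) ^ 2 * A.h) x ∂(areaMeasure K))) :=
    ((continuous_integral_sph _).tendsto _).comp
      (((A.fi_tendsto.const_mul Z).pow 2).mul_const _)
  have h2 : Tendsto (fun k => ∫ x, (Z * A.fi k * A.h) x ∂(areaMeasure K)) atTop
      (𝓝 (∫ x, (Z * A.hi * A.h) x ∂(areaMeasure K))) :=
    ((continuous_integral_sph _).tendsto _).comp ((A.fi_tendsto.const_mul Z).mul_const _)
  have e1 : ∀ x, ((Z * A.hi) ^ 2 * A.h) x = z x ^ 2 * (supp K x)⁻¹ := fun x => by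
    have := (A.h_pos x).ne'
    simp only [ContinuousMap.mul_apply, ContinuousMap.pow_apply, A.hi_apply, A.h_apply, Z,
      ContinuousMap.coe_mk]
    field_simp
  have e2 : ∀ x, (Z * A.hi * A.h) x = z x := fun x => by
    have := (A.h_pos x).ne'
    simp only [ContinuousMap.mul_apply, A.hi_apply, A.h_apply, Z, ContinuousMap.coe_mk]
    field_simp
  simp_rw [e1] at h1
  simp_rw [e2] at h2
  have h3 := h1.sub ((h2.pow 2).const_mul (∫ x : Sph n, A.h x ∂(areaMeasure K))⁻¹)
  have e3 : denK K z = ∫ x : Sph n, z x ^ 2 * (supp K x)⁻¹ ∂(areaMeasure K)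
      - (∫ x : Sph n, A.h x ∂(areaMeasure K))⁻¹ * (∫ x, z x ∂(areaMeasure K)) ^ 2 := by
    simp only [denK, A.h_apply]
  rw [e3]
  refine h3.congr fun k => ?_
  rw [denL_eq A (u := fun x => z x * A.fi k x) (hz.mul (A.fi k).continuous)]
  simp [Z]

/-- A lower bound for quotients with nonzero denominators passes to the limit. -/
theorem le_coe_div_of_tendsto {c : EReal} {a b : ℕ → ℝ} {a₀ b₀ : ℝ} (ha : Tendsto a atTop (𝓝 a₀))
    (hb : Tendsto b atTop (𝓝 b₀)) (hb₀ : b₀ ≠ 0)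
    (hc : ∀ k, b k ≠ 0 → c ≤ ((a k / b k : ℝ) : EReal)) : c ≤ ((a₀ / b₀ : ℝ) : EReal) := by
  refine ge_of_tendsto (EReal.tendsto_coe.2 (ha.div hb hb₀)) ?_
  filter_upwards [hb.eventually_ne hb₀] with k hk using hc k hk

theorem ApproxSeq.lambdaL_eq_lambdaK (A : ApproxSeq K) (hh : IsPosBdd (supp K))
    (hK : HasSmoothApprox K) : lambdaL K = lambdaK K := by
  have := (hh.isNearLimit_areaMeasure hK).2.1
  refine le_antisymm (le_iInf₂ fun z hz => ?_) (le_iInf₂ fun u hu => ?_)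
  · refine le_coe_div_of_tendsto (A.tendsto_numL hh hK hz.1)
      (A.tendsto_denL (mem_C2Even_iff.1 hz.1).1.continuous) hz.2 fun k hk => ?_
    exact iInf₂_le _ ⟨A.mul_fi_mem k hz.1, hk⟩
  · refine le_coe_div_of_tendsto (A.tendsto_numK hh hK (mem_C2Even_iff.1 hu.1).1)
      (A.tendsto_denK (mem_C2Even_iff.1 hu.1).1.continuous) hu.2 fun k hk => ?_
    exact iInf₂_le _ ⟨A.mul_f_mem k hu.1, hk⟩

end Rayleigh

end HBM

end

theorem mainTheorem5 (n : ℕ) (hn : 1 ≤ n) (K : ConvexBody (EuclideanSpace ℝ (Fin (n + 1))))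
    (hK : HBM.IsOriginSymmetric K) (C : ℝ) (hC : 0 < C)
    (hKC : ∀ x : EuclideanSpace ℝ (Fin (n + 1)), ‖x‖ = 1 →
      C⁻¹ ≤ HBM.supp K x ∧ HBM.supp K x ≤ C) :
    (∃! μ, HBM.IsWeakLimitMeasure HBM.areaDensity K μ) ∧
    (∃! μ, HBM.IsWeakLimitMeasure HBM.traceDensity K μ) ∧
    (∀ u ∈ HBM.C2Even n, ∃! μ, HBM.IsWeakLimitMeasure (HBM.energyDensity u) K μ) ∧
    HBM.lambdaL K = HBM.lambdaK K := by
  have hh : HBM.IsPosBdd (HBM.supp K) := ⟨C⁻¹, inv_pos.2 hC, C, hKC⟩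
  have hS := hK.hasSmoothApprox hh
  obtain ⟨A⟩ := hS.nonempty_approxSeq hh
  exact ⟨(hh.isNearLimit_areaMeasure hS).1, (hh.isNearLimit_traceMeasure hS).1,
    fun u hu => (hh.isNearLimit_energyMeasure hS (HBM.mem_C2Even_iff.1 hu).1).1,
    A.lambdaL_eq_lambdaK hh hS⟩
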